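/- **Setting.** Let $p\ge1$, $k\ge2$, and for $y\in\mathbb R$ write $[y]_+=\max\{y,0\}$, $[y]_-=\min\{y,0\}$, $\mathbf 1^+(y)=\mathbf 1\{y\ge0\}$, $\mathbf 1^-(y)=\mathbf 1\{y<0\}$. A superscript $\pm$ means that the statement holds for both signs. For each sample size $n$ let $z_t=z_{n,t}=(y_t,x_t^{\top})^{\top}$, $t\ge -k+1$, be an $\mathbb R\times\mathbb R^{p-1}$-valued process, with possibly random initial values at $t=-k+1,\dots,0$ (these, and hence the process, may depend on $n$), generated by a canonical censored and kinked structural VAR (CKSVAR): with $y_t^{\pm}=[y_t]_\pm$, $$\begin{bmatrix}y_t\\x_t\end{bmatrix}=c+\sum_{i=1}^k\bigl(\phi_i^+y_{t-i}^++\phi_i^-y_{t-i}^-+\Phi_i^xx_{t-i}\bigr)+u_t,\qquad t\ge1,$$ where $c,\phi_i^\pm\in\mathbb R^p$, $\Phi_i^x\in\mathbb R^{p\times(p-1)}$, and $(u_t)_{t\ge1}$ is a random sequence in $\mathbb R^p$ not depending on $n$. Put $\Phi_i^\pm=[\phi_i^\pm,\Phi_i^x]$, $\Phi^\pm(\lambda)=I_p-\sum_{i=1}^k\Phi_i^\pm\lambda^i$,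 $\Pi^\pm=-\Phi^\pm(1)=[\pi^\pm,\Pi^x]$, $\Gamma_i^\pm=-\sum_{j=i+1}^k\Phi_j^\pm$, $\Gamma_i=-\sum_{j=i+1}^k[\phi_j^+,\phi_j^-,\Phi_j^x]$ for $1\le i\le k-1$, $\Gamma^\pm(1)=I_p-\sum_{i=1}^{k-1}\Gamma_i^\pm$ and $\Gamma(1;y)=\Gamma^+(1)\mathbf 1^+(y)+\Gamma^-(1)\mathbf 1^-(y)$. $D[0,1]$ is the space of cadlag functions $[0,1]\to\mathbb R^p$ with the uniform topology. A (possibly $n$-dependent) process $w_t$ is called $I^*(0)$ if $n^{-1/2}\max_{1\le t\le n}\|w_t\|\to0$ in probability. The joint spectral radius of a bounded set $\mathcal A$ of square matrices is $\rho_{\rm JSR}(\mathcal A)=\limsup_{t\to\infty}\sup\{\rho(B)^{1/t}:B\text{ a product of }t\text{ elements of }\mathcal A\}$, $\rho$ being the spectral radius. **Assumptions.** 1. For some $\delta>0$, $\sup_{t\ge1}E\|u_t\|^{2+\delta}<\infty$, and $n^{-1/2}\sum_{t=1}^{\lfloor n\lambda\rfloor}u_t$ converges weakly on $D[0,1]$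 to $U(\lambda)$, a $p$-dimensional Brownian motion with positive definite variance matrix. 2. $\det\Phi^\pm(\lambda)$ has $q^\pm$ roots at $\lambda=1$ (with multiplicity), all its other roots satisfy $|\lambda|>1$, $\operatorname{rank}\Pi^\pm=p-q^\pm$, and $c$ lies in the column spaces of $\Pi^+$ and of $\Pi^-$. 3. $\operatorname{rank}\Pi^+=\operatorname{rank}\Pi^-=\operatorname{rank}\Pi^x=r$. Consequently $\Pi^x=\alpha\beta_x^{\top}$ and $\pi^\pm=\Pi^x\theta^\pm$ with $\alpha\in\mathbb R^{p\times r}$, $\beta_x\in\mathbb R^{(p-1)\times r}$ of rank $r$ and $\theta^\pm\in\mathbb R^{p-1}$; fix any such choice, and full-column-rank matrices $\alpha_\perp\in\mathbb R^{p\times(p-r)}$, $\beta_{x,\perp}\in\mathbb R^{(p-1)\times(p-1-r)}$ with $\alpha_\perp^{\top}\alpha=0$, $\beta_{x,\perp}^{\top}\beta_x=0$. Set $\theta(y)=\theta^+\mathbf 1^+(y)+\theta^-\mathbf 1^-(y)$, $$\beta(y)^{\top}=\beta_x^{\top}[\theta(y),I_{p-1}],\quad \beta_\perp(y)=\begin{bmatrix}1&0\\-\theta(y)&\beta_{x,\perp}\end{bmatrix},\quad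 P_{\beta_\perp}(y)=\beta_\perp(y)\bigl[\alpha_\perp^{\top}\Gamma(1;y)\beta_\perp(y)\bigr]^{-1}\alpha_\perp^{\top},$$ $$\boldsymbol\alpha=\begin{bmatrix}\alpha&\Gamma_1&\cdots&\Gamma_{k-1}\\&I_{p+1}\\&&\ddots\\&&&I_{p+1}\end{bmatrix},\quad \boldsymbol\beta(y)^{\top}=\begin{bmatrix}\beta(y)^{\top}\\S(y)&-I_{p+1}\\&I_{p+1}&-I_{p+1}\\&&\ddots&\ddots\\&&&I_{p+1}&-I_{p+1}\end{bmatrix},\quad S(y)=\begin{bmatrix}\mathbf 1^+(y)&0\\\mathbf 1^-(y)&0\\0&I_{p-1}\end{bmatrix}.$$ 4. $\rho_{\rm JSR}\bigl(\{I+\boldsymbol\beta(+1)^{\top}\boldsymbol\alpha,\ I+\boldsymbol\beta(-1)^{\top}\boldsymbol\alpha\}\bigr)<1$. 5. $\operatorname{sgn}\det\alpha_\perp^{\top}\Gamma(1;+1)\beta_\perp(+1)=\operatorname{sgn}\det\alpha_\perp^{\top}\Gamma(1;-1)\beta_\perp(-1)\ne0$. 6. The $(2+\delta)$-th absolute moments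 of $\beta(y_t)^{\top}z_t$, $t\in\{-k+1,\dots,0\}$, and of $\Delta z_t=z_t-z_{t-1}$, $t\in\{-k+2,\dots,0\}$, are bounded uniformly in $t$ and $n$; and $n^{-1/2}z_0\to\mathcal Z_0=(\mathcal Y_0,\mathcal X_0^{\top})^{\top}$ in probability, where $\mathcal Z_0$ is non-random and $\pi^+[\mathcal Y_0]_++\pi^-[\mathcal Y_0]_-+\Pi^x\mathcal X_0=0$. **Theorem (kinked cointegration).** Let $\vartheta^{\top}=e_1^{\top}P_{\beta_\perp}(+1)$ and $U_0(\lambda)=\Gamma(1;\mathcal Y_0)\mathcal Z_0+U(\lambda)$. Then: (i) $\xi_t=\beta(y_t)^{\top}z_t$ and $\Delta z_t$ are $I^*(0)$; (ii) $n^{-1/2}z_{\lfloor n\lambda\rfloor}$ converges weakly on $D[0,1]$ to the process $Z(\lambda)=(Y(\lambda),X(\lambda)^{\top})^{\top}$ with $$Z(\lambda)=P_{\beta_\perp}[Y(\lambda)]\,U_0(\lambda)=P_{\beta_\perp}[\vartheta^{\top}U_0(\lambda)]\,U_0(\lambda),$$ and $\operatorname{sgn}Y(\lambda)=\operatorname{sgn}\vartheta^{\top}U_0(\lambda)$.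 -/

import Mathlib

open MeasureTheory ProbabilityTheory Filter Topology Matrix
open scoped ENNReal NNReal unitInterval UniformConvergence Polynomial

noncomputable section

/-! ### The space `D[0,1]` with the uniform topology -/

/-- Right-continuous with left limits. -/
def IsCadlag {E : Type*} [TopologicalSpace E] (f : I → E) : Prop :=
  ∀ t : I, ContinuousWithinAt f (Set.Ici t) t ∧ ∃ l : E, Tendsto f (𝓝[<] t) (𝓝 l)

/-- `D_E[0,1]`: the cadlag functions `[0,1] → E`, with the topology of uniform convergence
(the metric is the supremum distance) and its Borel σ-algebra. -/
def CadlagPath (E : Type*) [PseudoEMetricSpace E] : Type _ :=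
  {f : I →ᵤ E // IsCadlag (UniformFun.toFun f)}

namespace CadlagPath

variable {E : Type*} [PseudoEMetricSpace E]

instance : PseudoEMetricSpace (CadlagPath E) :=
  inferInstanceAs (PseudoEMetricSpace {f : I →ᵤ E // IsCadlag (UniformFun.toFun f)})

instance : MeasurableSpace (CadlagPath E) := borel _

instance : BorelSpace (CadlagPath E) := ⟨rfl⟩

instance : CoeFun (CadlagPath E) (fun _ => I → E) := ⟨fun f => UniformFun.toFun f.1⟩

end CadlagPath

theorem isCadlag_step {E : Type*} [TopologicalSpace E] (n : ℕ) (f : ℕ → E) :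
    IsCadlag (fun s : I => f ⌊(n : ℝ) * (s : ℝ)⌋₊) := by
  intro t
  have hc : Continuous (fun s : I => (n : ℝ) * (s : ℝ)) := by fun_prop
  have hn : (0 : ℝ) ≤ n := Nat.cast_nonneg n
  constructor
  · have hconst : ContinuousWithinAt (fun _ : I => f ⌊(n : ℝ) * (t : ℝ)⌋₊) (Set.Ici t) t :=
      continuousWithinAt_const
    refine hconst.congr_of_eventuallyEq ?_ rfl
    have h1 : ∀ᶠ s : I in 𝓝[≥] t, (n : ℝ) * (s : ℝ) < ⌊(n : ℝ) * (t : ℝ)⌋₊ + 1 :=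
      (hc.continuousAt.eventually_lt continuousAt_const
        (Nat.lt_floor_add_one _)).filter_mono nhdsWithin_le_nhds
    filter_upwards [h1, self_mem_nhdsWithin] with s hs hts
    have h2 : (t : ℝ) ≤ s := hts
    congr 1
    rw [Nat.floor_eq_iff (mul_nonneg hn s.2.1)]
    exact ⟨(Nat.floor_le (mul_nonneg hn t.2.1)).trans (mul_le_mul_of_nonneg_left h2 hn), hs⟩
  · refine ⟨f (⌈(n : ℝ) * (t : ℝ)⌉₊ - 1), tendsto_const_nhds.congr' ?_⟩
    rcases (mul_nonneg hn t.2.1).eq_or_lt with h0 | h0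
    · filter_upwards [self_mem_nhdsWithin] with s hs
      have h2 : (s : ℝ) ≤ t := le_of_lt hs
      have h3 : (n : ℝ) * (s : ℝ) = 0 :=
        le_antisymm ((mul_le_mul_of_nonneg_left h2 hn).trans h0.symm.le) (mul_nonneg hn s.2.1)
      simp [← h0, h3]
    · have hpos : 0 < ⌈(n : ℝ) * (t : ℝ)⌉₊ := Nat.ceil_pos.2 h0
      obtain ⟨l, hl⟩ : ∃ l, ⌈(n : ℝ) * (t : ℝ)⌉₊ = l + 1 := ⟨_, (Nat.sub_add_cancel hpos).symm⟩
      have hlt : (l : ℝ) < (n : ℝ) * (t : ℝ) := Nat.lt_ceil.1 (by omega)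
      have hle : (n : ℝ) * (t : ℝ) ≤ l + 1 := by
        have := Nat.le_ceil ((n : ℝ) * (t : ℝ)); rw [hl] at this; exact_mod_cast this
      have hn' : (0 : ℝ) < n := pos_of_mul_pos_left h0 t.2.1
      have h1 : ∀ᶠ s : I in 𝓝[<] t, (l : ℝ) < (n : ℝ) * (s : ℝ) :=
        (continuousAt_const.eventually_lt hc.continuousAt hlt).filter_mono nhdsWithin_le_nhds
      filter_upwards [h1, self_mem_nhdsWithin] with s hs hts
      have h2 : (s : ℝ) < t := hts
      have h3 : ⌊(n : ℝ) * (s : ℝ)⌋₊ = l := by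
        rw [Nat.floor_eq_iff (mul_nonneg hn s.2.1)]
        exact ⟨hs.le, (mul_lt_mul_of_pos_left h2 hn').trans_le hle⟩
      rw [hl, h3, Nat.add_sub_cancel]

/-- The path `s ↦ f ⌊n s⌋` as an element of `D[0,1]`. -/
def stepPath {E : Type*} [PseudoEMetricSpace E] (n : ℕ) (f : ℕ → E) : CadlagPath E :=
  ⟨UniformFun.ofFun (fun s : I => f ⌊(n : ℝ) * (s : ℝ)⌋₊), isCadlag_step n f⟩

/-! ### Brownian motion, order of integration, joint spectral radius -/

/-- A Brownian motion on `[0,1]`, started at `0`, with variance matrix `V`. -/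
structure IsBrownianMotion {ι Ω : Type*} [Fintype ι] [DecidableEq ι] [MeasurableSpace Ω]
    (B : I → Ω → EuclideanSpace ℝ ι) (V : Matrix ι ι ℝ) (P : Measure Ω) : Prop where
  zero : ∀ᵐ ω ∂P, B 0 ω = 0
  indep : HasIndepIncrements B P
  law : ∀ s t : I, s ≤ t →
    HasLaw (fun ω => B t ω - B s ω) (multivariateGaussian 0 (((t : ℝ) - (s : ℝ)) • V)) P
  cont : ∀ᵐ ω ∂P, Continuous (fun s => B s ω)

/-- `w ∼ I*(0)`, i.e. `sup_{1 ≤ t ≤ n} ‖w_t‖ = o_p(n^{1/2})`. The process may depend on the sample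
size: `w n t` is its value at time `t` for sample size `n`. -/
def IsStarStationary {E Ω : Type*} [NormedAddCommGroup E] [MeasurableSpace Ω] (P : Measure Ω)
    (w : ℕ → ℕ → Ω → E) : Prop :=
  TendstoInMeasure P
    (fun (n : ℕ) ω => (√(n : ℝ))⁻¹ * NNReal.toReal ((Finset.Icc 1 n).sup fun t => ‖w n t ω‖₊))
    atTop (fun _ => 0)

/-- The set of `t`-fold products of elements of `A`. -/
def matrixProducts {ι : Type*} [Fintype ι] [DecidableEq ι] (A : Set (Matrix ι ι ℝ)) (t : ℕ) :
    Set (Matrix ι ι ℝ) :=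
  {B | ∃ M : Fin t → Matrix ι ι ℝ, (∀ s, M s ∈ A) ∧ B = (List.ofFn M).prod}

/-- `limsup_t sup_{B ∈ A^t} ρ(B)^{1/t}`, where `ρ` is the largest modulus of a complex
eigenvalue. -/
def jointSpectralRadius {ι : Type*} [Fintype ι] [DecidableEq ι] (A : Set (Matrix ι ι ℝ)) : ℝ≥0∞ :=
  limsup (fun t : ℕ => ⨆ B ∈ matrixProducts A t,
    spectralRadius ℂ (B.map (algebraMap ℝ ℂ)) ^ (1 / (t : ℝ))) atTop

/-! ### The model -/

/-- Coordinates of `z = (y, x)`, with `x ∈ ℝ^m`; thus `p = m + 1`. -/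
abbrev ZIdx (m : ℕ) : Type := Unit ⊕ Fin m

/-- Coordinates of `z* = (y⁺, y⁻, x)`. -/
abbrev ZStarIdx (m : ℕ) : Type := Unit ⊕ Unit ⊕ Fin m

/-- The space `ℝ^p` in which `z = (y, x)` takes its values, with the Euclidean norm. -/
abbrev ZSpace (m : ℕ) : Type := EuclideanSpace ℝ (ZIdx m)

/-- The component `y` of `z = (y, x)`. -/
def yPart {m : ℕ} (z : ZSpace m) : ℝ := z (Sum.inl ())

/-- `z* = (y⁺, y⁻, x)`, where `y⁺ = max y 0` and `y⁻ = min y 0`. -/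
def zStar {m : ℕ} (z : ZSpace m) : ZStarIdx m → ℝ :=
  Sum.elim (fun _ => max (yPart z) 0) (Sum.elim (fun _ => min (yPart z) 0) (fun j => z (Sum.inr j)))

/-- A matrix acting on Euclidean vectors. -/
def act {ι κ : Type*} [Fintype κ] (A : Matrix ι κ ℝ) (v : EuclideanSpace ℝ κ) :
    EuclideanSpace ℝ ι :=
  WithLp.toLp 2 (A *ᵥ WithLp.ofLp v)

/-- The `(m+1) × (m+2)` matrix `[a, b, C]` with columns `a`, `b` and the columns of `C`. -/
def starCols {m : ℕ} (a b : ZIdx m → ℝ) (C : Matrix (ZIdx m) (Fin m) ℝ) :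
    Matrix (ZIdx m) (ZStarIdx m) ℝ :=
  fromCols (replicateCol Unit a) (fromCols (replicateCol Unit b) C)

/-- The parameters of a CKSVAR with `k` lags in `p = m + 1` variables:
`φ₀⁺ y_t⁺ + φ₀⁻ y_t⁻ + Φ₀ˣ x_t = c + ∑_{i=1}^k (φ_i⁺ y_{t-i}⁺ + φ_i⁻ y_{t-i}⁻ + Φ_iˣ x_{t-i}) + u_t`.
Only the coefficients with index `0, …, k` play a role. -/
structure CKSVAR (m k : ℕ) where
  c : ZIdx m → ℝ
  φpos : ℕ → ZIdx m → ℝ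
  φneg : ℕ → ZIdx m → ℝ
  Φx : ℕ → Matrix (ZIdx m) (Fin m) ℝ

namespace CKSVAR

variable {m k : ℕ} (M : CKSVAR m k)

/-- `Φ_i = [φ_i⁺, φ_i⁻, Φ_iˣ]`. -/
def PhiStar (i : ℕ) : Matrix (ZIdx m) (ZStarIdx m) ℝ := starCols (M.φpos i) (M.φneg i) (M.Φx i)

/-- The CKSVAR is canonical: `Φ₀ = [[1, 1, 0], [0, 0, I]]`. -/
def IsCanonical : Prop :=
  M.PhiStar 0 = fromBlocks 1 (fromCols 1 0) 0 (fromCols 0 1)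

/-- The path `z` (at the times `-k+1, -k+2, …`) satisfies the equations of the model for
`t = 1, 2, …` with errors `u`. -/
def Generates (u : ℕ → ZSpace m) (z : ℤ → ZSpace m) : Prop :=
  ∀ t : ℕ, 1 ≤ t →
    M.PhiStar 0 *ᵥ zStar (z t) =
      M.c + ∑ i ∈ Finset.Icc 1 k, M.PhiStar i *ᵥ zStar (z ((t : ℤ) - (i : ℤ))) + WithLp.ofLp (u t)

/-- `φ_i⁺` if `y ≥ 0`, and `φ_i⁻` if `y < 0`. In all that follows an argument `y` selects the
regime in the same way, so that the values at `1` and at `-1` are the objects with the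
superscripts `+` and `-`. -/
def phi (y : ℝ) (i : ℕ) : ZIdx m → ℝ := if 0 ≤ y then M.φpos i else M.φneg i

/-- `Φ_i^± = [φ_i^±, Φ_iˣ]`. -/
def Phi (y : ℝ) (i : ℕ) : Matrix (ZIdx m) (ZIdx m) ℝ :=
  fromCols (replicateCol Unit (M.phi y i)) (M.Φx i)

/-- The matrix polynomial `Φ^±(λ) = Φ₀^± - ∑_{i=1}^k Φ_i^± λ^i`. -/
def PhiPoly (y : ℝ) : Matrix (ZIdx m) (ZIdx m) ℝ[X] :=
  (M.Phi y 0).map Polynomial.C -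
    ∑ i ∈ Finset.Icc 1 k, (Polynomial.X ^ i : ℝ[X]) • (M.Phi y i).map Polynomial.C

/-- `π^± = -φ^±(1)`. -/
def smallPi (y : ℝ) : ZIdx m → ℝ := -(M.phi y 0 - ∑ i ∈ Finset.Icc 1 k, M.phi y i)

/-- `Πˣ = -Φˣ(1)`. -/
def PiX : Matrix (ZIdx m) (Fin m) ℝ := -(M.Φx 0 - ∑ i ∈ Finset.Icc 1 k, M.Φx i)

/-- `Π^± = [π^±, Πˣ]`. -/
def Pi (y : ℝ) : Matrix (ZIdx m) (ZIdx m) ℝ :=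
  fromCols (replicateCol Unit (M.smallPi y)) M.PiX

/-- `Γ_i^± = -∑_{j=i+1}^k Φ_j^±`. -/
def Gamma (y : ℝ) (i : ℕ) : Matrix (ZIdx m) (ZIdx m) ℝ := -∑ j ∈ Finset.Icc (i + 1) k, M.Phi y j

/-- `Γ(1; y) = Φ₀^± - ∑_{i=1}^{k-1} Γ_i^±`. -/
def GammaOne (y : ℝ) : Matrix (ZIdx m) (ZIdx m) ℝ :=
  M.Phi y 0 - ∑ i ∈ Finset.Icc 1 (k - 1), M.Gamma y i

/-- `Γ_i = [γ_i⁺, γ_i⁻, Γ_iˣ] = -∑_{j=i+1}^k Φ_j`. -/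
def GammaStar (i : ℕ) : Matrix (ZIdx m) (ZStarIdx m) ℝ :=
  -∑ j ∈ Finset.Icc (i + 1) k, M.PhiStar j

/-- The space of common trends `{(y, x) : π⁺ [y]₊ + π⁻ [y]₋ + Πˣ x = 0}`. -/
def commonTrends : Set (ZSpace m) :=
  {z | starCols (M.smallPi 1) (M.smallPi (-1)) M.PiX *ᵥ zStar z = 0}

/-- `det Φ^±(λ)` has exactly `q` roots at unity (counted with multiplicity), and all its other
(complex) roots lie outside the unit circle. -/
def UnitRoots (y : ℝ) (q : ℕ) : Prop :=
  (M.PhiPoly y).det.rootMultiplicity 1 = q ∧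
    ∀ l : ℂ, Polynomial.aeval l (M.PhiPoly y).det = 0 → l ≠ 1 → 1 < ‖l‖

/-- The factorisation `Π^± = Πˣ [θ^±, I] = α [β_y^±, β_xᵀ] = α β^±ᵀ` with `α`, `β_x` of full column
rank `r`, together with orthocomplements of `α` and `β_x`; here `p - r = d + 1`. -/
structure KinkedFactorisation (r d : ℕ) where
  α : Matrix (ZIdx m) (Fin r) ℝ
  βx : Matrix (Fin m) (Fin r) ℝ
  θpos : Fin m → ℝ
  θneg : Fin m → ℝ
  αperp : Matrix (ZIdx m) (Unit ⊕ Fin d) ℝ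
  βxperp : Matrix (Fin m) (Fin d) ℝ
  dim_eq : r + d = m
  α_rank : α.rank = r
  βx_rank : βx.rank = r
  PiX_eq : M.PiX = α * βxᵀ
  θpos_eq : M.PiX *ᵥ θpos = M.smallPi 1
  θneg_eq : M.PiX *ᵥ θneg = M.smallPi (-1)
  αperp_rank : αperp.rank = d + 1
  αperp_mul : αperpᵀ * α = 0
  βxperp_rank : βxperp.rank = d
  βxperp_mul : βxperpᵀ * βx = 0

/-- `S(y)`, for which `S(y) z = (y⁺, y⁻, x)` if `z = (y, x)`. -/
def S (m : ℕ) (y : ℝ) : Matrix (ZStarIdx m) (ZIdx m) ℝ :=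
  fromRows (fromCols (Matrix.of fun _ _ => if 0 ≤ y then 1 else 0) 0)
    (fromBlocks (Matrix.of fun _ _ => if 0 ≤ y then 0 else 1) 0 0 1)

namespace KinkedFactorisation

variable {M} {r d : ℕ} (F : M.KinkedFactorisation r d)

/-- `θ(y)`. -/
def θ (y : ℝ) : Fin m → ℝ := if 0 ≤ y then F.θpos else F.θneg

/-- `β(y)`, where `β(y)ᵀ = β_xᵀ [θ(y), I]`. -/
def β (y : ℝ) : Matrix (ZIdx m) (Fin r) ℝ :=
  (fromCols (replicateCol Unit (F.βxᵀ *ᵥ F.θ y)) F.βxᵀ)ᵀ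

/-- `β_⊥(y) = [[1, 0], [-θ(y), β_{x,⊥}]]`. -/
def βperp (y : ℝ) : Matrix (ZIdx m) (Unit ⊕ Fin d) ℝ :=
  fromBlocks 1 0 (-replicateCol Unit (F.θ y)) F.βxperp

/-- `α_⊥ᵀ Γ(1; y) β_⊥(y)`. -/
def core (y : ℝ) : Matrix (Unit ⊕ Fin d) (Unit ⊕ Fin d) ℝ :=
  F.αperpᵀ * M.GammaOne y * F.βperp y

/-- `P_{β_⊥}(y) = β_⊥(y) [α_⊥ᵀ Γ(1; y) β_⊥(y)]⁻¹ α_⊥ᵀ`. -/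
def proj (y : ℝ) : Matrix (ZIdx m) (ZIdx m) ℝ := F.βperp y * (F.core y)⁻¹ * F.αperpᵀ

/-- `ϑᵀ = e₁ᵀ P_{β_⊥}(+1)`. -/
def vartheta : ZIdx m → ℝ := fun j => F.proj 1 (Sum.inl ()) j

/-- The block matrix `𝛂` with first block row `[α, Γ_1, …, Γ_{k-1}]` and the identity below. -/
def boldα : Matrix (ZIdx m ⊕ (Fin (k - 1) × ZStarIdx m)) (Fin r ⊕ (Fin (k - 1) × ZStarIdx m)) ℝ :=
  fromBlocks F.α (Matrix.of fun a js => M.GammaStar ((js.1 : ℕ) + 1) a js.2) 0 1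

/-- The block matrix `𝛃(y)ᵀ` with block rows `[β(y)ᵀ, 0, …]`, `[S(y), -I, 0, …]`,
`[0, I, -I, 0, …]`, …, `[0, …, I, -I]`. -/
def boldβT (y : ℝ) :
    Matrix (Fin r ⊕ (Fin (k - 1) × ZStarIdx m)) (ZIdx m ⊕ (Fin (k - 1) × ZStarIdx m)) ℝ :=
  fromBlocks (F.β y)ᵀ 0
    (Matrix.of fun is a => if (is.1 : ℕ) = 0 then S m y is.2 a else 0)
    (Matrix.of fun is js => if is.2 = js.2 then
      (if (is.1 : ℕ) = js.1 then -1 else if (is.1 : ℕ) = (js.1 : ℕ) + 1 then 1 else 0) else 0)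

/-- The equilibrium error `β(y)ᵀ z` of `z = (y, x)`. -/
def eqError (z : ZSpace m) : EuclideanSpace ℝ (Fin r) := act (F.β (yPart z))ᵀ z

end KinkedFactorisation

end CKSVAR

end

/-! Let z* = (y⁺, y⁻, x). The model has the error correction form Δz_t = c + α ξ_{t-1} + ∑ Γ_i
Δz*_{t-i} + u_t, in which ξ is a linear function of z*. The increments of y⁺ and y⁻ are fractions a
and 1 - a of that of y, with a in [0,1]. Hence the state, which stacks ξ_t with the last k - 1
increments of z*, follows an autoregression whose coefficient matrix is at each time a convex
combination of the two matrices I + 𝛃(±1)ᵀ𝛂 (`exists_state_eq`).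

By the Berger–Wang theorem, a joint spectral radius below one gives a single norm contracted by both
matrices, hence by all their convex combinations (`exists_seminorm_contraction`). So the state is
bounded by a constant times (initial size + 1 + largest error), path by path
(`exists_norm_state_le`). Moments of order 2 + δ make this bound o_p(√n), which is part (i).

For part (ii), α_⊥ᵀ annihilates c and α, so summing over time shows that α_⊥ᵀ Γ(1; y_t) z_t equals
α_⊥ᵀ (Γ(1; y_0) z_0 + ∑ u_s) up to a multiple of the state (`exists_commonTrend_remainder_le`). As
ξ_t is also small, z_t is recovered by inverting z ↦ (β(y)ᵀ z, α_⊥ᵀ Γ(1; y) z). Along β_⊥ this is a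
piecewise linear map whose two matrices differ in one column, so the determinant of a convex
combination is the convex combination of the determinants. Their equal signs keep it away from zero,
and the inverse `trendMap` is globally Lipschitz (`exists_norm_sub_trendMap_le`); Cramer's rule
identifies the regime of the solution by the sign of ϑᵀv. The scaled path is thus uniformly within
o_p(1) of a Lipschitz image of the scaled partial sums, and the continuous mapping theorem applies.
-/

/-! ### Finite families of endomorphisms: adapted norms and the Berger–Wang theorem -/

section BergerWang

variable {ι V : Type*}

/-- The product of the members of the family `A` along the word `w`. -/
def wordProd [AddCommGroup V] [Module ℂ V] (A : ι → Module.End ℂ V) (w : List ι) :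
    Module.End ℂ V :=
  (w.map A).prod

/-! ### Contracted norms, invariant subspaces and quotients. -/

section Algebra

variable [AddCommGroup V] [Module ℂ V] (A : ι → Module.End ℂ V)

@[simp]
theorem wordProd_nil (v : V) : wordProd A [] v = v := by simp [wordProd]

@[simp]
theorem wordProd_cons (i : ι) (w : List ι) (v : V) :
    wordProd A (i :: w) v = A i (wordProd A w v) := by
  simp [wordProd, Module.End.mul_apply]

theorem wordProd_append (w w' : List ι) (v : V) :
    wordProd A (w ++ w') v = wordProd A w (wordProd A w' v) := by
  simp [wordProd, Module.End.mul_apply]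

/-- The family `A` contracts a norm by the factor `s`. -/
def ContractsBy (A : ι → Module.End ℂ V) (s : ℝ) : Prop :=
  ∃ N : Seminorm ℂ V, (∀ v, N v = 0 → v = 0) ∧ ∀ i v, N (A i v) ≤ s * N v

variable {A}

theorem ContractsBy.mono {s s' : ℝ} (h : ContractsBy A s) (hs : s ≤ s') : ContractsBy A s' := by
  obtain ⟨N, h1, h2⟩ := h
  exact ⟨N, h1, fun i v => (h2 i v).trans (mul_le_mul_of_nonneg_right hs (apply_nonneg N v))⟩

theorem ContractsBy.smul {s : ℝ} (h : ContractsBy A s) (a : ℝ) :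
    ContractsBy (fun i => (a : ℂ) • A i) (|a| * s) := by
  obtain ⟨N, h1, h2⟩ := h
  refine ⟨N, h1, fun i v => ?_⟩
  rw [LinearMap.smul_apply, map_smul_eq_mul, Complex.norm_real, Real.norm_eq_abs, mul_assoc]
  exact mul_le_mul_of_nonneg_left (h2 i v) (abs_nonneg a)

theorem wordProd_smul (a : ℂ) (w : List ι) (v : V) :
    wordProd (fun i => a • A i) w v = a ^ w.length • wordProd A w v := by
  induction w with
  | nil => simp
  | cons i w ih => simp [ih, pow_succ, smul_smul]

/-- Every eigenvalue of every product along a nonempty word has modulus at most `q`. -/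
def WordEigenvaluesLE (A : ι → Module.End ℂ V) (q : ℝ) : Prop :=
  ∀ w : List ι, w ≠ [] → ∀ (μ : ℂ) (v : V), v ≠ 0 → wordProd A w v = μ • v → ‖μ‖ ≤ q

theorem WordEigenvaluesLE.smul {q : ℝ} (h : WordEigenvaluesLE A q) {a : ℝ} (ha : 0 < a)
    (ha1 : a ≤ 1) : WordEigenvaluesLE (fun i => (a : ℂ) • A i) q := by
  intro w hw μ v hv hμ
  rw [wordProd_smul] at hμ
  have ha' : (a : ℂ) ^ w.length ≠ 0 := pow_ne_zero _ (by exact_mod_cast ha.ne')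
  have h1 := h w hw (((a : ℂ) ^ w.length)⁻¹ * μ) v hv (by
    rw [mul_smul, ← hμ, smul_smul, inv_mul_cancel₀ ha', one_smul])
  refine le_trans ?_ h1
  rw [norm_mul, norm_inv, norm_pow, Complex.norm_real, Real.norm_eq_abs, abs_of_pos ha]
  refine le_mul_of_one_le_left (norm_nonneg _) ?_
  exact (one_le_inv₀ (by positivity)).2 (pow_le_one₀ ha.le ha1)

variable {W : Submodule ℂ V}

theorem wordProd_restrict (hW : ∀ i, ∀ v ∈ W, A i v ∈ W) (w : List ι) (v : W) :
    (wordProd (fun i => (A i).restrict (hW i)) w v : V) = wordProd A w v := by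
  induction w with
  | nil => simp
  | cons i w ih => simp [ih]

theorem wordProd_mapQ (hW : ∀ i, ∀ v ∈ W, A i v ∈ W) (w : List ι) (v : V) :
    wordProd (fun i => W.mapQ W (A i) (hW i)) w (W.mkQ v) = W.mkQ (wordProd A w v) := by
  induction w with
  | nil => simp
  | cons i w ih => rw [wordProd_cons, ih, wordProd_cons]; simp

theorem WordEigenvaluesLE.restrict (hW : ∀ i, ∀ v ∈ W, A i v ∈ W) {q : ℝ} (h : WordEigenvaluesLE A q) :
    WordEigenvaluesLE (fun i => (A i).restrict (hW i)) q := by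
  intro w hw μ v hv hμ
  refine h w hw μ v (by simpa using hv) ?_
  rw [← wordProd_restrict hW, hμ]; simp

/-- An eigenvector of the quotient need not lift to one. But an eigenvalue μ makes the quotient map
minus μ fail to be surjective, so the map upstairs minus μ is not surjective either, hence not
injective. -/
theorem WordEigenvaluesLE.mapQ [FiniteDimensional ℂ V] (hW : ∀ i, ∀ v ∈ W, A i v ∈ W) {q : ℝ}
    (h : WordEigenvaluesLE A q) :
    WordEigenvaluesLE (fun i => W.mapQ W (A i) (hW i)) q := by
  intro w hw μ v hv hμ
  have hQ : ¬ Function.Surjective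
      (wordProd (fun i => W.mapQ W (A i) (hW i)) w - μ • (1 : Module.End ℂ (V ⧸ W))) := by
    rw [← LinearMap.injective_iff_surjective]
    intro hinj
    exact hv (hinj (by simp [hμ]))
  have hV : ¬ Function.Injective (wordProd A w - μ • (1 : Module.End ℂ V)) := by
    rw [LinearMap.injective_iff_surjective]
    intro hsurj
    apply hQ
    intro y
    obtain ⟨x, rfl⟩ := W.mkQ_surjective y
    obtain ⟨x', rfl⟩ := hsurj x
    refine ⟨W.mkQ x', ?_⟩
    rw [LinearMap.sub_apply, wordProd_mapQ hW]
    simp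
  rw [← LinearMap.ker_eq_bot, Submodule.eq_bot_iff] at hV
  push Not at hV
  obtain ⟨x, hx, hx0⟩ := hV
  refine h w hw μ x hx0 ?_
  simpa [sub_eq_zero] using hx

theorem Seminorm.exists_le_norm {V : Type*} [NormedAddCommGroup V] [NormedSpace ℂ V]
    [FiniteDimensional ℂ V] (N : Seminorm ℂ V) : ∃ C > 0, ∀ v, N v ≤ C * ‖v‖ := by
  let b := Module.finBasis ℂ V
  refine ⟨∑ i, ‖LinearMap.toContinuousLinearMap (b.coord i)‖ * N (b i) + 1, ?_, fun v => ?_⟩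
  · have : 0 ≤ ∑ i, ‖LinearMap.toContinuousLinearMap (b.coord i)‖ * N (b i) :=
      Finset.sum_nonneg fun i _ => mul_nonneg (norm_nonneg _) (apply_nonneg _ _)
    linarith
  · calc N v = N (∑ i, b.repr v i • b i) := by rw [b.sum_repr]
      _ ≤ ∑ i, N (b.repr v i • b i) := by
          simpa using Finset.le_sum_of_subadditive N (map_zero N).le (map_add_le_add N) Finset.univ
            fun i => b.repr v i • b i
      _ ≤ ∑ i, ‖LinearMap.toContinuousLinearMap (b.coord i)‖ * N (b i) * ‖v‖ := by
          refine Finset.sum_le_sum fun i _ => ?_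
          rw [map_smul_eq_mul, mul_right_comm]
          refine mul_le_mul_of_nonneg_right ?_ (apply_nonneg _ _)
          exact (LinearMap.toContinuousLinearMap (b.coord i)).le_opNorm v
      _ ≤ _ := by
          rw [← Finset.sum_mul]
          exact mul_le_mul_of_nonneg_right (by linarith) (norm_nonneg _)

/-- A definite seminorm can itself serve as the norm of V, so the bound by an arbitrary norm applies
to it. -/
theorem Seminorm.exists_le_of_definite [FiniteDimensional ℂ V] {N : Seminorm ℂ V}
    (hN : ∀ v, N v = 0 → v = 0) (p : Seminorm ℂ V) : ∃ C > 0, ∀ v, p v ≤ C * N v := by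
  let _ : Norm V := ⟨N⟩
  have core : NormedSpace.Core ℂ V :=
    { norm_nonneg := fun v => apply_nonneg N v
      norm_smul := fun c v => map_smul_eq_mul N c v
      norm_triangle := fun v w => map_add_le_add N v w
      norm_eq_zero_iff := fun v => ⟨hN v, fun h => h ▸ map_zero N⟩ }
  let _ : NormedAddCommGroup V := NormedAddCommGroup.ofCore core
  let _ : NormedSpace ℂ V := NormedSpace.ofCore core
  exact Seminorm.exists_le_norm p

/-- A family that leaves a subspace invariant contracts a norm as soon as it does so on the
subspace and on the quotient. -/
theorem ContractsBy.of_restrict_mapQ [FiniteDimensional ℂ V] [Finite ι]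
    (hW : ∀ i, ∀ v ∈ W, A i v ∈ W) {s : ℝ} (hs1 : s < 1)
    (h1 : ContractsBy (fun i => (A i).restrict (hW i)) s)
    (h2 : ContractsBy (fun i => W.mapQ W (A i) (hW i)) s) : ∃ s' < 1, ContractsBy A s' := by
  obtain ⟨N, hN, hNA⟩ := h1
  obtain ⟨Q, hQ, hQA⟩ := h2
  obtain ⟨sec, hsec⟩ := W.mkQ.exists_rightInverse_of_surjective
    (LinearMap.range_eq_top.2 W.mkQ_surjective)
  have hsec' (x : V ⧸ W) : W.mkQ (sec x) = x := LinearMap.congr_fun hsec x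
  -- The projection onto W along a linear section of the quotient map. In the coordinates `τ` and
  -- `W.mkQ` each `A i` is block triangular, with off-diagonal block `τ ∘ₗ A i ∘ₗ sec`.
  let τ : V →ₗ[ℂ] W := LinearMap.codRestrict W (LinearMap.id - sec ∘ₗ W.mkQ) fun v => by
    rw [← Submodule.Quotient.mk_eq_zero, ← Submodule.mkQ_apply]
    simp [hsec', -Submodule.mkQ_apply]
  have hτ (v : V) : (τ v : V) = v - sec (W.mkQ v) := rfl
  have hstep (i : ι) (v : V) :
      τ (A i v) = (A i).restrict (hW i) (τ v) + (τ ∘ₗ A i ∘ₗ sec) (W.mkQ v) := by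
    apply Subtype.ext
    have h3 : W.mkQ (A i (sec (W.mkQ v))) = W.mkQ (A i v) := by
      have h4 (x : V) : W.mkQ (A i x) = W.mapQ W (A i) (hW i) (W.mkQ x) := rfl
      rw [h4, h4, hsec']
    simp only [Submodule.coe_add, hτ, LinearMap.coe_restrict_apply, LinearMap.comp_apply, h3,
      map_sub]
    abel
  choose K hK0 hK using fun i => Seminorm.exists_le_of_definite hQ (N.comp (τ ∘ₗ A i ∘ₗ sec))
  obtain ⟨K', hK'⟩ := Finite.exists_le K
  -- In the norm ε N(τ v) + Q(v + W) the off-diagonal block costs at most ε B Q. The choice ε B = (1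
  -- - s)/2 raises the factor of Q from s to exactly (1 + s)/2.
  set B : ℝ := max K' 1 with hB
  have hB0 : 0 < B := lt_max_of_lt_right one_pos
  have hε : 0 < (1 - s) / (2 * B) := div_pos (by linarith) (by positivity)
  set ε : ℝ≥0 := ⟨(1 - s) / (2 * B), hε.le⟩ with hεdef
  have hεB : (ε : ℝ) * B = (1 - s) / 2 := by
    change (1 - s) / (2 * B) * B = _
    field_simp
  have hε0 : (0 : ℝ) < ε := hε
  have hval (v : V) : (ε • N.comp τ + Q.comp W.mkQ) v = ε * N (τ v) + Q (W.mkQ v) := by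
    simp [NNReal.smul_def]
  refine ⟨(1 + s) / 2, by linarith, ε • N.comp τ + Q.comp W.mkQ, fun v hv => ?_, fun i v => ?_⟩
  · rw [hval] at hv
    have h3 := apply_nonneg N (τ v)
    have h4 := apply_nonneg Q (W.mkQ v)
    have h5 : Q (W.mkQ v) = 0 := by nlinarith
    have h6 : N (τ v) = 0 := by nlinarith
    have h7 := congrArg Subtype.val (hN _ h6)
    rw [hτ, hQ _ h5] at h7
    simpa using h7
  · rw [hval, hval, hstep]
    have h3 : N ((A i).restrict (hW i) (τ v) + (τ ∘ₗ A i ∘ₗ sec) (W.mkQ v)) ≤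
        s * N (τ v) + B * Q (W.mkQ v) := by
      refine (map_add_le_add N _ _).trans (add_le_add (hNA i _) ((hK i _).trans ?_))
      exact mul_le_mul_of_nonneg_right ((hK' i).trans (le_max_left _ _)) (apply_nonneg _ _)
    have h4 : Q (W.mkQ (A i v)) ≤ s * Q (W.mkQ v) := hQA i (W.mkQ v)
    have h5 := apply_nonneg N (τ v)
    have h6 := apply_nonneg Q (W.mkQ v)
    have h7 := mul_le_mul_of_nonneg_left h3 hε0.le
    have h8 : (ε : ℝ) * N (τ v) * s ≤ (ε : ℝ) * N (τ v) * ((1 + s) / 2) :=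
      mul_le_mul_of_nonneg_left (by linarith) (by positivity)
    have h9 : (ε : ℝ) * (B * Q (W.mkQ v)) = (1 - s) / 2 * Q (W.mkQ v) := by
      rw [← mul_assoc, hεB]
    nlinarith

end Algebra

/-! ### From eigenvalue bounds to a contracted norm. -/

section Normed

variable [NormedAddCommGroup V] [NormedSpace ℂ V] [FiniteDimensional ℂ V]

variable {A : ι → Module.End ℂ V}

/-- The adapted norm is v ↦ sup_w s^(-|w|) ‖A_w v‖. The empty word makes it definite, and extending
w by a letter that acts first shows that this letter contracts it by s. -/
theorem ContractsBy.of_norm_wordProd_le {V : Type*} [NormedAddCommGroup V] [NormedSpace ℂ V]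
    {A : ι → Module.End ℂ V} {s C : ℝ} (hs : 0 < s)
    (h : ∀ w v, ‖wordProd A w v‖ ≤ C * s ^ w.length * ‖v‖) : ContractsBy A s := by
  have hbdd (v : V) : BddAbove (Set.range fun w => (s ^ w.length)⁻¹ * ‖wordProd A w v‖) := by
    refine ⟨C * ‖v‖, ?_⟩
    rintro _ ⟨w, rfl⟩
    rw [inv_mul_le_iff₀ (by positivity)]
    exact (h w v).trans_eq (by ring)
  have hle (w : List ι) (v : V) :
      (s ^ w.length)⁻¹ * ‖wordProd A w v‖ ≤ ⨆ w, (s ^ w.length)⁻¹ * ‖wordProd A w v‖ :=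
    le_ciSup (hbdd v) w
  have hnn (v : V) : ‖v‖ ≤ ⨆ w, (s ^ w.length)⁻¹ * ‖wordProd A w v‖ := by
    simpa using hle [] v
  refine ⟨Seminorm.ofSMulLE (fun v => ⨆ w, (s ^ w.length)⁻¹ * ‖wordProd A w v‖) ?_ ?_ ?_, ?_, ?_⟩
  · simp
  · intro x y
    refine ciSup_le fun w => ?_
    refine le_trans ?_ (add_le_add (hle w x) (hle w y))
    rw [map_add, ← mul_add]
    exact mul_le_mul_of_nonneg_left (norm_add_le _ _) (by positivity)
  · intro c x
    refine ciSup_le fun w => ?_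
    rw [map_smul, norm_smul, mul_left_comm]
    exact mul_le_mul_of_nonneg_left (hle w x) (norm_nonneg _)
  · intro v hv
    exact norm_le_zero_iff.1 ((hnn v).trans_eq hv)
  · intro i v
    change (⨆ w, _) ≤ s * ⨆ w, _
    refine ciSup_le fun w => ?_
    have h1 := hle (w ++ [i]) v
    rw [wordProd_append, List.length_append, pow_add, mul_inv] at h1
    simp only [wordProd_cons, wordProd_nil, List.length_singleton, pow_one] at h1
    rw [← div_le_iff₀' hs]
    refine le_trans (le_of_eq ?_) h1
    field_simp

/-- With s = 2^(-1/t), each block of length t contributes exactly s^t. The incomplete block costs at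
most K^t, while its power of s is at least 1/2; hence the constant 2 K^t. -/
theorem ContractsBy.of_length [Finite ι] {t : ℕ} (ht : 1 ≤ t)
    (h : ∀ w : List ι, w.length = t → ∀ v, ‖wordProd A w v‖ ≤ 1 / 2 * ‖v‖) :
    ∃ s < 1, ContractsBy A s := by
  obtain ⟨K, hK1, hK⟩ : ∃ K : ℝ, 1 ≤ K ∧ ∀ i v, ‖A i v‖ ≤ K * ‖v‖ := by
    obtain ⟨K, hK⟩ := Finite.exists_le fun i => ‖LinearMap.toContinuousLinearMap (A i)‖
    refine ⟨max K 1, le_max_right _ _, fun i v => ?_⟩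
    refine ((LinearMap.toContinuousLinearMap (A i)).le_opNorm v).trans ?_
    exact mul_le_mul_of_nonneg_right ((hK i).trans (le_max_left _ _)) (norm_nonneg _)
  have hKw (w : List ι) (v : V) : ‖wordProd A w v‖ ≤ K ^ w.length * ‖v‖ := by
    induction w with
    | nil => simp
    | cons i w ih =>
      rw [wordProd_cons, List.length_cons, pow_succ', mul_assoc]
      exact (hK i _).trans (mul_le_mul_of_nonneg_left ih (by linarith))
  set s : ℝ := (1 / 2 : ℝ) ^ ((t : ℝ)⁻¹) with hs
  have hs0 : 0 < s := by positivity
  have hst : s ^ t = 1 / 2 := Real.rpow_inv_natCast_pow (by norm_num) (by omega)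
  have hs1 : s < 1 := by
    by_contra! hc
    have := one_le_pow₀ hc (n := t)
    rw [hst] at this
    norm_num at this
  refine ⟨s, hs1, ContractsBy.of_norm_wordProd_le (C := 2 * K ^ t) hs0 fun w => ?_⟩
  induction hl : w.length using Nat.strong_induction_on generalizing w with
  | _ l ih =>
    intro v
    subst hl
    rcases lt_or_ge w.length t with hlt | hge
    · refine (hKw w v).trans (mul_le_mul_of_nonneg_right ?_ (norm_nonneg _))
      have h1 : 1 / 2 ≤ s ^ w.length := by
        rw [← hst]; exact pow_le_pow_of_le_one hs0.le hs1.le hlt.le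
      have h2 : K ^ w.length ≤ K ^ t := pow_le_pow_right₀ hK1 hlt.le
      have h3 : 0 < K ^ t := by positivity
      nlinarith
    · have hw : w.take t ++ w.drop t = w := List.take_append_drop t w
      have hd : (w.drop t).length = w.length - t := List.length_drop
      have h1 := ih (w.length - t) (by omega) (w.drop t) hd v
      have h2 := h (w.take t) (by simp [hge]) (wordProd A (w.drop t) v)
      rw [← wordProd_append, hw] at h2
      refine h2.trans ((mul_le_mul_of_nonneg_left h1 (by norm_num)).trans_eq ?_)
      have h3 : s ^ w.length = s ^ (w.length - t) * (1 / 2) := by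
        rw [← hst, ← pow_add, Nat.sub_add_cancel hge]
      rw [h3]; ring

/-- The determinant is the characteristic polynomial at 1, a product of factors 1 - μ over the
eigenvalues. -/
theorem pow_le_norm_det_one_sub {f : Module.End ℂ V} {q : ℝ} (hq : q ≤ 1)
    (hf : ∀ (μ : ℂ) (v : V), v ≠ 0 → f v = μ • v → ‖μ‖ ≤ q) :
    (1 - q) ^ Module.finrank ℂ V ≤ ‖LinearMap.det (1 - f)‖ := by
  have hmul (s : Multiset ℂ) (hs : ∀ μ ∈ s, ‖μ‖ ≤ q) :
      (1 - q) ^ s.card ≤ ‖(s.map fun μ => 1 - μ).prod‖ := by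
    induction s using Multiset.induction_on with
    | empty => simp
    | cons a s ih =>
      simp only [Multiset.card_cons, pow_succ', Multiset.map_cons, Multiset.prod_cons, norm_mul]
      have h1 : 1 - q ≤ ‖1 - a‖ := by
        have := norm_sub_norm_le 1 a
        have h2 := hs a (Multiset.mem_cons_self _ _)
        simp only [norm_one] at this
        linarith
      exact mul_le_mul h1 (ih fun μ hμ => hs μ (Multiset.mem_cons_of_mem hμ))
        (pow_nonneg (by linarith) _) (norm_nonneg _)
  have hsplit := IsAlgClosed.splits f.charpoly
  have h1 : LinearMap.det (1 - f) = (f.charpoly.roots.map fun μ => 1 - μ).prod := by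
    rw [← hsplit.eval_eq_prod_roots_of_monic f.charpoly_monic, LinearMap.eval_charpoly, map_one]
  have h2 : f.charpoly.roots.card = Module.finrank ℂ V := by
    rw [← hsplit.natDegree_eq_card_roots, LinearMap.charpoly_natDegree]
  rw [h1, ← h2]
  refine hmul _ fun μ hμ => ?_
  have h3 : Module.End.HasEigenvalue f μ := by
    rw [Module.End.hasEigenvalue_iff_isRoot_charpoly]
    exact Polynomial.isRoot_of_mem_roots hμ
  obtain ⟨v, hv⟩ := h3.exists_hasEigenvector
  exact hf μ v hv.2 hv.apply_eq_smul

/-- Along long words of a bounded family whose products do not decay there are subwords with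
nearly fixed vectors. -/
theorem exists_word_almost_fixed {K : ℝ} (hK : ∀ w v, ‖wordProd A w v‖ ≤ K * ‖v‖)
    (hlong : ∀ t : ℕ, 1 ≤ t → ∃ w : List ι, w.length = t ∧ ∃ v, 1 / 2 * ‖v‖ < ‖wordProd A w v‖)
    {ε : ℝ} (hε : 0 < ε) :
    ∃ w : List ι, w ≠ [] ∧ ∃ x : V, 1 / 2 ≤ K * ‖x‖ ∧ ‖x‖ ≤ K ∧ ‖wordProd A w x - x‖ ≤ ε := by
  have := FiniteDimensional.proper ℂ V
  obtain ⟨c, -, hcfin, hc⟩ := (isCompact_closedBall (0 : V) K).finite_cover_balls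
    (half_pos hε)
  set n := hcfin.toFinset.card
  obtain ⟨w, hw, v, hv⟩ := hlong (n + 1) (by omega)
  have hv0 : 0 < ‖v‖ := by
    rw [norm_pos_iff]; rintro rfl; simp at hv
  let x : V := (‖v‖⁻¹ : ℂ) • v
  have hx : ‖x‖ = 1 := by
    simp [x, norm_smul, hv0.ne']
  have hwx : 1 / 2 ≤ ‖wordProd A w x‖ := by
    simp only [x, map_smul, norm_smul, norm_inv, Complex.norm_real, norm_norm]
    rw [le_inv_mul_iff₀ hv0]
    linarith
  -- The n + 2 images of `x` under the suffixes of the word lie in n balls of radius ε/2, so two of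
  -- them share a ball; the letters between the two suffixes carry one image to the other. No image
  -- is small, since the rest of the word must still bring it to norm at least 1/2.
  let y : Fin (n + 2) → V := fun s => wordProd A (w.drop s) x
  have hyK (s) : ‖y s‖ ≤ K := (hK _ _).trans_eq (by rw [hx, mul_one])
  have hylow (s) : 1 / 2 ≤ K * ‖y s‖ := by
    have h1 := hK (w.take s) (y s)
    rw [← wordProd_append, List.take_append_drop] at h1
    exact hwx.trans h1
  have hmem (s) : ∃ a ∈ hcfin.toFinset, y s ∈ Metric.ball a (ε / 2) := by
    have h1 := hc (mem_closedBall_zero_iff.2 (hyK s))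
    simpa using h1
  choose a ha hya using hmem
  obtain ⟨s, -, s', -, hne, heq⟩ := Finset.exists_ne_map_eq_of_card_lt_of_maps_to
    (s := Finset.univ) (t := hcfin.toFinset) (f := a) (by simp [n]) (fun s _ => ha s)
  wlog hlt : s < s' generalizing s s'
  · exact this s' s hne.symm heq.symm (lt_of_le_of_ne (not_lt.1 hlt) hne.symm)
  have hs' : (s' : ℕ) ≤ n + 1 := by omega
  have hlt' : (s : ℕ) < s' := hlt
  refine ⟨(w.drop s).take (s' - s), ?_, y s', hylow s', hyK s', ?_⟩
  · rw [← List.length_pos_iff]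
    simp [hw]
    omega
  · have h1 : wordProd A ((w.drop s).take (s' - s)) (y s') = y s := by
      have h2 : w.drop s' = (w.drop s).drop (s' - s) := by
        rw [List.drop_drop]; congr 1; omega
      simp only [y]
      rw [← wordProd_append, h2, List.take_append_drop]
    rw [h1, ← dist_eq_norm]
    have h3 := hya s
    have h4 := hya s'
    rw [← heq] at h4
    rw [Metric.mem_ball] at h3 h4
    have := dist_triangle_right (y s) (y s') (a s)
    linarith

/-- Otherwise words of every length fail to halve some vector, and there are words with nearly fixed
vectors bounded away from zero. By compactness a limit operator has an exact fixed vector, so det(1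
- B') = 0; but the bound (1 - q)^dim on the determinants survives the limit. -/
theorem exists_contractsBy_of_bounded [Finite ι] {q K : ℝ} (hq : q < 1)
    (hA : WordEigenvaluesLE A q) (hK : ∀ w v, ‖wordProd A w v‖ ≤ K * ‖v‖) :
    ∃ s < 1, ContractsBy A s := by
  by_contra hcon
  have hlong : ∀ t : ℕ, 1 ≤ t →
      ∃ w : List ι, w.length = t ∧ ∃ v, 1 / 2 * ‖v‖ < ‖wordProd A w v‖ := by
    intro t ht
    by_contra! h
    exact hcon (ContractsBy.of_length ht h)
  choose w hw x hxlow hxK hfix using fun n : ℕ =>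
    exists_word_almost_fixed hK hlong (ε := 1 / ((n : ℝ) + 1)) (by positivity)
  have := FiniteDimensional.proper ℂ V
  have := FiniteDimensional.proper ℂ (V →L[ℂ] V)
  let B : ℕ → V →L[ℂ] V := fun n => LinearMap.toContinuousLinearMap (wordProd A (w n))
  have hK0 : 0 ≤ K := (norm_nonneg _).trans (hxK 0)
  have hB (n) : ‖B n‖ ≤ K := ContinuousLinearMap.opNorm_le_bound _ hK0 (hK (w n))
  obtain ⟨⟨B', x'⟩, -, φ, hφ, hlim⟩ :=
    ((isCompact_closedBall (0 : V →L[ℂ] V) K).prod (isCompact_closedBall (0 : V) K)).tendsto_subseq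
      (x := fun n => (B n, x n)) fun n =>
        ⟨mem_closedBall_zero_iff.2 (hB n), mem_closedBall_zero_iff.2 (hxK n)⟩
  have hBlim : Tendsto (fun n => B (φ n)) atTop (𝓝 B') := (continuous_fst.tendsto _).comp hlim
  have hxlim : Tendsto (fun n => x (φ n)) atTop (𝓝 x') := (continuous_snd.tendsto _).comp hlim
  have hfix' : B' x' = x' := by
    have h1 : Tendsto (fun n => B (φ n) (x (φ n)) - x (φ n)) atTop (𝓝 (B' x' - x')) :=
      ((isBoundedBilinearMap_apply.continuous.tendsto (B', x')).comp hlim).sub hxlim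
    have h2 : Tendsto (fun n => B (φ n) (x (φ n)) - x (φ n)) atTop (𝓝 0) := by
      refine squeeze_zero_norm (fun n => hfix (φ n)) ?_
      exact tendsto_one_div_add_atTop_nhds_zero_nat.comp hφ.tendsto_atTop
    exact sub_eq_zero.1 (tendsto_nhds_unique h1 h2)
  have hx' : x' ≠ 0 := by
    rintro rfl
    have h1 : (1 / 2 : ℝ) ≤ K * ‖(0 : V)‖ :=
      ge_of_tendsto' (hxlim.norm.const_mul K) fun n => hxlow (φ n)
    norm_num at h1
  have hdet : (1 - B').det = 0 := by
    by_contra hne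
    have h1 : IsUnit (LinearMap.det ((1 - B' : V →L[ℂ] V) : V →ₗ[ℂ] V)) := isUnit_iff_ne_zero.2 hne
    have h2 := (LinearMap.equivOfIsUnitDet h1).injective
    refine hx' (h2 ?_)
    simp [hfix']
  have hdetlim : Tendsto (fun n => ‖(1 - B (φ n)).det‖) atTop (𝓝 ‖(1 - B').det‖) :=
    ((ContinuousLinearMap.continuous_det.tendsto _).comp (hBlim.const_sub 1)).norm
  have h3 : (1 - q) ^ Module.finrank ℂ V ≤ ‖(1 - B').det‖ :=
    ge_of_tendsto' hdetlim fun n => pow_le_norm_det_one_sub hq.le (hA (w (φ n)) (hw (φ n)))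
  rw [hdet, norm_zero] at h3
  have : 0 < (1 - q) ^ Module.finrank ℂ V := pow_pos (by linarith) _
  linarith

/-- An irreducible family that contracts norms by every factor above one is bounded. -/
theorem bounded_of_irreducible [Nontrivial V]
    (hirr : ∀ W : Submodule ℂ V, (∀ i, ∀ v ∈ W, A i v ∈ W) → W = ⊥ ∨ W = ⊤)
    (hA : ∀ s > 1, ContractsBy A s) : ∃ K, ∀ w v, ‖wordProd A w v‖ ≤ K * ‖v‖ := by
  have := FiniteDimensional.proper ℂ V
  -- The vectors with bounded orbit form an invariant subspace. If it is everything,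
  -- Banach–Steinhaus makes the bound uniform.
  let W : Submodule ℂ V :=
    { carrier := {v | ∃ C, ∀ w, ‖wordProd A w v‖ ≤ C}
      zero_mem' := ⟨0, by simp⟩
      add_mem' := by
        rintro x y ⟨C, hC⟩ ⟨D, hD⟩
        refine ⟨C + D, fun w => ?_⟩
        rw [map_add]
        exact (norm_add_le _ _).trans (add_le_add (hC w) (hD w))
      smul_mem' := by
        rintro a x ⟨C, hC⟩
        refine ⟨‖a‖ * C, fun w => ?_⟩
        rw [map_smul, norm_smul]
        exact mul_le_mul_of_nonneg_left (hC w) (norm_nonneg _) }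
  have hWinv : ∀ i, ∀ v ∈ W, A i v ∈ W := by
    rintro i v ⟨C, hC⟩
    refine ⟨C, fun w => ?_⟩
    simpa [wordProd_append] using hC (w ++ [i])
  rcases hirr W hWinv with hbot | htop
  -- If every nonzero orbit is unbounded, compactness of the sphere gives finitely many words one of
  -- which doubles any given vector. Iteration yields growth 2^n along words of length at most n T.
  · exfalso
    have hex : ∀ v ∈ Metric.sphere (0 : V) 1, ∃ w, 2 < ‖wordProd A w v‖ := by
      intro v hv
      by_contra! h
      have : v ∈ W := ⟨2, h⟩
      rw [hbot, Submodule.mem_bot] at this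
      simp [this] at hv
    have hcont (w : List ι) : Continuous fun v => ‖wordProd A w v‖ :=
      (LinearMap.continuous_of_finiteDimensional _).norm
    obtain ⟨F, hF⟩ := (isCompact_sphere (0 : V) 1).elim_finite_subcover
      (fun w : List ι => {v | 2 < ‖wordProd A w v‖}) (fun w => isOpen_lt continuous_const (hcont w))
      (fun v hv => Set.mem_iUnion.2 (hex v hv))
    set T := F.sup List.length with hT
    have hgrow (v : V) : ∃ w : List ι, w.length ≤ T ∧ 2 * ‖v‖ ≤ ‖wordProd A w v‖ := by
      by_cases hv : v = 0
      · exact ⟨[], by simp, by simp [hv]⟩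
      have hv0 : 0 < ‖v‖ := norm_pos_iff.2 hv
      have h1 := hF (a := (‖v‖⁻¹ : ℂ) • v) (by simp [norm_smul, hv0.ne'])
      simp only [Set.mem_iUnion, Set.mem_ofPred_eq, map_smul, norm_smul, norm_inv,
        Complex.norm_real, norm_norm] at h1
      obtain ⟨w, hw, h2⟩ := h1
      refine ⟨w, Finset.le_sup (f := List.length) hw, ?_⟩
      rw [lt_inv_mul_iff₀ hv0] at h2
      linarith
    obtain ⟨v, hv⟩ := exists_ne (0 : V)
    have hiter (n : ℕ) : ∃ w : List ι, w.length ≤ n * T ∧ 2 ^ n * ‖v‖ ≤ ‖wordProd A w v‖ := by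
      induction n with
      | zero => exact ⟨[], by simp, by simp⟩
      | succ n ih =>
        obtain ⟨w, hw, h1⟩ := ih
        obtain ⟨w', hw', h2⟩ := hgrow (wordProd A w v)
        refine ⟨w' ++ w, ?_, ?_⟩
        · rw [List.length_append, add_mul]; omega
        · rw [wordProd_append, pow_succ']; linarith
    -- Contraction by s > 1 with s^(T+1) = 3/2 allows growth of at most (3/2)^n along words of
    -- length n T. The exponent T + 1 also covers T = 0.
    set s : ℝ := (3 / 2 : ℝ) ^ (((T + 1 : ℕ) : ℝ)⁻¹) with hs
    have hsT : s ^ (T + 1) = 3 / 2 := Real.rpow_inv_natCast_pow (by norm_num) (by omega)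
    have hs1 : 1 < s := by
      by_contra! hc
      have := pow_le_one₀ (by positivity : 0 ≤ s) hc (n := T + 1)
      rw [hsT] at this
      norm_num at this
    obtain ⟨N, hN, hNA⟩ := hA s hs1
    have hNw (w : List ι) : N (wordProd A w v) ≤ s ^ w.length * N v := by
      induction w with
      | nil => simp
      | cons i w ih =>
        rw [wordProd_cons, List.length_cons, pow_succ', mul_assoc]
        exact (hNA i _).trans (mul_le_mul_of_nonneg_left ih (by linarith))
    obtain ⟨C, hC0, hC⟩ := Seminorm.exists_le_of_definite hN (normSeminorm ℂ V)
    have hbound (n : ℕ) : (2 : ℝ) ^ n * ‖v‖ ≤ C * N v * (3 / 2) ^ n := by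
      obtain ⟨w, hw, h1⟩ := hiter n
      have h2 : s ^ w.length ≤ (3 / 2) ^ n := by
        rw [← hsT, ← pow_mul]
        exact pow_le_pow_right₀ hs1.le (by nlinarith)
      calc (2 : ℝ) ^ n * ‖v‖ ≤ ‖wordProd A w v‖ := h1
        _ ≤ C * N (wordProd A w v) := hC _
        _ ≤ C * (s ^ w.length * N v) := mul_le_mul_of_nonneg_left (hNw w) hC0.le
        _ ≤ C * ((3 / 2) ^ n * N v) := by
            have := apply_nonneg N v
            gcongr
        _ = _ := by ring
    have hpow : Tendsto (fun n : ℕ => ((4 : ℝ) / 3) ^ n) atTop atTop :=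
      tendsto_pow_atTop_atTop_of_one_lt (by norm_num)
    obtain ⟨n, hn⟩ := (hpow.eventually_gt_atTop (C * N v / ‖v‖)).exists
    have hv0 : 0 < ‖v‖ := norm_pos_iff.2 hv
    rw [div_lt_iff₀ hv0] at hn
    have h3 := hbound n
    have h4 : (2 : ℝ) ^ n = (4 / 3) ^ n * (3 / 2) ^ n := by rw [← mul_pow]; norm_num
    rw [h4, mul_right_comm] at h3
    have := le_of_mul_le_mul_right h3 (by positivity)
    linarith
  · obtain ⟨K, hK⟩ := banach_steinhaus
      (g := fun w => LinearMap.toContinuousLinearMap (wordProd A w)) fun v => by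
        have : v ∈ W := htop ▸ Submodule.mem_top
        exact this
    exact ⟨K, fun w v => (LinearMap.toContinuousLinearMap (wordProd A w)).le_of_opNorm_le (hK w) v⟩

/-- If the claim fails, the infimum r of the contraction factors is at least one. Division by r
keeps the eigenvalue bound and leaves a family contracted by every factor above one, hence bounded,
hence contracted by some s < 1; then A is contracted by r s < r. -/
theorem exists_contractsBy_of_irreducible [Finite ι] [Nontrivial V] {q : ℝ} (hq : q < 1)
    (hirr : ∀ W : Submodule ℂ V, (∀ i, ∀ v ∈ W, A i v ∈ W) → W = ⊥ ∨ W = ⊤)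
    (hA : WordEigenvaluesLE A q) : ∃ s < 1, ContractsBy A s := by
  by_contra hcon
  let S : Set ℝ := {s | 0 < s ∧ ContractsBy A s}
  have hS1 : ∀ s ∈ S, 1 ≤ s := fun s hs => by
    by_contra! h
    exact hcon ⟨s, h, hs.2⟩
  have hbdd : BddBelow S := ⟨1, hS1⟩
  have hne : S.Nonempty := by
    obtain ⟨K, hK⟩ := Finite.exists_le fun i => ‖LinearMap.toContinuousLinearMap (A i)‖
    refine ⟨max K 1, lt_max_of_lt_right one_pos, normSeminorm ℂ V, fun v hv => by simpa using hv,
      fun i v => ?_⟩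
    refine ((LinearMap.toContinuousLinearMap (A i)).le_opNorm v).trans ?_
    exact mul_le_mul_of_nonneg_right ((hK i).trans (le_max_left _ _)) (norm_nonneg _)
  set r := sInf S with hr
  have hr1 : 1 ≤ r := le_csInf hne hS1
  have hr0 : 0 < r := by linarith
  have hA' : ∀ s > 1, ContractsBy (fun i => ((r⁻¹ : ℝ) : ℂ) • A i) s := by
    intro s hs
    obtain ⟨s', hs', hlt⟩ := exists_lt_of_csInf_lt hne (lt_mul_of_one_lt_right hr0 hs)
    refine (hs'.2.smul r⁻¹).mono ?_
    rw [abs_of_pos (inv_pos.2 hr0), inv_mul_le_iff₀ hr0]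
    exact hlt.le
  have hirr' : ∀ W : Submodule ℂ V, (∀ i, ∀ v ∈ W, (((r⁻¹ : ℝ) : ℂ) • A i) v ∈ W) →
      W = ⊥ ∨ W = ⊤ := by
    intro W hW
    refine hirr W fun i v hv => ?_
    have h1 := W.smul_mem (r : ℂ) (hW i v hv)
    rwa [LinearMap.smul_apply, smul_smul, ← Complex.ofReal_mul, mul_inv_cancel₀ hr0.ne',
      Complex.ofReal_one, one_smul] at h1
  obtain ⟨K, hK⟩ := bounded_of_irreducible hirr' hA'
  obtain ⟨s, hs, hsc⟩ := exists_contractsBy_of_bounded hq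
    (hA.smul (inv_pos.2 hr0) (inv_le_one_of_one_le₀ hr1)) hK
  have h1 := hsc.smul r
  have h2 : (fun i => (r : ℂ) • (((r⁻¹ : ℝ) : ℂ) • A i)) = A := by
    funext i
    rw [smul_smul, ← Complex.ofReal_mul, mul_inv_cancel₀ hr0.ne', Complex.ofReal_one, one_smul]
  rw [h2, abs_of_pos hr0] at h1
  -- The maximum with r/2 keeps the factor positive, as membership in `S` requires, and still below
  -- r.
  have h3 : max (r * s) (r / 2) ∈ S :=
    ⟨lt_max_of_lt_right (by positivity), h1.mono (le_max_left _ _)⟩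
  have h4 : max (r * s) (r / 2) < r := max_lt (by nlinarith) (by linarith)
  exact absurd (csInf_le hbdd h3) (not_le.2 h4)

end Normed

/-- **Berger–Wang theorem**, in the form: a finite family of endomorphisms contracts a norm if the
spectral radii of all its products are bounded by a constant less than one. -/
theorem exists_contractsBy_of_wordEigenvaluesLE [Finite ι] {q : ℝ} (hq : q < 1) {V : Type*}
    [NormedAddCommGroup V] [NormedSpace ℂ V] [FiniteDimensional ℂ V] {A : ι → Module.End ℂ V}
    (hA : WordEigenvaluesLE A q) : ∃ s < 1, ContractsBy A s := by
  induction hn : Module.finrank ℂ V using Nat.strong_induction_on generalizing V with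
  | _ n ih =>
    rcases subsingleton_or_nontrivial V with hV | hV
    · exact ⟨0, one_pos, 0, fun v _ => Subsingleton.elim _ _, fun i v => by simp⟩
    by_cases hirr : ∀ W : Submodule ℂ V, (∀ i, ∀ v ∈ W, A i v ∈ W) → W = ⊥ ∨ W = ⊤
    · exact exists_contractsBy_of_irreducible hq hirr hA
    push Not at hirr
    obtain ⟨W, hW, hbot, htop⟩ := hirr
    -- Closedness makes the quotient a normed space and not merely a seminormed one, as the
    -- induction needs.
    have : IsClosed (W : Set V) := W.closed_of_finiteDimensional
    have hlt : Module.finrank ℂ W < n := hn ▸ Submodule.finrank_lt htop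
    have hlt' : Module.finrank ℂ (V ⧸ W) < n := by
      have h1 := W.finrank_quotient_add_finrank
      have h2 : Module.finrank ℂ W ≠ 0 := by
        rwa [Ne, Submodule.finrank_eq_zero]
      omega
    obtain ⟨s, hs, h1⟩ := ih _ hlt (hA.restrict hW) rfl
    obtain ⟨s', hs', h2⟩ := ih _ hlt' (hA.mapQ hW) rfl
    exact ContractsBy.of_restrict_mapQ hW (max_lt hs hs') (h1.mono (le_max_left _ _))
      (h2.mono (le_max_right _ _))

/-! ### The joint spectral radius of real matrices. -/

variable {n : Type*} [Fintype n] [DecidableEq n]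

theorem wordProd_toLin' {S : Set (Matrix n n ℝ)} (w : List S) :
    wordProd (fun B : S => ((B : Matrix n n ℝ).map (algebraMap ℝ ℂ)).toLin') w =
      (((w.map Subtype.val).prod).map (algebraMap ℝ ℂ)).toLin' := by
  induction w with
  | nil => simp [wordProd]; rfl
  | cons B w ih =>
    ext1 v
    rw [List.map_cons, List.prod_cons, Matrix.map_mul, Matrix.toLin'_mul, ← ih]
    ext
    simp

/-- The upper limit controls only long products. An eigenvalue μ of a short word w gives the
eigenvalue μ^j of w repeated j times, which is long enough for j = T + 1; the bound q^(j |w|) then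
returns to |μ| ≤ q by taking roots. -/
theorem wordEigenvaluesLE_of_jointSpectralRadius_lt_one {S : Set (Matrix n n ℝ)}
    (h : jointSpectralRadius S < 1) :
    ∃ q < 1, WordEigenvaluesLE
      (fun B : S => ((B : Matrix n n ℝ).map (algebraMap ℝ ℂ)).toLin') q := by
  obtain ⟨q, hq, hq1⟩ := exists_between h
  have hqtop : q ≠ ∞ := (hq1.trans ENNReal.one_lt_top).ne
  have hev := eventually_lt_of_limsup_lt hq
  obtain ⟨T, hT⟩ := eventually_atTop.1 hev
  refine ⟨q.toReal, by rw [← ENNReal.toReal_one]; exact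
    (ENNReal.toReal_lt_toReal hqtop ENNReal.one_ne_top).2 hq1, fun w hw μ v hv hμ => ?_⟩
  have hl : 1 ≤ w.length := List.length_pos_iff.2 hw
  set j := T + 1
  set w' := (List.replicate j w).flatten
  have hlen : w'.length = j * w.length := by simp [w']
  have hTl : T ≤ w'.length := by rw [hlen]; exact (Nat.le_succ T).trans (Nat.le_mul_of_pos_right _ hl)
  have hpow (i : ℕ) : wordProd (fun B : S => ((B : Matrix n n ℝ).map (algebraMap ℝ ℂ)).toLin')
      (List.replicate i w).flatten v = μ ^ i • v := by
    induction i with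
    | zero => simp
    | succ i ih =>
      rw [List.replicate_succ, List.flatten_cons, wordProd_append, ih, map_smul, hμ, smul_smul,
        pow_succ]
  have hmem : (w'.map Subtype.val).prod ∈ matrixProducts S w'.length := by
    refine ⟨fun s => (w'.get s : S), fun s => (w'.get s).2, ?_⟩
    congr 1
    exact List.ext_get (by simp) (by simp)
  have hspec : μ ^ j ∈ spectrum ℂ ((w'.map Subtype.val).prod.map (algebraMap ℝ ℂ)) := by
    rw [← Matrix.spectrum_toLin', ← wordProd_toLin']
    exact (Module.End.hasEigenvalue_of_hasEigenvector
      (Module.End.hasEigenvector_iff.2 ⟨Module.End.mem_eigenspace_iff.2 (hpow j), hv⟩)).mem_spectrum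
  have h1 : (‖μ ^ j‖₊ : ℝ≥0∞) ≤ spectralRadius ℂ ((w'.map Subtype.val).prod.map (algebraMap ℝ ℂ)) :=
    le_iSup₂ (f := fun (a : ℂ) (_ : a ∈ spectrum ℂ _) => (‖a‖₊ : ℝ≥0∞)) _ hspec
  have h2 := (le_iSup₂ (f := fun (B : Matrix n n ℝ) (_ : B ∈ matrixProducts S w'.length) =>
    spectralRadius ℂ (B.map (algebraMap ℝ ℂ)) ^ (1 / (w'.length : ℝ))) _ hmem).trans
      (hT _ hTl).le
  have hlpos : (0 : ℝ) < w'.length := by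
    rw [hlen]; exact_mod_cast Nat.mul_pos (Nat.succ_pos _) hl
  rw [one_div, ENNReal.rpow_inv_le_iff hlpos, ENNReal.rpow_natCast, hlen, mul_comm, pow_mul] at h2
  have h3 : (‖μ‖₊ : ℝ≥0∞) ^ j ≤ (q ^ w.length) ^ j := by
    have := h1.trans h2
    rwa [nnnorm_pow, ENNReal.coe_pow] at this
  have h4 : (‖μ‖₊ : ℝ≥0∞) ≤ q ^ w.length := (ENNReal.pow_le_pow_left_iff (Nat.succ_ne_zero T)).1 h3
  have h5 : (‖μ‖₊ : ℝ≥0∞) ≤ q := h4.trans (pow_le_of_le_one zero_le hq1.le (by omega))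
  have := ENNReal.toReal_mono hqtop h5
  simpa using this

/-- A finite set of matrices with joint spectral radius less than one contracts a norm. -/
theorem exists_seminorm_contraction {S : Set (Matrix n n ℝ)} (hS : S.Finite)
    (h : jointSpectralRadius S < 1) :
    ∃ s : ℝ, 0 ≤ s ∧ s < 1 ∧ ∃ N : Seminorm ℝ (n → ℝ), (∃ C > 0, ∀ v, N v ≤ C * ‖v‖) ∧
      (∃ C > 0, ∀ v, ‖v‖ ≤ C * N v) ∧ ∀ B ∈ S, ∀ v, N (B *ᵥ v) ≤ s * N v := by
  have : Finite S := hS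
  obtain ⟨q, hq, hA⟩ := wordEigenvaluesLE_of_jointSpectralRadius_lt_one h
  obtain ⟨s, hs, hsc⟩ := exists_contractsBy_of_wordEigenvaluesLE hq hA
  obtain ⟨N, hN, hNA⟩ := hsc.mono (le_max_left s 0)
  -- The contracted norm lives on ℂⁿ, where eigenvectors exist. It is pulled back along the
  -- entrywise inclusion, an isometry of the sup norms.
  let c : (n → ℝ) →ₗ[ℝ] n → ℂ := Complex.ofRealCLM.toLinearMap.compLeft n
  have hcnorm (v : n → ℝ) : ‖c v‖ = ‖v‖ := by
    simp [c, Pi.norm_def, Complex.nnnorm_real]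
  refine ⟨max s 0, le_max_right _ _, max_lt hs one_pos, (N.restrictScalars ℝ).comp c, ?_, ?_,
    fun B hB v => ?_⟩
  · obtain ⟨C, hC, h1⟩ := Seminorm.exists_le_norm N
    exact ⟨C, hC, fun v => by rw [← hcnorm]; exact h1 _⟩
  · obtain ⟨C, hC, h1⟩ := Seminorm.exists_le_of_definite hN (normSeminorm ℂ (n → ℂ))
    exact ⟨C, hC, fun v => by rw [← hcnorm]; exact h1 _⟩
  · have h2 : c (B *ᵥ v) = (B.map (algebraMap ℝ ℂ)).toLin' (c v) := by
      ext i
      simp [c, Matrix.mulVec, dotProduct]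
    rw [Seminorm.comp_apply, h2]
    exact hNA ⟨B, hB⟩ (c v)

end BergerWang

/-! ### Kinked linear maps -/

/-- The increments of the positive and the negative part are complementary fractions of the
increment. -/
theorem exists_kink_weight (y y' : ℝ) : ∃ a : ℝ, 0 ≤ a ∧ a ≤ 1 ∧
    max y 0 - max y' 0 = a * (y - y') ∧ min y 0 - min y' 0 = (1 - a) * (y - y') := by
  rcases le_total 0 y with hy | hy <;> rcases le_total 0 y' with hy' | hy'
  · exact ⟨1, by norm_num, le_rfl, by simp [hy, hy'], by simp [hy, hy']⟩
  · rcases eq_or_lt_of_le (hy'.trans hy) with h | h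
    · exact ⟨1, by norm_num, le_rfl, by simp [h], by simp [h]⟩
    · have hpos : 0 < y - y' := by linarith
      refine ⟨y / (y - y'), div_nonneg hy hpos.le, (div_le_one hpos).2 (by linarith), ?_, ?_⟩
      · rw [max_eq_left hy, max_eq_right hy']; field_simp; ring
      · rw [min_eq_right hy, min_eq_left hy']; field_simp; ring
  · rcases eq_or_lt_of_le (hy.trans hy') with h | h
    · exact ⟨1, by norm_num, le_rfl, by simp [h], by simp [h]⟩
    · have hneg : 0 < y' - y := by linarith
      have hne : y - y' ≠ 0 := by linarith
      refine ⟨y' / (y' - y), div_nonneg hy' hneg.le, (div_le_one hneg).2 (by linarith), ?_, ?_⟩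
      · rw [max_eq_right hy, max_eq_left hy']; field_simp; ring
      · rw [min_eq_left hy, min_eq_right hy']; field_simp; ring
  · exact ⟨0, le_rfl, by norm_num, by simp [hy, hy'], by simp [hy, hy']⟩

/-! ### The map z ↦ z* and the error correction form. -/

namespace CKSVAR

variable {m k : ℕ} {M : CKSVAR m k}

/-- `S(y) z = z*`. -/
theorem S_mulVec (z : ZSpace m) : S m (yPart z) *ᵥ WithLp.ofLp z = zStar z := by
  ext i
  rcases i with i | i | i <;> by_cases h : 0 ≤ yPart z <;>
    simp [S, zStar, mulVec, dotProduct, h, Matrix.one_apply]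
  · rfl
  · linarith
  · rw [min_eq_left (by linarith)]; rfl

theorem zStar_sub_zStar (z z' : ZSpace m) {a : ℝ}
    (h1 : max (yPart z) 0 - max (yPart z') 0 = a * (yPart z - yPart z'))
    (h2 : min (yPart z) 0 - min (yPart z') 0 = (1 - a) * (yPart z - yPart z')) :
    zStar z - zStar z' = (a • S m 1 + (1 - a) • S m (-1)) *ᵥ WithLp.ofLp (z - z') := by
  have h10 : ¬ (1 : ℝ) ≤ 0 := by norm_num
  ext i
  rcases i with i | i | i <;> simp [S, zStar, mulVec, dotProduct, Matrix.one_apply, h1, h2, h10]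
  · left; rfl
  · left; rfl
  · simp only [add_mul, ite_mul, zero_mul, Finset.sum_add_distrib, Finset.sum_ite_eq,
      Finset.mem_univ, if_true]
    ring

theorem IsCanonical.mulVec_zStar (h : M.IsCanonical) (z : ZSpace m) :
    M.PhiStar 0 *ᵥ zStar z = WithLp.ofLp z := by
  rw [h]
  ext i
  rcases i with i | i <;> simp [zStar, mulVec, dotProduct, Matrix.one_apply, max_add_min]
  rfl

/-- Summation by parts. Lag K is absent from the right-hand side because its coefficient is an empty
sum. -/
theorem sum_mulVec_eq_error_correction {α β : Type*} [Fintype α] [Fintype β] (Φ : ℕ → Matrix α β ℝ)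
    (x : ℕ → β → ℝ) (K : ℕ) :
    ∑ i ∈ Finset.Icc 1 K, Φ i *ᵥ x i = (∑ i ∈ Finset.Icc 1 K, Φ i) *ᵥ x 1 +
      ∑ i ∈ Finset.range (K - 1),
        (-∑ j ∈ Finset.Icc (i + 1 + 1) K, Φ j) *ᵥ (x (i + 1) - x (i + 2)) := by
  -- The additional term of the range, whose coefficient is an empty sum, makes the induction step
  -- uniform.
  have key : ∑ i ∈ Finset.Icc 1 K, Φ i *ᵥ x i = (∑ i ∈ Finset.Icc 1 K, Φ i) *ᵥ x 1 +
      ∑ i ∈ Finset.range K,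
        (-∑ j ∈ Finset.Icc (i + 1 + 1) K, Φ j) *ᵥ (x (i + 1) - x (i + 2)) := by
    induction K with
    | zero => simp
    | succ K ih =>
      have h1 : ∀ i ∈ Finset.range (K + 1),
          (-∑ j ∈ Finset.Icc (i + 1 + 1) (K + 1), Φ j) *ᵥ (x (i + 1) - x (i + 2)) =
          (-∑ j ∈ Finset.Icc (i + 1 + 1) K, Φ j) *ᵥ (x (i + 1) - x (i + 2)) +
            if i < K then Φ (K + 1) *ᵥ (x (i + 2) - x (i + 1)) else 0 := by
        intro i hi
        split_ifs with hlt
        · rw [Finset.sum_Icc_succ_top (by omega), neg_add, Matrix.add_mulVec,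
            ← neg_sub (x (i + 1)), Matrix.mulVec_neg, Matrix.neg_mulVec _ (Φ (K + 1))]
        · have h2 : Finset.Icc (i + 1 + 1) (K + 1) = ∅ := Finset.Icc_eq_empty (by omega)
          have h3 : Finset.Icc (i + 1 + 1) K = ∅ := Finset.Icc_eq_empty (by omega)
          rw [h2, h3, add_zero]
      rw [Finset.sum_congr rfl h1, Finset.sum_add_distrib, Finset.sum_range_succ,
        Finset.sum_range_succ _ K, if_neg (lt_irrefl K), add_zero,
        Finset.sum_congr rfl fun i hi => if_pos (Finset.mem_range.1 hi),
        ← Matrix.mulVec_sum, Finset.sum_range_sub (fun i => x (i + 1)) K,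
        Finset.Icc_eq_empty (a := K + 1 + 1) (b := K) (by omega),
        Finset.sum_Icc_succ_top (by omega), Finset.sum_Icc_succ_top (by omega), ih,
        Matrix.add_mulVec, Matrix.mulVec_sub]
      simp only [Finset.sum_empty, neg_zero, Matrix.zero_mulVec, zero_add,
        Matrix.mulVec_sub]
      abel
  rw [key]
  rcases K with _ | K
  · simp
  · rw [Nat.add_sub_cancel, Finset.sum_range_succ,
      Finset.Icc_eq_empty (a := K + 1 + 1) (b := K + 1) (by omega)]
    simp

/-- The error correction form of the model. -/
theorem Generates.error_correction (h : M.IsCanonical) {u : ℕ → ZSpace m}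
    {z : ℤ → ZSpace m} (hz : M.Generates u z) {t : ℕ} (ht : 1 ≤ t) :
    WithLp.ofLp (z t - z (t - 1)) =
      M.c + starCols (M.smallPi 1) (M.smallPi (-1)) M.PiX *ᵥ zStar (z (t - 1)) +
      ∑ i ∈ Finset.range (k - 1), M.GammaStar (i + 1) *ᵥ
        (zStar (z ((t : ℤ) - 1 - i)) - zStar (z ((t : ℤ) - 1 - i - 1))) + WithLp.ofLp (u t) := by
  have h1 := hz t ht
  rw [h.mulVec_zStar, sum_mulVec_eq_error_correction M.PhiStar
    (fun i => zStar (z ((t : ℤ) - i)))] at h1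
  have h2 : starCols (M.smallPi 1) (M.smallPi (-1)) M.PiX =
      ∑ i ∈ Finset.Icc 1 k, M.PhiStar i - M.PhiStar 0 := by
    have h10 : ¬ (1 : ℝ) ≤ 0 := by norm_num
    ext i j
    rcases j with j | j | j <;>
      simp [starCols, PhiStar, smallPi, PiX, phi, Matrix.sum_apply, h10]
  rw [h2, Matrix.sub_mulVec, h.mulVec_zStar, WithLp.ofLp_sub, h1]
  have h3 : ∀ i ∈ Finset.range (k - 1), M.GammaStar (i + 1) *ᵥ
        (zStar (z ((t : ℤ) - 1 - i)) - zStar (z ((t : ℤ) - 1 - i - 1))) =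
      (-∑ j ∈ Finset.Icc (i + 1 + 1) k, M.PhiStar j) *ᵥ
        (zStar (z ((t : ℤ) - (i + 1 : ℕ))) - zStar (z ((t : ℤ) - (i + 2 : ℕ)))) := by
    intro i _
    have h4 : (t : ℤ) - (i + 1 : ℕ) = t - 1 - i := by push_cast; ring
    have h5 : (t : ℤ) - (i + 2 : ℕ) = t - 1 - i - 1 := by push_cast; ring
    rw [GammaStar, h4, h5]
  rw [Finset.sum_congr rfl h3]
  simp only [Nat.cast_one]
  abel

/-! ### The stacked autoregression and its stability. -/

namespace KinkedFactorisation

variable {r d : ℕ} (F : M.KinkedFactorisation r d)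

/-- The matrix `β*ᵀ = β_xᵀ [θ⁺, θ⁻, I]`, for which `β(y)ᵀ = β*ᵀ S(y)`. -/
noncomputable def βStar : Matrix (Fin r) (ZStarIdx m) ℝ :=
  fromCols (replicateCol Unit (F.βxᵀ *ᵥ F.θpos))
    (fromCols (replicateCol Unit (F.βxᵀ *ᵥ F.θneg)) F.βxᵀ)

theorem transpose_β (y : ℝ) : (F.β y)ᵀ = F.βStar * S m y := by
  ext i j
  by_cases h : 0 ≤ y <;> rcases j with j | j <;>
    simp [β, βStar, S, Matrix.mul_apply, θ, h, Matrix.one_apply]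

/-- The kink is absorbed by z*: in these coordinates the equilibrium error is linear, hence its
increments are linear in those of z*. -/
theorem eqError_eq (z : ZSpace m) : WithLp.ofLp (F.eqError z) = F.βStar *ᵥ zStar z := by
  rw [eqError, act, transpose_β, ← Matrix.mulVec_mulVec, S_mulVec]

theorem starCols_eq_mul_βStar :
    starCols (M.smallPi 1) (M.smallPi (-1)) M.PiX = F.α * F.βStar := by
  have h1 := F.θpos_eq
  have h2 := F.θneg_eq
  rw [F.PiX_eq, ← Matrix.mulVec_mulVec] at h1 h2
  ext i j
  rcases j with j | j | j
  · rw [← h1]; simp [starCols, βStar, Matrix.mul_apply, mulVec, dotProduct, -Matrix.mulVec_mulVec]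
  · rw [← h2]; simp [starCols, βStar, Matrix.mul_apply, mulVec, dotProduct, -Matrix.mulVec_mulVec]
  · rw [F.PiX_eq]; simp [starCols, βStar, Matrix.mul_apply]

/-- The equilibrium error at time `t`, stacked with the increments of `z*` at the times
`t, t - 1, …, t - k + 2`. -/
noncomputable def state (z : ℤ → ZSpace m) (t : ℤ) : Fin r ⊕ (Fin (k - 1) × ZStarIdx m) → ℝ :=
  Sum.elim (fun i => F.eqError (z t) i)
    (fun js => zStar (z (t - js.1)) js.2 - zStar (z (t - js.1 - 1)) js.2)

/-- The first block row is the error correction form, and the identity block passes the lagged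
increments on. Applying 𝛃ᵀ to the result will give the increment of the state. -/
theorem boldα_mulVec_state (h : M.IsCanonical) {u : ℕ → ZSpace m}
    {z : ℤ → ZSpace m} (hz : M.Generates u z) {t : ℕ} (ht : 1 ≤ t) :
    F.boldα *ᵥ F.state z (t - 1) + Sum.elim (M.c + WithLp.ofLp (u t)) 0 =
      Sum.elim (WithLp.ofLp (z t - z (t - 1)))
        (fun js => zStar (z ((t : ℤ) - 1 - js.1)) js.2 - zStar (z ((t : ℤ) - 1 - js.1 - 1)) js.2) := by
  ext i
  rcases i with i | i
  · rw [Sum.elim_inl, hz.error_correction h ht, F.starCols_eq_mul_βStar, ← Matrix.mulVec_mulVec,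
      ← F.eqError_eq, Finset.sum_range]
    simp [boldα, state, mulVec, dotProduct, Fintype.sum_prod_type]
    ring
  · simp [boldα, state, mulVec, dotProduct, Matrix.one_apply]

/-- On the stacked increments 𝛃(y)ᵀ acts as the increment of a shift register: S(y) v enters the
first slot, every other slot takes over its predecessor, and the old contents are subtracted. -/
theorem boldβT_mulVec (y : ℝ) (v : ZIdx m → ℝ) (w : Fin (k - 1) × ZStarIdx m → ℝ) :
    F.boldβT y *ᵥ Sum.elim v w = Sum.elim (F.βStar *ᵥ (S m y *ᵥ v)) (fun is =>
      (if (is.1 : ℕ) = 0 then (S m y *ᵥ v) is.2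
        else w (⟨is.1 - 1, by omega⟩, is.2)) - w is) := by
  ext i
  rcases i with i | ⟨i, s⟩
  · rw [Matrix.mulVec_mulVec, ← transpose_β]
    simp [boldβT, mulVec, dotProduct]
  · have hsum : ∑ j : Fin (k - 1), (if (i : ℕ) = j then -1 else if (i : ℕ) = j + 1 then 1 else 0) *
        w (j, s) = (if (i : ℕ) = 0 then 0 else w (⟨i - 1, by omega⟩, s)) - w (i, s) := by
      have h1 (j : Fin (k - 1)) :
          (if (i : ℕ) = j then -1 else if (i : ℕ) = j + 1 then 1 else 0) * w (j, s) =
            (if (i : ℕ) = j + 1 then w (j, s) else 0) - if i = j then w (j, s) else 0 := by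
        by_cases hij : i = j
        · subst hij; simp
        · have : (i : ℕ) ≠ j := fun h => hij (Fin.ext h)
          by_cases h2 : (i : ℕ) = j + 1 <;> simp [hij, h2, this]
      rw [Finset.sum_congr rfl fun j _ => h1 j, Finset.sum_sub_distrib, Finset.sum_ite_eq,
        if_pos (Finset.mem_univ _)]
      congr 1
      split_ifs with h0
      · exact Finset.sum_eq_zero fun j _ => if_neg (by omega)
      · rw [Finset.sum_eq_single (⟨i - 1, by omega⟩ : Fin (k - 1))]
        · exact if_pos (by simp; omega)
        · intro j _ hj
          exact if_neg fun h => hj (Fin.ext (by simp; omega))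
        · simp
    have hmul : (F.boldβT y *ᵥ Sum.elim v w) (Sum.inr (i, s)) =
        (if (i : ℕ) = 0 then (S m y *ᵥ v) s else 0) +
        ∑ j : Fin (k - 1), (if (i : ℕ) = j then -1 else if (i : ℕ) = j + 1 then 1 else 0) *
          w (j, s) := by
      simp only [boldβT, mulVec, dotProduct, Fintype.sum_sum_type, fromBlocks_apply₂₁,
        fromBlocks_apply₂₂, of_apply, Sum.elim_inl, Sum.elim_inr, Fintype.sum_prod_type, ite_mul,
        zero_mul, Finset.sum_ite_eq, Finset.mem_univ, if_true]
      congr 1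
      split_ifs <;> simp
    rw [hmul, hsum, Sum.elim_inr]
    dsimp only
    split_ifs <;> ring

/-- The stacked process follows an autoregression whose coefficient matrix is, at each time, a
convex combination of the coefficient matrices of the two regimes. -/
theorem exists_state_eq (h : M.IsCanonical) {u : ℕ → ZSpace m}
    {z : ℤ → ZSpace m} (hz : M.Generates u z) {t : ℕ} (ht : 1 ≤ t) :
    ∃ a : ℝ, 0 ≤ a ∧ a ≤ 1 ∧ F.state z t =
      a • (1 + F.boldβT 1 * F.boldα) *ᵥ F.state z (t - 1) +
      (1 - a) • (1 + F.boldβT (-1) * F.boldα) *ᵥ F.state z (t - 1) +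
      (a • F.boldβT 1 + (1 - a) • F.boldβT (-1)) *ᵥ Sum.elim (M.c + WithLp.ofLp (u t)) 0 := by
  obtain ⟨a, ha0, ha1, h1, h2⟩ := exists_kink_weight (yPart (z t)) (yPart (z (t - 1)))
  refine ⟨a, ha0, ha1, ?_⟩
  have hS := zStar_sub_zStar (z t) (z (t - 1)) h1 h2
  have hα := F.boldα_mulVec_state h hz ht
  have hinc : F.state z t - F.state z (t - 1) = a • F.boldβT 1 *ᵥ (F.boldα *ᵥ F.state z (t - 1) +
        Sum.elim (M.c + WithLp.ofLp (u t)) 0) + (1 - a) • F.boldβT (-1) *ᵥ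
        (F.boldα *ᵥ F.state z (t - 1) + Sum.elim (M.c + WithLp.ofLp (u t)) 0) := by
    rw [hα, boldβT_mulVec, boldβT_mulVec]
    -- One weight `a` serves all blocks: the same mixture of the two regimes that turns Δz into Δz*
    -- also governs the equilibrium error.
    have hcomb : a • S m 1 *ᵥ WithLp.ofLp (z t - z (t - 1)) +
        (1 - a) • S m (-1) *ᵥ WithLp.ofLp (z t - z (t - 1)) =
        zStar (z t) - zStar (z (t - 1)) := by
      rw [hS, Matrix.add_mulVec, Matrix.smul_mulVec, Matrix.smul_mulVec]
    ext i
    rcases i with i | ⟨i, s⟩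
    · have h3 : F.βStar *ᵥ zStar (z t) - F.βStar *ᵥ zStar (z (t - 1)) =
          a • F.βStar *ᵥ (S m 1 *ᵥ WithLp.ofLp (z t - z (t - 1))) +
          (1 - a) • F.βStar *ᵥ (S m (-1) *ᵥ WithLp.ofLp (z t - z (t - 1))) := by
        rw [← Matrix.mulVec_sub, ← hcomb, Matrix.mulVec_add, Matrix.mulVec_smul,
          Matrix.mulVec_smul]
      have h4 := congrFun h3 i
      simpa [state, eqError_eq] using h4
    -- Slot 0 receives the new increment of z*; the other slots only shift, with weights that add up
    -- to one.
    · by_cases hi : (i : ℕ) = 0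
      · have h4 := congrFun hcomb s
        simp only [Pi.add_apply, Pi.smul_apply, Pi.sub_apply, smul_eq_mul] at h4
        simp only [state, Pi.sub_apply, Sum.elim_inr, Pi.add_apply, Pi.smul_apply, smul_eq_mul, hi,
          if_true, Nat.cast_zero, sub_zero]
        linear_combination -h4
      · have h5 : (((i : ℕ) - 1 : ℕ) : ℤ) = (i : ℤ) - 1 := by omega
        have h6 : (t : ℤ) - 1 - ((i : ℤ) - 1) = t - i := by ring
        simp only [state, Pi.sub_apply, Sum.elim_inr, Pi.add_apply, Pi.smul_apply, smul_eq_mul, hi,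
          if_false, h5, h6]
        ring
  rw [sub_eq_iff_eq_add] at hinc
  rw [hinc]
  simp only [Matrix.add_mulVec, Matrix.one_mulVec, Matrix.mulVec_add, Matrix.smul_mulVec,
    ← Matrix.mulVec_mulVec]
  module

/-- A norm contracted by both regime matrices is contracted by their convex combinations, whatever
the weights along the path. The errors then add up to a geometric series, with constants that depend
neither on the path nor on n. -/
theorem exists_norm_state_le (h : M.IsCanonical)
    (hjsr : jointSpectralRadius {1 + F.boldβT 1 * F.boldα, 1 + F.boldβT (-1) * F.boldα} < 1) :
    ∃ C > 0, ∀ (u : ℕ → ZSpace m) (z : ℤ → ZSpace m), M.Generates u z → ∀ (n : ℕ) (L : ℝ),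
      0 ≤ L → (∀ j ∈ Finset.Icc 1 n, ‖u j‖ ≤ L) → ∀ t ≤ n,
        ‖F.state z t‖ ≤ C * (‖F.state z 0‖ + 1 + L) := by
  obtain ⟨s, hs0, hs1, N, ⟨C₁, hC₁, hN₁⟩, ⟨C₂, hC₂, hN₂⟩, hNA⟩ :=
    exists_seminorm_contraction (Set.toFinite _) hjsr
  have hnoise (B : Matrix (Fin r ⊕ (Fin (k - 1) × ZStarIdx m))
      (ZIdx m ⊕ (Fin (k - 1) × ZStarIdx m)) ℝ) : ∃ K > 0, ∀ v : ZSpace m,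
      N (B *ᵥ Sum.elim (M.c + WithLp.ofLp v) 0) ≤ K * (1 + ‖v‖) := by
    set T := LinearMap.toContinuousLinearMap B.toLin'
    refine ⟨C₁ * (‖T‖ + 1) * (‖M.c‖ + 1), by positivity, fun v => (hN₁ _).trans ?_⟩
    have h1 : ‖(Sum.elim (M.c + WithLp.ofLp v) 0 : ZIdx m ⊕ (Fin (k - 1) × ZStarIdx m) → ℝ)‖ ≤
        ‖M.c‖ + ‖v‖ := by
      refine (pi_norm_le_iff_of_nonneg (by positivity)).2 fun i => ?_
      rcases i with i | i
      · exact (norm_add_le _ _).trans (add_le_add (norm_le_pi_norm _ i) (PiLp.norm_apply_le v i))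
      · simp only [Sum.elim_inr, Pi.zero_apply, norm_zero]
        positivity
    have h2 : ‖B *ᵥ Sum.elim (M.c + WithLp.ofLp v) 0‖ ≤ ‖T‖ * (‖M.c‖ + ‖v‖) :=
      (T.le_opNorm _).trans (mul_le_mul_of_nonneg_left h1 (norm_nonneg _))
    have h3 : ‖M.c‖ + ‖v‖ ≤ (‖M.c‖ + 1) * (1 + ‖v‖) := by
      nlinarith [norm_nonneg M.c, norm_nonneg v]
    calc C₁ * ‖B *ᵥ Sum.elim (M.c + WithLp.ofLp v) 0‖
        ≤ C₁ * ((‖T‖ + 1) * ((‖M.c‖ + 1) * (1 + ‖v‖))) := by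
          refine mul_le_mul_of_nonneg_left (h2.trans ?_) hC₁.le
          exact mul_le_mul (by linarith) h3 (by positivity) (by positivity)
      _ = _ := by ring
  obtain ⟨K₁, hK₁, h₁⟩ := hnoise (F.boldβT 1)
  obtain ⟨K₂, hK₂, h₂⟩ := hnoise (F.boldβT (-1))
  have hstep {u : ℕ → ZSpace m} {z : ℤ → ZSpace m} (hz : M.Generates u z) {t : ℕ} (ht : 1 ≤ t) :
      N (F.state z t) ≤ s * N (F.state z (t - 1)) + (K₁ + K₂) * (1 + ‖u t‖) := by
    obtain ⟨a, ha0, ha1, heq⟩ := F.exists_state_eq h hz ht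
    have hsmul (b : ℝ) (hb : 0 ≤ b) (v) : N (b • v) = b * N v := by
      rw [map_smul_eq_mul, Real.norm_eq_abs, abs_of_nonneg hb]
    rw [heq, Matrix.add_mulVec (a • _), Matrix.smul_mulVec, Matrix.smul_mulVec]
    refine (map_add_le_add N _ _).trans (add_le_add ((map_add_le_add N _ _).trans ?_)
      ((map_add_le_add N _ _).trans ?_))
    · rw [hsmul a ha0, hsmul _ (sub_nonneg.2 ha1)]
      have h3 := mul_le_mul_of_nonneg_left (hNA _ (Or.inl rfl) (F.state z (t - 1))) ha0
      have h4 := mul_le_mul_of_nonneg_left (hNA _ (Or.inr rfl) (F.state z (t - 1)))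
        (sub_nonneg.2 ha1)
      linarith
    · rw [hsmul a ha0, hsmul _ (sub_nonneg.2 ha1), add_mul]
      have h3 := h₁ (u t)
      have h4 := h₂ (u t)
      have h5 : a * N (F.boldβT 1 *ᵥ Sum.elim (M.c + WithLp.ofLp (u t)) 0) ≤ 1 * _ :=
        mul_le_mul_of_nonneg_right ha1 (apply_nonneg N _)
      have h6 : (1 - a) * N (F.boldβT (-1) *ᵥ Sum.elim (M.c + WithLp.ofLp (u t)) 0) ≤ 1 * _ :=
        mul_le_mul_of_nonneg_right (by linarith) (apply_nonneg N _)
      linarith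
  have hs : 0 < 1 - s := by linarith
  -- With D = s D + K₁ + K₂, the bound N(state at 0) + D (1 + L) reproduces itself under the
  -- recursion.
  set D := (K₁ + K₂) / (1 - s) with hD
  have hD0 : 0 < D := by positivity
  have hDs : D * (1 - s) = K₁ + K₂ := div_mul_cancel₀ _ hs.ne'
  refine ⟨C₂ * (C₁ + D), by positivity, fun u z hz n L hL hu t ht => ?_⟩
  have hmain : ∀ t : ℕ, t ≤ n → N (F.state z t) ≤ N (F.state z 0) + D * (1 + L) := by
    intro t
    induction t with
    | zero =>
      intro _
      have : 0 ≤ D * (1 + L) := by positivity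
      simpa using this
    | succ t ih =>
      intro ht
      have h3 := hstep hz (t := t + 1) (by omega)
      rw [Nat.cast_succ, add_sub_cancel_right, ← Nat.cast_succ] at h3
      have h4 := mul_le_mul_of_nonneg_left (ih (by omega)) hs0
      have h5 : (K₁ + K₂) * (1 + ‖u (t + 1)‖) ≤ D * (1 - s) * (1 + L) := by
        rw [hDs]
        have := hu (t + 1) (Finset.mem_Icc.2 ⟨by omega, ht⟩)
        gcongr
      have h6 : s * N (F.state z 0) ≤ 1 * N (F.state z 0) :=
        mul_le_mul_of_nonneg_right hs1.le (apply_nonneg N _)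
      linarith
  calc ‖F.state z t‖ ≤ C₂ * N (F.state z t) := hN₂ _
    _ ≤ C₂ * (C₁ * ‖F.state z 0‖ + D * (1 + L)) :=
        mul_le_mul_of_nonneg_left ((hmain t ht).trans (by linarith [hN₁ (F.state z 0)])) hC₂.le
    _ ≤ C₂ * ((C₁ + D) * (‖F.state z 0‖ + 1 + L)) := by
        refine mul_le_mul_of_nonneg_left ?_ hC₂.le
        have h3 := mul_nonneg hD0.le (norm_nonneg (F.state z 0))
        have h4 := mul_nonneg hC₁.le (by linarith : 0 ≤ 1 + L)
        linarith
    _ = _ := by ring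

end KinkedFactorisation

end CKSVAR

theorem Matrix.exists_norm_mulVec_le {α β : Type*} [Fintype α] [Fintype β] (A : Matrix α β ℝ) :
    ∃ C > 0, ∀ v, ‖A *ᵥ v‖ ≤ C * ‖v‖ := by
  set T := LinearMap.toContinuousLinearMap A.mulVecLin
  refine ⟨‖T‖ + 1, by positivity, fun v => (T.le_opNorm v).trans ?_⟩
  exact mul_le_mul_of_nonneg_right (by linarith) (norm_nonneg _)

/-! ### Common trends. -/

namespace CKSVAR

variable {m k : ℕ} {M : CKSVAR m k}

theorem PhiStar_mul_S (y : ℝ) (i : ℕ) : M.PhiStar i * S m y = M.Phi y i := by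
  ext a j
  by_cases h : 0 ≤ y <;> rcases j with j | j <;>
    simp [PhiStar, starCols, S, Phi, phi, Matrix.mul_apply, h, Matrix.one_apply]

theorem GammaStar_mul_S (y : ℝ) (i : ℕ) : M.GammaStar i * S m y = M.Gamma y i := by
  simp [GammaStar, Gamma, Matrix.sum_mul, PhiStar_mul_S]

/-- When the regime is that of z itself, Γ(1; y) z is linear in z*; hence it is Lipschitz and
positively homogeneous in z despite the switch. -/
theorem IsCanonical.GammaOne_mulVec (h : M.IsCanonical) (z : ZSpace m) :
    M.GammaOne (yPart z) *ᵥ WithLp.ofLp z =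
      WithLp.ofLp z - ∑ i ∈ Finset.range (k - 1), M.GammaStar (i + 1) *ᵥ zStar z := by
  have h1 : M.GammaOne (yPart z) = M.PhiStar 0 * S m (yPart z) -
      ∑ i ∈ Finset.range (k - 1), M.GammaStar (i + 1) * S m (yPart z) := by
    rw [GammaOne, PhiStar_mul_S, Finset.range_eq_Ico, Finset.sum_Ico_add'
      (fun i => M.GammaStar i * S m (yPart z)) 0 (k - 1) 1]
    congr 1
    refine Finset.sum_congr ?_ fun i _ => (GammaStar_mul_S _ _).symm
    ext i; simp only [Finset.mem_Icc, Finset.mem_Ico]; omega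
  rw [h1, Matrix.sub_mulVec, Matrix.sum_mulVec, ← Matrix.mulVec_mulVec, S_mulVec, h.mulVec_zStar]
  congr 1
  refine Finset.sum_congr rfl fun i _ => ?_
  rw [← Matrix.mulVec_mulVec, S_mulVec]

namespace KinkedFactorisation

variable {r d : ℕ} (F : M.KinkedFactorisation r d)

/-- The difference telescopes into at most k - 1 of the increments stacked in the state. -/
theorem norm_zStar_sub_le_state (z : ℤ → ZSpace m) (t : ℤ) {i : ℕ} (hi : i < k - 1) :
    ‖zStar (z t) - zStar (z (t - 1 - i))‖ ≤ k * ‖F.state z t‖ := by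
  have hinc : ∀ j < k - 1, ‖zStar (z (t - j)) - zStar (z (t - j - 1))‖ ≤ ‖F.state z t‖ := by
    intro j hj
    refine (pi_norm_le_iff_of_nonneg (norm_nonneg _)).2 fun s => ?_
    exact norm_le_pi_norm (F.state z t) (Sum.inr (⟨j, hj⟩, s))
  have htel : ∀ j ≤ k - 1, ‖zStar (z t) - zStar (z (t - j))‖ ≤ j * ‖F.state z t‖ := by
    intro j
    induction j with
    | zero => simp
    | succ j ih =>
      intro hj
      have h1 := ih (by omega)
      have h2 := hinc j (by omega)
      have h3 : t - (j + 1 : ℕ) = t - j - 1 := by push_cast; ring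
      rw [h3, ← sub_add_sub_cancel _ (zStar (z (t - j)))]
      refine (norm_add_le _ _).trans ((add_le_add h1 h2).trans_eq ?_)
      push_cast; ring
  have h1 := htel (i + 1) (by omega)
  have h2 : t - (i + 1 : ℕ) = t - 1 - i := by push_cast; ring
  rw [h2] at h1
  refine h1.trans (mul_le_mul_of_nonneg_right ?_ (norm_nonneg _))
  exact_mod_cast (by omega : i + 1 ≤ k)

/-- The intercept lies in the column space of Π⁺ = α β(+1)ᵀ, hence in that of α: there is no linear
drift in the common trends. -/
theorem αperp_mulVec_c (hc : ∃ v, M.Pi 1 *ᵥ v = M.c) : F.αperpᵀ *ᵥ M.c = 0 := by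
  obtain ⟨v, hv⟩ := hc
  have h1 : M.Pi 1 = F.α * (F.β 1)ᵀ := by
    rw [F.transpose_β, ← Matrix.mul_assoc, ← F.starCols_eq_mul_βStar]
    ext i j
    rcases j with j | j <;> simp [Pi, starCols, S, Matrix.mul_apply, Matrix.one_apply]
  rw [← hv, h1, Matrix.mulVec_mulVec, ← Matrix.mul_assoc, F.αperp_mul]
  simp

/-- The common trends accumulate the errors, up to a remainder controlled by the stacked
process. -/
theorem exists_commonTrend_remainder_le (h : M.IsCanonical) (hc : ∃ v, M.Pi 1 *ᵥ v = M.c) :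
    ∃ C > 0, ∀ (u : ℕ → ZSpace m) (z : ℤ → ZSpace m), M.Generates u z → ∀ j : ℕ,
      ‖F.αperpᵀ *ᵥ (M.GammaOne (yPart (z j)) *ᵥ WithLp.ofLp (z j) -
        (M.GammaOne (yPart (z 0)) *ᵥ WithLp.ofLp (z 0) +
          WithLp.ofLp (∑ t ∈ Finset.Icc 1 j, u t)))‖ ≤ C * (‖F.state z j‖ + ‖F.state z 0‖) := by
  choose K hK0 hK using fun i => Matrix.exists_norm_mulVec_le (F.αperpᵀ * M.GammaStar (i + 1))
  refine ⟨∑ i ∈ Finset.range (k - 1), K i * k + 1, ?_, fun u z hz j => ?_⟩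
  · have : 0 ≤ ∑ i ∈ Finset.range (k - 1), K i * k :=
      Finset.sum_nonneg fun i _ => mul_nonneg (hK0 i).le (Nat.cast_nonneg k)
    linarith
  -- Summation over time: α_⊥ᵀ removes the intercept and the error correction term, and the lagged
  -- increments of z* telescope.
  have hsum : F.αperpᵀ *ᵥ (WithLp.ofLp (z j) - WithLp.ofLp (z 0)) =
      ∑ i ∈ Finset.range (k - 1), (F.αperpᵀ * M.GammaStar (i + 1)) *ᵥ
        (zStar (z ((j : ℤ) - 1 - i)) - zStar (z (0 - 1 - i))) +
      F.αperpᵀ *ᵥ WithLp.ofLp (∑ t ∈ Finset.Icc 1 j, u t) := by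
    induction j with
    | zero => simp
    | succ j ih =>
      have h1 := congrArg (F.αperpᵀ *ᵥ ·) (hz.error_correction h (t := j + 1) (by omega))
      simp only [Nat.cast_succ, add_sub_cancel_right] at h1
      rw [F.starCols_eq_mul_βStar, Matrix.mulVec_add, Matrix.mulVec_add, Matrix.mulVec_add,
        F.αperp_mulVec_c hc, Matrix.mulVec_mulVec, ← Matrix.mul_assoc, F.αperp_mul,
        Matrix.zero_mul, Matrix.zero_mulVec, zero_add, zero_add, Matrix.mulVec_sum] at h1
      rw [Finset.sum_Icc_succ_top (by omega), WithLp.ofLp_add, Matrix.mulVec_add,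
        ← sub_add_sub_cancel _ (WithLp.ofLp (z j)), Matrix.mulVec_add, ih, ← WithLp.ofLp_sub]
      simp only [Nat.cast_succ]
      rw [h1]
      have h2 : ∀ i ∈ Finset.range (k - 1), (F.αperpᵀ * M.GammaStar (i + 1)) *ᵥ
          (zStar (z ((j : ℤ) + 1 - 1 - i)) - zStar (z (0 - 1 - i))) =
          F.αperpᵀ *ᵥ M.GammaStar (i + 1) *ᵥ
            (zStar (z ((j : ℤ) - i)) - zStar (z ((j : ℤ) - i - 1))) +
          (F.αperpᵀ * M.GammaStar (i + 1)) *ᵥ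
            (zStar (z ((j : ℤ) - 1 - i)) - zStar (z (0 - 1 - i))) := by
        intro i _
        rw [Matrix.mulVec_mulVec, ← Matrix.mulVec_add]
        have h3 : (j : ℤ) + 1 - 1 - i = j - i := by ring
        have h4 : (j : ℤ) - 1 - i = j - i - 1 := by ring
        rw [h3, h4, sub_add_sub_cancel]
      rw [Finset.sum_congr rfl h2, Finset.sum_add_distrib]
      abel
  -- Γ(1; y) z contains z* at the current date, the telescoped sum contains it at lag i + 1; what
  -- remains are differences within the window of the state at times j and 0.
  have hrem : F.αperpᵀ *ᵥ (M.GammaOne (yPart (z j)) *ᵥ WithLp.ofLp (z j) -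
        (M.GammaOne (yPart (z 0)) *ᵥ WithLp.ofLp (z 0) +
          WithLp.ofLp (∑ t ∈ Finset.Icc 1 j, u t))) =
      ∑ i ∈ Finset.range (k - 1), (F.αperpᵀ * M.GammaStar (i + 1)) *ᵥ
        ((zStar (z 0) - zStar (z (0 - 1 - i))) - (zStar (z j) - zStar (z ((j : ℤ) - 1 - i)))) := by
    rw [h.GammaOne_mulVec, h.GammaOne_mulVec]
    have h1 : WithLp.ofLp (z j) - ∑ i ∈ Finset.range (k - 1), M.GammaStar (i + 1) *ᵥ zStar (z j) -
        (WithLp.ofLp (z 0) - ∑ i ∈ Finset.range (k - 1), M.GammaStar (i + 1) *ᵥ zStar (z 0) +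
          WithLp.ofLp (∑ t ∈ Finset.Icc 1 j, u t)) =
        (WithLp.ofLp (z j) - WithLp.ofLp (z 0)) +
        ∑ i ∈ Finset.range (k - 1), M.GammaStar (i + 1) *ᵥ (zStar (z 0) - zStar (z j)) -
          WithLp.ofLp (∑ t ∈ Finset.Icc 1 j, u t) := by
      simp only [Matrix.mulVec_sub, Finset.sum_sub_distrib]
      abel
    rw [h1, Matrix.mulVec_sub, Matrix.mulVec_add, hsum, Matrix.mulVec_sum, add_right_comm,
      add_sub_cancel_right, ← Finset.sum_add_distrib]
    refine Finset.sum_congr rfl fun i _ => ?_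
    rw [Matrix.mulVec_mulVec, ← Matrix.mulVec_add]
    congr 1
    abel
  rw [hrem]
  have hpos : 0 ≤ ‖F.state z j‖ + ‖F.state z 0‖ := by positivity
  calc _ ≤ ∑ i ∈ Finset.range (k - 1), K i * k * (‖F.state z j‖ + ‖F.state z 0‖) := by
        refine (norm_sum_le _ _).trans (Finset.sum_le_sum fun i hi => (hK i _).trans ?_)
        rw [mul_assoc]
        refine mul_le_mul_of_nonneg_left ((norm_sub_le _ _).trans ?_) (hK0 i).le
        have h1 := F.norm_zStar_sub_le_state z 0 (Finset.mem_range.1 hi)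
        have h2 := F.norm_zStar_sub_le_state z j (Finset.mem_range.1 hi)
        linarith
    _ ≤ _ := by
        rw [← Finset.sum_mul]
        exact mul_le_mul_of_nonneg_right (by linarith) hpos

end KinkedFactorisation

end CKSVAR

/-! ### Kinked linear maps with an inverse -/

theorem EuclideanSpace.exists_norm_le_mul_norm_ofLp (ι : Type*) [Fintype ι] :
    ∃ C > 0, ∀ v : EuclideanSpace ℝ ι, ‖v‖ ≤ C * ‖WithLp.ofLp v‖ := by
  set T := LinearMap.toContinuousLinearMap (WithLp.linearEquiv 2 ℝ (ι → ℝ)).symm.toLinearMap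
  refine ⟨‖T‖ + 1, by positivity, fun v => ?_⟩
  refine (T.le_opNorm (WithLp.ofLp v)).trans ?_
  exact mul_le_mul_of_nonneg_right (by linarith) (norm_nonneg _)

theorem EuclideanSpace.norm_ofLp_le {ι : Type*} [Fintype ι] (v : EuclideanSpace ℝ ι) : ‖WithLp.ofLp v‖ ≤ ‖v‖ :=
  (pi_norm_le_iff_of_nonneg (norm_nonneg _)).2 fun i => PiLp.norm_apply_le v i

section Kink

variable {n α : Type*} [Fintype n] [DecidableEq n]

/-- Two matrices that differ at most in one column, selected by the sign of the corresponding
coordinate, define a map whose increments are those of convex combinations of the matrices. -/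
theorem exists_kink_mulVec_sub (o : n) {K : ℝ → Matrix α n ℝ}
    (hK : ∀ y, K y = if 0 ≤ y then K 1 else K (-1)) (hcol : ∀ i, ∀ j ≠ o, K 1 i j = K (-1) i j)
    (w w' : n → ℝ) : ∃ a : ℝ, 0 ≤ a ∧ a ≤ 1 ∧
      K (w o) *ᵥ w - K (w' o) *ᵥ w' = (a • K 1 + (1 - a) • K (-1)) *ᵥ (w - w') := by
  obtain ⟨a, ha0, ha1, h1, h2⟩ := exists_kink_weight (w o) (w' o)
  refine ⟨a, ha0, ha1, ?_⟩
  have hval (v : n → ℝ) (i : α) : (K (v o) *ᵥ v) i =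
      max (v o) 0 * K 1 i o + min (v o) 0 * K (-1) i o +
        ∑ j ∈ Finset.univ.erase o, K 1 i j * v j := by
    rw [hK, mulVec, dotProduct, ← Finset.add_sum_erase _ _ (Finset.mem_univ o)]
    split_ifs with h
    · rw [max_eq_left h, min_eq_right h]; ring
    · push Not at h
      rw [max_eq_right h.le, min_eq_left h.le]
      rw [Finset.sum_congr rfl fun j hj => by rw [← hcol i j (Finset.ne_of_mem_erase hj)]]
      ring
  ext i
  rw [Pi.sub_apply, hval, hval, mulVec, dotProduct, ← Finset.add_sum_erase _ _ (Finset.mem_univ o)]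
  have h3 : ∑ j ∈ Finset.univ.erase o, (a • K 1 + (1 - a) • K (-1)) i j * (w - w') j =
      ∑ j ∈ Finset.univ.erase o, K 1 i j * w j - ∑ j ∈ Finset.univ.erase o, K 1 i j * w' j := by
    rw [← Finset.sum_sub_distrib]
    refine Finset.sum_congr rfl fun j hj => ?_
    simp only [Matrix.add_apply, Matrix.smul_apply, smul_eq_mul, Pi.sub_apply,
      ← hcol i j (Finset.ne_of_mem_erase hj)]
    ring
  rw [h3]
  simp only [Matrix.add_apply, Matrix.smul_apply, smul_eq_mul, Pi.sub_apply]
  linear_combination K 1 i o * h1 + K (-1) i o * h2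

theorem exists_norm_kink_mulVec_sub_le [Fintype α] (o : n) {K : ℝ → Matrix α n ℝ}
    (hK : ∀ y, K y = if 0 ≤ y then K 1 else K (-1)) (hcol : ∀ i, ∀ j ≠ o, K 1 i j = K (-1) i j) :
    ∃ C > 0, ∀ w w' : n → ℝ, ‖K (w o) *ᵥ w - K (w' o) *ᵥ w'‖ ≤ C * ‖w - w'‖ := by
  obtain ⟨C₁, hC₁, h₁⟩ := Matrix.exists_norm_mulVec_le (K 1)
  obtain ⟨C₂, hC₂, h₂⟩ := Matrix.exists_norm_mulVec_le (K (-1))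
  refine ⟨C₁ + C₂, by positivity, fun w w' => ?_⟩
  obtain ⟨a, ha0, ha1, heq⟩ := exists_kink_mulVec_sub o hK hcol w w'
  rw [heq, Matrix.add_mulVec, Matrix.smul_mulVec, Matrix.smul_mulVec, add_mul]
  refine (norm_add_le _ _).trans (add_le_add ?_ ?_)
  · rw [norm_smul, Real.norm_eq_abs, abs_of_nonneg ha0]
    exact (mul_le_of_le_one_left (norm_nonneg _) ha1).trans (h₁ _)
  · rw [norm_smul, Real.norm_eq_abs, abs_of_nonneg (sub_nonneg.2 ha1)]
    exact (mul_le_of_le_one_left (norm_nonneg _) (by linarith)).trans (h₂ _)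

/-- The combination is A with a single column replaced, and the determinant is linear in that
column. -/
theorem det_convexComb_of_eq_off_column (o : n) {A B : Matrix n n ℝ}
    (hcol : ∀ i, ∀ j ≠ o, A i j = B i j) (a : ℝ) :
    (a • A + (1 - a) • B).det = a * A.det + (1 - a) * B.det := by
  have h1 : a • A + (1 - a) • B =
      A.updateCol o (a • A.col o + (1 - a) • B.col o) := by
    ext i j
    by_cases hj : j = o
    · subst hj; simp [Matrix.col]
    · simp [hj, ← hcol i j hj]; ring
  have h2 : A.updateCol o (A.col o) = A := by
    ext i j
    by_cases hj : j = o
    · subst hj; simp [Matrix.col]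
    · simp [hj]
  have h3 : A.updateCol o (B.col o) = B := by
    ext i j
    by_cases hj : j = o
    · subst hj; simp [Matrix.col]
    · simp [hj, hcol i j hj]
  rw [h1, det_updateCol_add, det_updateCol_smul, det_updateCol_smul, h2, h3]

/-- The norm of the image attains a positive minimum over weights in [0,1] and unit vectors, by
compactness. -/
theorem exists_norm_le_convexComb_mulVec [Nonempty n] {A B : Matrix n n ℝ}
    (h : ∀ a : ℝ, 0 ≤ a → a ≤ 1 → (a • A + (1 - a) • B).det ≠ 0) :
    ∃ C > 0, ∀ a : ℝ, 0 ≤ a → a ≤ 1 → ∀ w, ‖w‖ ≤ C * ‖(a • A + (1 - a) • B) *ᵥ w‖ := by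
  have hcont : Continuous fun x : ℝ × (n → ℝ) => ‖(x.1 • A + (1 - x.1) • B) *ᵥ x.2‖ := by
    refine Continuous.norm (Continuous.matrix_mulVec ?_ continuous_snd)
    fun_prop
  obtain ⟨x, hx⟩ := exists_norm_eq (n → ℝ) zero_le_one
  obtain ⟨⟨a₀, w₀⟩, ⟨ha₀, hw₀⟩, hmin⟩ :=
    (isCompact_Icc.prod (isCompact_sphere (0 : n → ℝ) 1)).exists_isMinOn
      (s := Set.Icc (0 : ℝ) 1 ×ˢ Metric.sphere (0 : n → ℝ) 1)
      ⟨(0, x), ⟨by simp, by simpa using hx⟩⟩ hcont.continuousOn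
  set c := ‖(a₀ • A + (1 - a₀) • B) *ᵥ w₀‖ with hc
  have hc0 : 0 < c := by
    rw [hc, norm_pos_iff]
    intro h0
    have h1 := Matrix.eq_zero_of_mulVec_eq_zero (h a₀ ha₀.1 ha₀.2) h0
    simp [h1] at hw₀
  refine ⟨c⁻¹, inv_pos.2 hc0, fun a ha0 ha1 w => ?_⟩
  by_cases hw : w = 0
  · simp [hw]
  have hw0 : 0 < ‖w‖ := norm_pos_iff.2 hw
  have h1 := hmin (a := (a, ‖w‖⁻¹ • w)) ⟨⟨ha0, ha1⟩, by simp [norm_smul, hw0.ne']⟩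
  have h2 : c ≤ ‖(a • A + (1 - a) • B) *ᵥ (‖w‖⁻¹ • w)‖ := h1
  rw [Matrix.mulVec_smul, norm_smul, norm_inv, norm_norm, le_inv_mul_iff₀ hw0] at h2
  rw [le_inv_mul_iff₀ hc0]
  linarith

/-- Determinants of equal sign keep every convex combination invertible. Increments of the kinked
map are images under such combinations, so the map is injective with Lipschitz inverse. -/
theorem exists_norm_sub_le_kink_mulVec_sub [Nonempty n] (o : n) {K : ℝ → Matrix n n ℝ}
    (hK : ∀ y, K y = if 0 ≤ y then K 1 else K (-1)) (hcol : ∀ i, ∀ j ≠ o, K 1 i j = K (-1) i j)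
    (hdet : SignType.sign (K 1).det = SignType.sign (K (-1)).det) (hdet0 : (K 1).det ≠ 0) :
    ∃ C > 0, ∀ w w' : n → ℝ, ‖w - w'‖ ≤ C * ‖K (w o) *ᵥ w - K (w' o) *ᵥ w'‖ := by
  obtain ⟨C, hC, h⟩ := exists_norm_le_convexComb_mulVec (A := K 1) (B := K (-1)) (by
    intro a ha0 ha1
    rw [det_convexComb_of_eq_off_column o hcol]
    rcases lt_or_gt_of_ne hdet0 with h | h
    · have h' : (K (-1)).det < 0 := by
        rw [← sign_eq_neg_one_iff, ← hdet, sign_eq_neg_one_iff]; exact h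
      rcases eq_or_lt_of_le ha0 with rfl | ha
      · simpa using h'.ne
      · nlinarith [mul_neg_of_pos_of_neg ha h]
    · have h' : 0 < (K (-1)).det := by
        rw [← sign_eq_one_iff, ← hdet, sign_eq_one_iff]; exact h
      rcases eq_or_lt_of_le ha0 with rfl | ha
      · simpa using h'.ne'
      · nlinarith [mul_pos ha h])
  refine ⟨C, hC, fun w w' => ?_⟩
  obtain ⟨a, ha0, ha1, heq⟩ := exists_kink_mulVec_sub o hK hcol w w'
  rw [heq]
  exact h a ha0 ha1 _

theorem det_mul_inv_mulVec_apply (A : Matrix n n ℝ) (hA : A.det ≠ 0) (b : n → ℝ) (o : n) :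
    A.det * (A⁻¹ *ᵥ b) o = (A.updateCol o b).det := by
  rw [← Matrix.cramer_apply, Matrix.cramer_eq_adjugate_mulVec, Matrix.inv_def,
    Matrix.smul_mulVec, Pi.smul_apply, smul_eq_mul, Ring.inverse_eq_inv', mul_inv_cancel_left₀ hA]

/-- Cramer's rule: the numerator replaces the only column in which A and B differ, so it is common
to both, and the denominators have the same sign. -/
theorem sign_inv_mulVec_apply_eq {A B : Matrix n n ℝ} (o : n)
    (hcol : ∀ i, ∀ j ≠ o, A i j = B i j)
    (hdet : SignType.sign A.det = SignType.sign B.det) (hdet0 : A.det ≠ 0) (b : n → ℝ) :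
    SignType.sign ((A⁻¹ *ᵥ b) o) = SignType.sign ((B⁻¹ *ᵥ b) o) := by
  have hB0 : B.det ≠ 0 := by
    rw [← sign_ne_zero, ← hdet, sign_ne_zero]; exact hdet0
  have h1 : A.updateCol o b = B.updateCol o b := by
    ext i j
    by_cases hj : j = o
    · subst hj; simp
    · simp [hj, hcol i j hj]
  have h2 : A.det * (A⁻¹ *ᵥ b) o = B.det * (B⁻¹ *ᵥ b) o := by
    rw [det_mul_inv_mulVec_apply A hdet0, det_mul_inv_mulVec_apply B hB0, h1]
  have h3 := congrArg SignType.sign h2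
  rw [sign_mul, sign_mul, ← hdet] at h3
  exact mul_left_cancel₀ (sign_ne_zero.2 hdet0) h3

end Kink

/-! ### The kinked system of the model and its inverse. -/

namespace CKSVAR

variable {m k : ℕ} {M : CKSVAR m k}

theorem GammaOne_eq_ite (y : ℝ) :
    M.GammaOne y = if 0 ≤ y then M.GammaOne 1 else M.GammaOne (-1) := by
  have h10 : ¬ (1 : ℝ) ≤ 0 := by norm_num
  split_ifs with h <;> simp [GammaOne, Gamma, Phi, phi, h, h10]

theorem GammaOne_apply_inr (y y' : ℝ) (i : ZIdx m) (j : Fin m) :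
    M.GammaOne y i (Sum.inr j) = M.GammaOne y' i (Sum.inr j) := by
  simp [GammaOne, Gamma, Phi, Matrix.sum_apply]

namespace KinkedFactorisation

variable {r d : ℕ} (F : M.KinkedFactorisation r d)

theorem θ_eq_ite (y : ℝ) : F.θ y = if 0 ≤ y then F.θ 1 else F.θ (-1) := by
  have h10 : ¬ (1 : ℝ) ≤ 0 := by norm_num
  split_ifs with h <;> simp [θ, h, h10]

theorem βperp_eq_ite (y : ℝ) : F.βperp y = if 0 ≤ y then F.βperp 1 else F.βperp (-1) := by
  rw [βperp, θ_eq_ite]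
  split_ifs <;> rfl

theorem core_eq_ite (y : ℝ) : F.core y = if 0 ≤ y then F.core 1 else F.core (-1) := by
  rw [core, GammaOne_eq_ite, βperp_eq_ite]
  split_ifs <;> rfl

theorem proj_eq_ite (y : ℝ) : F.proj y = if 0 ≤ y then F.proj 1 else F.proj (-1) := by
  rw [proj, core_eq_ite, βperp_eq_ite]
  split_ifs <;> rfl

theorem βperp_apply_inr (y y' : ℝ) (i : ZIdx m) (j : Fin d) :
    F.βperp y i (Sum.inr j) = F.βperp y' i (Sum.inr j) := by
  rcases i with i | i <;> simp [βperp]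

/-- Only the first columns of Γ(1; y) and β_⊥(y) depend on the regime, and the other columns of β_⊥
vanish in the y coordinate, so they never meet the first column of Γ(1; y). -/
theorem core_apply_inr (y y' : ℝ) (i : Unit ⊕ Fin d) (j : Fin d) :
    F.core y i (Sum.inr j) = F.core y' i (Sum.inr j) := by
  have h (y : ℝ) : F.core y i (Sum.inr j) =
      ∑ l, (∑ a, F.αperpᵀ i a * M.GammaOne y a (Sum.inr l)) * F.βxperp l j := by
    simp [core, Matrix.mul_apply, βperp]
  rw [h, h]
  simp only [M.GammaOne_apply_inr y y']

theorem βperp_mulVec_inl (y : ℝ) (w : Unit ⊕ Fin d → ℝ) :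
    (F.βperp y *ᵥ w) (Sum.inl ()) = w (Sum.inl ()) := by
  simp [βperp, mulVec, dotProduct]

/-- `z = (y, x)` decomposes along the columns of `β_⊥(y)` and `β_x`, and the second component is
determined by the equilibrium error. -/
theorem exists_eq_βperp_mulVec_add : ∃ B : Matrix (ZIdx m) (Fin r) ℝ,
    (∀ i, B (Sum.inl ()) i = 0) ∧ ∀ z : ZSpace m, ∃ w : Unit ⊕ Fin d → ℝ,
      w (Sum.inl ()) = yPart z ∧
        WithLp.ofLp z = F.βperp (yPart z) *ᵥ w + B *ᵥ WithLp.ofLp (F.eqError z) := by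
  -- The Gram matrix is invertible because β_x has full column rank; it yields the projection onto
  -- the columns of β_x.
  set G := F.βxᵀ * F.βx with hG
  have hGdet : IsUnit G.det := by
    rw [isUnit_iff_ne_zero, Ne, ← Matrix.exists_mulVec_eq_zero_iff]
    rintro ⟨v, hv0, hv⟩
    have h1 : v ∈ LinearMap.ker F.βx.mulVecLin := by
      rw [← Matrix.ker_mulVecLin_transpose_mul_self]; exact hv
    have h2 := F.βx.mulVecLin.finrank_range_add_finrank_ker
    have h3 : Module.finrank ℝ (LinearMap.range F.βx.mulVecLin) = r := F.βx_rank
    simp only [h3, Module.finrank_fintype_fun_eq_card, Fintype.card_fin] at h2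
    have h4 : Module.finrank ℝ (LinearMap.ker F.βx.mulVecLin) = 0 := by omega
    rw [Submodule.finrank_eq_zero] at h4
    rw [h4] at h1
    exact hv0 h1
  -- One inclusion is orthogonality; equality follows from the dimension count r + d = m.
  have hker : ∀ v : Fin m → ℝ, F.βxᵀ *ᵥ v = 0 → ∃ a, F.βxperp *ᵥ a = v := by
    have hle : LinearMap.range F.βxperp.mulVecLin ≤ LinearMap.ker F.βxᵀ.mulVecLin := by
      rintro _ ⟨a, rfl⟩
      have h1 : F.βxᵀ * F.βxperp = 0 := by
        rw [← Matrix.transpose_transpose (F.βxᵀ * F.βxperp), Matrix.transpose_mul,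
          Matrix.transpose_transpose, F.βxperp_mul, Matrix.transpose_zero]
      rw [LinearMap.mem_ker, Matrix.mulVecLin_apply, Matrix.mulVecLin_apply, Matrix.mulVec_mulVec, h1,
        Matrix.zero_mulVec]
    have hrank : Module.finrank ℝ (LinearMap.range F.βxperp.mulVecLin) =
        Module.finrank ℝ (LinearMap.ker F.βxᵀ.mulVecLin) := by
      have h1 := F.βxᵀ.mulVecLin.finrank_range_add_finrank_ker
      have h2 : Module.finrank ℝ (LinearMap.range F.βxᵀ.mulVecLin) = r := by
        have := F.βx_rank
        rw [← Matrix.rank_transpose] at this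
        exact this
      have h3 : Module.finrank ℝ (LinearMap.range F.βxperp.mulVecLin) = d := F.βxperp_rank
      have h4 := F.dim_eq
      simp only [Module.finrank_fintype_fun_eq_card, Fintype.card_fin] at h1
      omega
    have heq := Submodule.eq_of_le_of_finrank_eq hle hrank
    intro v hv
    have h1 : v ∈ LinearMap.ker F.βxᵀ.mulVecLin := hv
    rw [← heq] at h1
    exact h1
  refine ⟨fromRows 0 (F.βx * G⁻¹), by simp, fun z => ?_⟩
  set x : Fin m → ℝ := fun j => z (Sum.inr j) with hx
  -- The shift by y θ(y) gives ξ = β_xᵀ x', so the part of x' along β_x depends on ξ alone and the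
  -- rest lies in the range of β_{x,⊥}.
  set x' : Fin m → ℝ := x + yPart z • F.θ (yPart z) with hx'
  have hξ : WithLp.ofLp (F.eqError z) = F.βxᵀ *ᵥ x' := by
    ext i
    simp [eqError, act, β, mulVec, dotProduct, hx', hx, mul_add, Finset.sum_add_distrib]
    rw [Finset.sum_mul, add_comm]
    congr 1
    refine Finset.sum_congr rfl fun j _ => ?_
    rw [show z.ofLp (Sum.inl ()) = yPart z from rfl]
    ring
  obtain ⟨a, ha⟩ := hker (x' - F.βx *ᵥ (G⁻¹ *ᵥ (F.βxᵀ *ᵥ x'))) (by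
    rw [Matrix.mulVec_sub, Matrix.mulVec_mulVec, Matrix.mulVec_mulVec, Matrix.mulVec_mulVec, ← hG,
      Matrix.mul_nonsing_inv _ hGdet, Matrix.one_mul, sub_self])
  refine ⟨Sum.elim (fun _ => yPart z) a, rfl, ?_⟩
  have hxz : x = F.βxperp *ᵥ a - yPart z • F.θ (yPart z) +
      F.βx *ᵥ (G⁻¹ *ᵥ (F.βxᵀ *ᵥ x')) := by
    rw [ha, hx']; abel
  rw [hξ, Matrix.fromRows_mulVec, βperp, Matrix.fromBlocks_mulVec]
  ext i
  rcases i with i | i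
  · simp [yPart]
  · have := congrFun hxz i
    simp only [hx] at this
    simp [this]
    have h1 : (-replicateCol Unit (F.θ (yPart z)) *ᵥ fun _ => yPart z) i =
        -(yPart z * F.θ (yPart z) i) := by
      simp [mulVec, dotProduct, mul_comm]
    rw [h1, Matrix.mul_assoc]
    ring

/-- The limiting map `v ↦ P_{β_⊥}(ϑᵀ v) v`. -/
noncomputable def trendMap (v : ZSpace m) : ZSpace m :=
  act (F.proj (F.vartheta ⬝ᵥ WithLp.ofLp v)) v

theorem proj_mulVec (y : ℝ) (v : ZIdx m → ℝ) :
    F.proj y *ᵥ v = F.βperp y *ᵥ ((F.core y)⁻¹ *ᵥ (F.αperpᵀ *ᵥ v)) := by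
  rw [proj, Matrix.mulVec_mulVec, Matrix.mulVec_mulVec, Matrix.mul_assoc]

theorem vartheta_dotProduct (v : ZIdx m → ℝ) :
    F.vartheta ⬝ᵥ v = ((F.core 1)⁻¹ *ᵥ (F.αperpᵀ *ᵥ v)) (Sum.inl ()) := by
  rw [← F.βperp_mulVec_inl 1 ((F.core 1)⁻¹ *ᵥ _), ← proj_mulVec]
  rfl

/-- Solving in either regime gives the same sign of y, so ϑᵀv, computed in the positive regime,
selects the regime consistently. -/
theorem sign_core_inv_mulVec
    (hdet : SignType.sign (F.core 1).det = SignType.sign (F.core (-1)).det)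
    (hdet0 : (F.core 1).det ≠ 0) (y : ℝ) (v : ZIdx m → ℝ) :
    SignType.sign (((F.core y)⁻¹ *ᵥ (F.αperpᵀ *ᵥ v)) (Sum.inl ())) =
      SignType.sign (F.vartheta ⬝ᵥ v) := by
  rw [vartheta_dotProduct, core_eq_ite]
  split_ifs with h
  · rfl
  · refine (sign_inv_mulVec_apply_eq (Sum.inl ()) (fun i j hj => ?_) hdet hdet0 _).symm
    rcases j with j | j
    · exact absurd rfl hj
    · exact F.core_apply_inr _ _ _ _

theorem sign_yPart_trendMap
    (hdet : SignType.sign (F.core 1).det = SignType.sign (F.core (-1)).det)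
    (hdet0 : (F.core 1).det ≠ 0) (v : ZSpace m) :
    SignType.sign (yPart (F.trendMap v)) = SignType.sign (F.vartheta ⬝ᵥ WithLp.ofLp v) := by
  rw [← F.sign_core_inv_mulVec hdet hdet0 (F.vartheta ⬝ᵥ WithLp.ofLp v),
    ← F.βperp_mulVec_inl (F.vartheta ⬝ᵥ WithLp.ofLp v) ((F.core _)⁻¹ *ᵥ _), ← proj_mulVec]
  rfl

/-- The coordinates of `trendMap v` along the columns of `β_⊥`. -/
noncomputable def trendCoef (v : ZIdx m → ℝ) : Unit ⊕ Fin d → ℝ :=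
  (F.core (F.vartheta ⬝ᵥ v))⁻¹ *ᵥ (F.αperpᵀ *ᵥ v)

theorem trendCoef_nonneg_iff
    (hdet : SignType.sign (F.core 1).det = SignType.sign (F.core (-1)).det)
    (hdet0 : (F.core 1).det ≠ 0) (v : ZIdx m → ℝ) :
    0 ≤ F.trendCoef v (Sum.inl ()) ↔ 0 ≤ F.vartheta ⬝ᵥ v := by
  rw [← sign_nonneg_iff, trendCoef, F.sign_core_inv_mulVec hdet hdet0, sign_nonneg_iff]

/-- The regime chosen for the inversion is the regime of the resulting first coordinate, so the
vector solves the kinked equation and not just one of its linear branches. -/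
theorem core_mulVec_trendCoef
    (hdet : SignType.sign (F.core 1).det = SignType.sign (F.core (-1)).det)
    (hdet0 : (F.core 1).det ≠ 0) (v : ZIdx m → ℝ) :
    F.core (F.trendCoef v (Sum.inl ())) *ᵥ F.trendCoef v = F.αperpᵀ *ᵥ v := by
  have h1 : F.core (F.trendCoef v (Sum.inl ())) = F.core (F.vartheta ⬝ᵥ v) := by
    rw [core_eq_ite, F.core_eq_ite (F.vartheta ⬝ᵥ v)]
    simp only [F.trendCoef_nonneg_iff hdet hdet0]
  have hneg : (F.core (-1)).det ≠ 0 := by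
    rw [← sign_ne_zero, ← hdet, sign_ne_zero]; exact hdet0
  have h2 : IsUnit (F.core (F.vartheta ⬝ᵥ v)).det := by
    rw [core_eq_ite, isUnit_iff_ne_zero]
    split_ifs
    exacts [hdet0, hneg]
  rw [h1, trendCoef, Matrix.mulVec_mulVec, Matrix.mul_nonsing_inv _ h2, Matrix.one_mulVec]

theorem ofLp_trendMap
    (hdet : SignType.sign (F.core 1).det = SignType.sign (F.core (-1)).det)
    (hdet0 : (F.core 1).det ≠ 0) (v : ZSpace m) :
    WithLp.ofLp (F.trendMap v) =
      F.βperp (F.trendCoef (WithLp.ofLp v) (Sum.inl ())) *ᵥ F.trendCoef (WithLp.ofLp v) := by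
  have h1 : F.βperp (F.trendCoef (WithLp.ofLp v) (Sum.inl ())) =
      F.βperp (F.vartheta ⬝ᵥ WithLp.ofLp v) := by
    rw [βperp_eq_ite, F.βperp_eq_ite (F.vartheta ⬝ᵥ WithLp.ofLp v)]
    simp only [F.trendCoef_nonneg_iff hdet hdet0]
  rw [h1, trendCoef, ← proj_mulVec]
  rfl

theorem exists_norm_βperp_mulVec_sub_le : ∃ C > 0, ∀ w w' : Unit ⊕ Fin d → ℝ,
    ‖F.βperp (w (Sum.inl ())) *ᵥ w - F.βperp (w' (Sum.inl ())) *ᵥ w'‖ ≤ C * ‖w - w'‖ := by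
  refine exists_norm_kink_mulVec_sub_le (Sum.inl ()) F.βperp_eq_ite fun i j hj => ?_
  rcases j with j | j
  · exact absurd rfl hj
  · exact F.βperp_apply_inr _ _ _ _

theorem exists_norm_sub_le_core
    (hdet : SignType.sign (F.core 1).det = SignType.sign (F.core (-1)).det)
    (hdet0 : (F.core 1).det ≠ 0) : ∃ C > 0, ∀ w w' : Unit ⊕ Fin d → ℝ,
    ‖w - w'‖ ≤ C * ‖F.core (w (Sum.inl ())) *ᵥ w - F.core (w' (Sum.inl ())) *ᵥ w'‖ := by
  refine exists_norm_sub_le_kink_mulVec_sub (Sum.inl ()) F.core_eq_ite (fun i j hj => ?_) hdet hdet0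
  rcases j with j | j
  · exact absurd rfl hj
  · exact F.core_apply_inr _ _ _ _

/-- `trendMap` inverts `z ↦ (β(y)ᵀ z, α_⊥ᵀ Γ(1; y) z)` in a Lipschitz way. -/
theorem exists_norm_sub_trendMap_le
    (hdet : SignType.sign (F.core 1).det = SignType.sign (F.core (-1)).det)
    (hdet0 : (F.core 1).det ≠ 0) : ∃ C > 0, ∀ z v : ZSpace m, ‖z - F.trendMap v‖ ≤
      C * (‖WithLp.ofLp (F.eqError z)‖ +
        ‖F.αperpᵀ *ᵥ (M.GammaOne (yPart z) *ᵥ WithLp.ofLp z - WithLp.ofLp v)‖) := by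
  obtain ⟨B, hB, hdecomp⟩ := F.exists_eq_βperp_mulVec_add
  obtain ⟨C₀, hC₀, h₀⟩ := EuclideanSpace.exists_norm_le_mul_norm_ofLp (ZIdx m)
  obtain ⟨C₁, hC₁, h₁⟩ := F.exists_norm_βperp_mulVec_sub_le
  obtain ⟨C₂, hC₂, h₂⟩ := F.exists_norm_sub_le_core hdet hdet0
  obtain ⟨C₃, hC₃, h₃⟩ := Matrix.exists_norm_mulVec_le B
  obtain ⟨C₄, hC₄, h₄⟩ := Matrix.exists_norm_mulVec_le (F.αperpᵀ * M.GammaOne 1 * B)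
  -- The y row of `B` is zero, so the regime-dependent column of Γ(1; y) does not contribute.
  have hΓB (y : ℝ) : M.GammaOne y * B = M.GammaOne 1 * B := by
    ext i j
    simp [Matrix.mul_apply, hB, M.GammaOne_apply_inr y 1]
  refine ⟨C₀ * (C₁ * (C₂ * (1 + C₄)) + C₃), by positivity, fun z v => ?_⟩
  obtain ⟨w, hw, hz⟩ := hdecomp z
  set ξ := WithLp.ofLp (F.eqError z)
  set R := F.αperpᵀ *ᵥ (M.GammaOne (yPart z) *ᵥ WithLp.ofLp z - WithLp.ofLp v)
  set w' := F.trendCoef (WithLp.ofLp v)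
  -- The coordinates `w` of z and `w'` of the trend solve the same kinked equation up to the
  -- remainder and a linear image of ξ; the Lipschitz inverse converts this into closeness.
  have hcore : F.core (w (Sum.inl ())) *ᵥ w - F.core (w' (Sum.inl ())) *ᵥ w' =
      R - (F.αperpᵀ * M.GammaOne 1 * B) *ᵥ ξ := by
    rw [F.core_mulVec_trendCoef hdet hdet0, hw]
    have h5 : R = F.core (yPart z) *ᵥ w + (F.αperpᵀ * M.GammaOne 1 * B) *ᵥ ξ -
        F.αperpᵀ *ᵥ WithLp.ofLp v := by
      simp only [R]
      rw [Matrix.mulVec_sub, hz, Matrix.mulVec_add, Matrix.mulVec_add, Matrix.mul_assoc F.αperpᵀ,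
        ← hΓB (yPart z), core]
      simp only [Matrix.mulVec_mulVec, Matrix.mul_assoc]
    rw [h5]
    abel
  have hww : ‖w - w'‖ ≤ C₂ * (1 + C₄) * (‖ξ‖ + ‖R‖) := by
    refine (h₂ w w').trans ?_
    rw [hcore, mul_assoc]
    refine mul_le_mul_of_nonneg_left ((norm_sub_le _ _).trans ?_) hC₂.le
    nlinarith [h₄ ξ, norm_nonneg ξ, norm_nonneg R]
  have hzz : WithLp.ofLp (z - F.trendMap v) =
      (F.βperp (w (Sum.inl ())) *ᵥ w - F.βperp (w' (Sum.inl ())) *ᵥ w') + B *ᵥ ξ := by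
    rw [WithLp.ofLp_sub, F.ofLp_trendMap hdet hdet0, hz, hw]
    abel
  refine (h₀ _).trans ?_
  rw [hzz, mul_assoc C₀]
  refine mul_le_mul_of_nonneg_left ((norm_add_le _ _).trans ?_) hC₀.le
  have h5 := (h₁ w w').trans (mul_le_mul_of_nonneg_left hww hC₁.le)
  have h6 := h₃ ξ
  nlinarith [mul_nonneg hC₃.le (norm_nonneg R)]

/-- The map is the Lipschitz inverse of w ↦ core(w₁) w followed by the Lipschitz map w ↦ β_⊥(w₁) w.
-/
theorem exists_norm_trendMap_sub_le
    (hdet : SignType.sign (F.core 1).det = SignType.sign (F.core (-1)).det)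
    (hdet0 : (F.core 1).det ≠ 0) :
    ∃ C > 0, ∀ v v' : ZSpace m, ‖F.trendMap v - F.trendMap v'‖ ≤ C * ‖v - v'‖ := by
  obtain ⟨C₀, hC₀, h₀⟩ := EuclideanSpace.exists_norm_le_mul_norm_ofLp (ZIdx m)
  obtain ⟨C₁, hC₁, h₁⟩ := F.exists_norm_βperp_mulVec_sub_le
  obtain ⟨C₂, hC₂, h₂⟩ := F.exists_norm_sub_le_core hdet hdet0
  obtain ⟨C₃, hC₃, h₃⟩ := Matrix.exists_norm_mulVec_le F.αperpᵀ
  refine ⟨C₀ * (C₁ * (C₂ * C₃)), by positivity, fun v v' => (h₀ _).trans ?_⟩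
  rw [WithLp.ofLp_sub, F.ofLp_trendMap hdet hdet0, F.ofLp_trendMap hdet hdet0]
  simp only [mul_assoc]
  refine mul_le_mul_of_nonneg_left ((h₁ _ _).trans ?_) hC₀.le
  refine mul_le_mul_of_nonneg_left ((h₂ _ _).trans ?_) hC₁.le
  refine mul_le_mul_of_nonneg_left ?_ hC₂.le
  rw [F.core_mulVec_trendCoef hdet hdet0, F.core_mulVec_trendCoef hdet hdet0, ← Matrix.mulVec_sub,
    ← WithLp.ofLp_sub]
  exact (h₃ _).trans (mul_le_mul_of_nonneg_left (EuclideanSpace.norm_ofLp_le _) hC₃.le)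

theorem proj_yPart_trendMap
    (hdet : SignType.sign (F.core 1).det = SignType.sign (F.core (-1)).det)
    (hdet0 : (F.core 1).det ≠ 0) (v : ZSpace m) :
    F.proj (yPart (F.trendMap v)) = F.proj (F.vartheta ⬝ᵥ WithLp.ofLp v) := by
  rw [proj_eq_ite, F.proj_eq_ite (F.vartheta ⬝ᵥ WithLp.ofLp v)]
  simp only [← sign_nonneg_iff (a := yPart _), F.sign_yPart_trendMap hdet hdet0, sign_nonneg_iff]

end KinkedFactorisation

end CKSVAR

/-! ### Pathwise bounds -/

theorem norm_zStar_sub_le {m : ℕ} (z z' : ZSpace m) : ‖zStar z - zStar z'‖ ≤ ‖z - z'‖ := by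
  refine (pi_norm_le_iff_of_nonneg (norm_nonneg _)).2 fun i => ?_
  have hy : |yPart z - yPart z'| ≤ ‖z - z'‖ := PiLp.norm_apply_le (z - z') (Sum.inl ())
  rcases i with i | i | i
  · exact (abs_max_sub_max_le_abs _ _ _).trans hy
  · refine le_trans ?_ hy
    exact (abs_min_sub_min_le_max _ _ _ _).trans (by simp)
  · exact PiLp.norm_apply_le (z - z') (Sum.inr i)

theorem continuous_zStar {m : ℕ} : Continuous (zStar : ZSpace m → ZStarIdx m → ℝ) :=
  (LipschitzWith.of_dist_le_mul (K := 1) fun z z' => by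
    rw [dist_eq_norm, dist_eq_norm, NNReal.coe_one, one_mul]
    exact norm_zStar_sub_le z z').continuous

theorem zStar_smul {m : ℕ} {a : ℝ} (ha : 0 ≤ a) (z : ZSpace m) : zStar (a • z) = a • zStar z := by
  have hy : yPart (a • z) = a * yPart z := rfl
  ext i
  rcases i with i | i | i
  · simp [zStar, hy, mul_max_of_nonneg _ _ ha]
  · simp [zStar, hy, mul_min_of_nonneg _ _ ha]
  · simp [zStar]

/-- The coordinate y = y⁺ + y⁻ is recovered from two entries of z*, whence the factor 2. -/
theorem exists_norm_sub_le_zStar (m : ℕ) :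
    ∃ C > 0, ∀ z z' : ZSpace m, ‖z - z'‖ ≤ C * ‖zStar z - zStar z'‖ := by
  obtain ⟨C, hC, h⟩ := EuclideanSpace.exists_norm_le_mul_norm_ofLp (ZIdx m)
  refine ⟨C * 2, by positivity, fun z z' => (h _).trans ?_⟩
  rw [mul_assoc]
  refine mul_le_mul_of_nonneg_left ?_ hC.le
  refine (pi_norm_le_iff_of_nonneg (by positivity)).2 fun i => ?_
  rcases i with i | i
  · have h1 := norm_le_pi_norm (zStar z - zStar z') (Sum.inl ())
    have h2 := norm_le_pi_norm (zStar z - zStar z') (Sum.inr (Sum.inl ()))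
    have h3 : (z - z') (Sum.inl i) = (zStar z - zStar z') (Sum.inl ()) +
        (zStar z - zStar z') (Sum.inr (Sum.inl ())) := by
      have h4 := max_add_min (yPart z) 0
      have h5 := max_add_min (yPart z') 0
      have h6 : (z - z') (Sum.inl i) = yPart z - yPart z' := rfl
      simp only [zStar, Pi.sub_apply, Sum.elim_inl, Sum.elim_inr]
      linarith
    rw [h3]
    refine (norm_add_le _ _).trans ?_
    linarith
  · have h1 := norm_le_pi_norm (zStar z - zStar z') (Sum.inr (Sum.inr i))
    refine le_trans ?_ (h1.trans ?_)
    · exact le_rfl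
    · linarith [norm_nonneg (zStar z - zStar z')]

namespace CKSVAR

variable {m k : ℕ} {M : CKSVAR m k}

theorem IsCanonical.GammaOne_mulVec_smul (h : M.IsCanonical) {a : ℝ} (ha : 0 ≤ a) (z : ZSpace m) :
    M.GammaOne (yPart (a • z)) *ᵥ WithLp.ofLp (a • z) =
      a • M.GammaOne (yPart z) *ᵥ WithLp.ofLp z := by
  rw [h.GammaOne_mulVec, h.GammaOne_mulVec, zStar_smul ha, smul_sub, Finset.smul_sum]
  simp only [Matrix.mulVec_smul, WithLp.ofLp_smul]

theorem IsCanonical.exists_norm_GammaOne_mulVec_sub_le (h : M.IsCanonical) :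
    ∃ C > 0, ∀ z z' : ZSpace m, ‖M.GammaOne (yPart z) *ᵥ WithLp.ofLp z -
      M.GammaOne (yPart z') *ᵥ WithLp.ofLp z'‖ ≤ C * ‖z - z'‖ := by
  choose K hK0 hK using fun i => Matrix.exists_norm_mulVec_le (M.GammaStar (i + 1))
  have hpos : 0 ≤ ∑ i ∈ Finset.range (k - 1), K i := Finset.sum_nonneg fun i _ => (hK0 i).le
  refine ⟨1 + ∑ i ∈ Finset.range (k - 1), K i, by linarith, fun z z' => ?_⟩
  have h1 : M.GammaOne (yPart z) *ᵥ WithLp.ofLp z - M.GammaOne (yPart z') *ᵥ WithLp.ofLp z' =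
      WithLp.ofLp (z - z') -
        ∑ i ∈ Finset.range (k - 1), M.GammaStar (i + 1) *ᵥ (zStar z - zStar z') := by
    rw [h.GammaOne_mulVec, h.GammaOne_mulVec, WithLp.ofLp_sub]
    simp only [Matrix.mulVec_sub, Finset.sum_sub_distrib]
    abel
  rw [h1, add_mul, one_mul, Finset.sum_mul]
  refine (norm_sub_le _ _).trans (add_le_add (EuclideanSpace.norm_ofLp_le _) ?_)
  refine (norm_sum_le _ _).trans (Finset.sum_le_sum fun i _ => (hK i _).trans ?_)
  exact mul_le_mul_of_nonneg_left (norm_zStar_sub_le z z') (hK0 i).le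

namespace KinkedFactorisation

variable {r d : ℕ} (F : M.KinkedFactorisation r d)

theorem eqError_smul {a : ℝ} (ha : 0 ≤ a) (z : ZSpace m) :
    F.eqError (a • z) = a • F.eqError z := by
  apply (WithLp.ofLp_injective 2)
  rw [WithLp.ofLp_smul, eqError_eq, eqError_eq, zStar_smul ha, Matrix.mulVec_smul]

theorem continuous_eqError : Continuous F.eqError := by
  have h : F.eqError = fun z => WithLp.toLp 2 (F.βStar *ᵥ zStar z) := by
    funext z
    rw [← F.eqError_eq]
  rw [h]
  exact (PiLp.continuous_toLp 2 _).comp (continuous_const.matrix_mulVec continuous_zStar)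

/-- The size of the initial conditions of a path. -/
noncomputable def initialSize (z : ℤ → ZSpace m) : ℝ :=
  ‖F.eqError (z 0)‖ + ∑ j ∈ Finset.range (k - 1), ‖z (-(j : ℤ)) - z (-(j : ℤ) - 1)‖

theorem norm_state_zero_le (z : ℤ → ZSpace m) : ‖F.state z 0‖ ≤ F.initialSize z := by
  have h0 : 0 ≤ ∑ j ∈ Finset.range (k - 1), ‖z (-(j : ℤ)) - z (-(j : ℤ) - 1)‖ :=
    Finset.sum_nonneg fun j _ => norm_nonneg _
  refine (pi_norm_le_iff_of_nonneg (add_nonneg (norm_nonneg _) h0)).2 fun i => ?_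
  rcases i with i | ⟨j, s⟩
  · exact (PiLp.norm_apply_le (F.eqError (z 0)) i).trans (le_add_of_nonneg_right h0)
  · have h1 := (norm_le_pi_norm (zStar (z (-(j : ℤ))) - zStar (z (-(j : ℤ) - 1))) s).trans
      (norm_zStar_sub_le _ _)
    have h2 := Finset.single_le_sum (f := fun j : ℕ => ‖z (-(j : ℤ)) - z (-(j : ℤ) - 1)‖)
      (fun j _ => norm_nonneg _) (Finset.mem_range.2 j.2)
    have h3 : F.state z 0 (Sum.inr (j, s)) =
        (zStar (z (-(j : ℤ))) - zStar (z (-(j : ℤ) - 1))) s := by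
      simp [state]
    rw [h3]
    exact h1.trans (h2.trans (le_add_of_nonneg_left (norm_nonneg _)))

theorem exists_norm_le_state (hk : 2 ≤ k) : ∃ C > 0, ∀ (z : ℤ → ZSpace m) (t : ℤ),
    ‖F.eqError (z t)‖ ≤ C * ‖F.state z t‖ ∧ ‖z t - z (t - 1)‖ ≤ C * ‖F.state z t‖ := by
  obtain ⟨C₁, hC₁, h₁⟩ := EuclideanSpace.exists_norm_le_mul_norm_ofLp (Fin r)
  obtain ⟨C₂, hC₂, h₂⟩ := exists_norm_sub_le_zStar m
  refine ⟨max C₁ C₂, lt_max_of_lt_left hC₁, fun z t => ⟨(h₁ _).trans ?_, (h₂ _ _).trans ?_⟩⟩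
  · refine mul_le_mul (le_max_left _ _) ?_ (norm_nonneg _) (hC₁.le.trans (le_max_left _ _))
    exact (pi_norm_le_iff_of_nonneg (norm_nonneg _)).2 fun i =>
      norm_le_pi_norm (F.state z t) (Sum.inl i)
  · refine mul_le_mul (le_max_right _ _) ?_ (norm_nonneg _) (hC₁.le.trans (le_max_left _ _))
    refine (pi_norm_le_iff_of_nonneg (norm_nonneg _)).2 fun s => ?_
    -- The newest increment is in slot 0, which exists because k ≥ 2.
    have h3 := norm_le_pi_norm (F.state z t) (Sum.inr (⟨0, by omega⟩, s))
    simpa [state] using h3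

/-- The pathwise bounds behind the theorem: the equilibrium errors and the increments are bounded
by the largest error, and the scaled path is close to the image of the scaled partial sums. -/
theorem exists_pathwise_bound (hk : 2 ≤ k) (h : M.IsCanonical) (hc : ∃ v, M.Pi 1 *ᵥ v = M.c)
    (hjsr : jointSpectralRadius {1 + F.boldβT 1 * F.boldα, 1 + F.boldβT (-1) * F.boldα} < 1)
    (hdet : SignType.sign (F.core 1).det = SignType.sign (F.core (-1)).det)
    (hdet0 : (F.core 1).det ≠ 0) (Z₀ : ZSpace m) :
    ∃ C > 0, ∀ (u : ℕ → ZSpace m) (z : ℤ → ZSpace m), M.Generates u z → ∀ (n : ℕ) (L : ℝ),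
      0 ≤ L → (∀ j ∈ Finset.Icc 1 n, ‖u j‖ ≤ L) → ∀ t : ℕ, t ≤ n →
        ‖F.eqError (z t)‖ ≤ C * (F.initialSize z + 1 + L) ∧
        ‖z t - z (t - 1)‖ ≤ C * (F.initialSize z + 1 + L) ∧
        ∀ a : ℝ, 0 ≤ a →
          ‖a • z t - F.trendMap (act (M.GammaOne (yPart Z₀)) Z₀ + a • ∑ s ∈ Finset.Icc 1 t, u s)‖ ≤
            C * (a * (F.initialSize z + 1 + L) + ‖a • z 0 - Z₀‖) := by
  obtain ⟨C₁, hC₁, h₁⟩ := F.exists_norm_state_le h hjsr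
  obtain ⟨C₂, hC₂, h₂⟩ := F.exists_norm_le_state hk
  obtain ⟨C₃, hC₃, h₃⟩ := F.exists_norm_sub_trendMap_le hdet hdet0
  obtain ⟨C₄, hC₄, h₄⟩ := F.exists_commonTrend_remainder_le h hc
  obtain ⟨C₅, hC₅, h₅⟩ := h.exists_norm_GammaOne_mulVec_sub_le
  obtain ⟨C₆, hC₆, h₆⟩ := Matrix.exists_norm_mulVec_le F.αperpᵀ
  refine ⟨C₂ * C₁ + C₃ * (C₂ * C₁ + C₄ * (C₁ + 1) + C₆ * C₅), by positivity,
    fun u z hz n L hL hu t ht => ?_⟩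
  set Q := F.initialSize z with hQ
  have hs0 : ‖F.state z 0‖ ≤ Q := F.norm_state_zero_le z
  have hQ0 : 0 ≤ Q := (norm_nonneg _).trans hs0
  have hQL : 0 ≤ Q + 1 + L := by positivity
  have hst : ‖F.state z t‖ ≤ C₁ * (Q + 1 + L) :=
    (h₁ u z hz n L hL hu t ht).trans (mul_le_mul_of_nonneg_left (by linarith) hC₁.le)
  have hC : C₂ * C₁ * (Q + 1 + L) ≤
      (C₂ * C₁ + C₃ * (C₂ * C₁ + C₄ * (C₁ + 1) + C₆ * C₅)) * (Q + 1 + L) :=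
    mul_le_mul_of_nonneg_right (le_add_of_nonneg_right (by positivity)) hQL
  have hC₂₁ : C₂ * ‖F.state z t‖ ≤ C₂ * C₁ * (Q + 1 + L) := by
    rw [mul_assoc]; exact mul_le_mul_of_nonneg_left hst hC₂.le
  refine ⟨(h₂ z t).1.trans (hC₂₁.trans hC), (h₂ z t).2.trans (hC₂₁.trans hC), fun a ha => ?_⟩
  set v : ZSpace m := act (M.GammaOne (yPart Z₀)) Z₀ + a • ∑ s ∈ Finset.Icc 1 t, u s with hv
  set D := ‖a • z 0 - Z₀‖
  have hD : 0 ≤ D := norm_nonneg _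
  have hξ : ‖WithLp.ofLp (F.eqError (a • z t))‖ ≤ a * (C₂ * C₁ * (Q + 1 + L)) := by
    refine (EuclideanSpace.norm_ofLp_le _).trans ?_
    rw [F.eqError_smul ha, norm_smul, Real.norm_eq_abs, abs_of_nonneg ha]
    exact mul_le_mul_of_nonneg_left ((h₂ z t).1.trans hC₂₁) ha
  have hR : ‖F.αperpᵀ *ᵥ (M.GammaOne (yPart (a • z t)) *ᵥ WithLp.ofLp (a • z t) - WithLp.ofLp v)‖ ≤
      a * (C₄ * (C₁ + 1) * (Q + 1 + L)) + C₆ * C₅ * D := by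
    -- Positive homogeneity separates the scaled common trend remainder from the error of replacing
    -- the scaled initial value by its limit `Z₀`.
    have h7 : M.GammaOne (yPart (a • z t)) *ᵥ WithLp.ofLp (a • z t) - WithLp.ofLp v =
        a • (M.GammaOne (yPart (z t)) *ᵥ WithLp.ofLp (z t) -
          (M.GammaOne (yPart (z 0)) *ᵥ WithLp.ofLp (z 0) +
            WithLp.ofLp (∑ s ∈ Finset.Icc 1 t, u s))) +
        (M.GammaOne (yPart (a • z 0)) *ᵥ WithLp.ofLp (a • z 0) -
          M.GammaOne (yPart Z₀) *ᵥ WithLp.ofLp Z₀) := by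
      rw [h.GammaOne_mulVec_smul ha, h.GammaOne_mulVec_smul ha, hv, WithLp.ofLp_add,
        WithLp.ofLp_smul, act]
      module
    rw [h7, Matrix.mulVec_add, Matrix.mulVec_smul]
    refine (norm_add_le _ _).trans (add_le_add ?_ ?_)
    · rw [norm_smul, Real.norm_eq_abs, abs_of_nonneg ha]
      refine mul_le_mul_of_nonneg_left ((h₄ u z hz t).trans ?_) ha
      rw [mul_assoc]
      refine mul_le_mul_of_nonneg_left ?_ hC₄.le
      linarith
    · refine (h₆ _).trans ?_
      rw [mul_assoc]
      exact mul_le_mul_of_nonneg_left (h₅ _ _) hC₆.le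
  refine (h₃ _ _).trans ((mul_le_mul_of_nonneg_left (add_le_add hξ hR) hC₃.le).trans ?_)
  -- These are the nonnegative cross terms needed to collect the bounds under a single constant.
  have e1 : 0 ≤ C₂ * C₁ * (a * (Q + 1 + L) + D) := by positivity
  have e2 : 0 ≤ C₃ * (C₂ * C₁ + C₄ * (C₁ + 1)) * D := by positivity
  have e3 : 0 ≤ C₃ * (C₆ * C₅) * (a * (Q + 1 + L)) := by positivity
  linarith

end KinkedFactorisation

end CKSVAR

/-! ### Convergence in distribution on `D[0,1]` -/

namespace CadlagPath

variable {E F : Type*} [PseudoEMetricSpace E] [PseudoEMetricSpace F]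

theorem edist_le {f g : CadlagPath E} {C : ℝ≥0∞} : edist f g ≤ C ↔ ∀ s, edist (f s) (g s) ≤ C :=
  UniformFun.edist_le

/-- Composition of a cadlag path with a continuous map. -/
def map (G : E → F) (hG : Continuous G) (f : CadlagPath E) : CadlagPath F :=
  ⟨UniformFun.ofFun fun s => G (f s), fun t => by
    obtain ⟨h1, l, h2⟩ := f.2 t
    exact ⟨hG.continuousAt.comp_continuousWithinAt h1, G l, (hG.tendsto l).comp h2⟩⟩

theorem map_apply (G : E → F) (hG : Continuous G) (f : CadlagPath E) (s : I) :
    map G hG f s = G (f s) := rfl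

theorem lipschitzWith_map {K : ℝ≥0} {G : E → F} (hG : LipschitzWith K G) :
    LipschitzWith K (map G hG.continuous) := by
  intro f g
  refine edist_le.2 fun s => (hG _ _).trans ?_
  gcongr
  exact edist_le.1 le_rfl s

end CadlagPath

theorem floor_mul_le (n : ℕ) (s : I) : ⌊(n : ℝ) * (s : ℝ)⌋₊ ≤ n := by
  refine Nat.floor_le_of_le ?_
  exact mul_le_of_le_one_right (Nat.cast_nonneg n) s.2.2

theorem edist_stepPath_le {E : Type*} [PseudoEMetricSpace E] {n : ℕ} {f g : ℕ → E} {C : ℝ≥0∞}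
    (h : ∀ j ≤ n, edist (f j) (g j) ≤ C) : edist (stepPath n f) (stepPath n g) ≤ C :=
  CadlagPath.edist_le.2 fun s => h _ (floor_mul_le n s)

/-- In the uniform topology measurability of the coordinates is not enough; a step path, however, is
a 1-Lipschitz function of its n + 1 values. The reduction modulo n + 1 in `Fin.ofNat` is harmless
since ⌊n s⌋ ≤ n. -/
theorem aemeasurable_stepPath {E Ω : Type*} [PseudoEMetricSpace E] [SecondCountableTopology E]
    [MeasurableSpace E] [BorelSpace E] [MeasurableSpace Ω] {P : Measure Ω} {n : ℕ}
    {f : ℕ → Ω → E} (hf : ∀ j ≤ n, AEMeasurable (f j) P) :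
    AEMeasurable (fun ω => stepPath n fun j => f j ω) P := by
  let φ : (Fin (n + 1) → E) → CadlagPath E := fun x => stepPath n fun j => x (Fin.ofNat (n + 1) j)
  have hφ : Continuous φ := by
    refine LipschitzWith.continuous (K := 1) fun x y => ?_
    rw [ENNReal.coe_one, one_mul]
    exact edist_stepPath_le fun j _ => edist_le_pi_edist x y _
  have heq : (fun ω => stepPath n fun j => f j ω) = φ ∘ fun ω (i : Fin (n + 1)) => f i ω := by
    funext ω
    refine Subtype.ext (funext fun s => ?_)
    change f _ ω = f (Fin.ofNat (n + 1) _ : Fin (n + 1)) ω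
    rw [Fin.val_ofNat, Nat.mod_eq_of_lt (Nat.lt_succ_of_le (floor_mul_le n s))]
  rw [heq]
  exact hφ.measurable.comp_aemeasurable
    (aemeasurable_pi_lambda _ fun i => hf i (Nat.le_of_lt_succ i.2))

/-- Sequences at a distance that vanishes in probability have the same limit in distribution. -/
theorem MeasureTheory.TendstoInDistribution.of_edist {E Ω Ω' : Type*} [PseudoEMetricSpace E]
    [MeasurableSpace E] [BorelSpace E] [MeasurableSpace Ω] [MeasurableSpace Ω'] {P : Measure Ω}
    [IsProbabilityMeasure P] {P' : Measure Ω'} [IsProbabilityMeasure P'] {X Y : ℕ → Ω → E}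
    {Z : Ω' → E} (hX : TendstoInDistribution X atTop Z (fun _ => P) P')
    (hY : ∀ n, AEMeasurable (Y n) P)
    (h : ∀ ε : ℝ, 0 < ε →
      Tendsto (fun n => P {ω | ENNReal.ofReal ε < edist (X n ω) (Y n ω)}) atTop (𝓝 0)) :
    TendstoInDistribution Y atTop Z (fun _ => P) P' where
  forall_aemeasurable := hY
  aemeasurable_limit := hX.aemeasurable_limit
  tendsto := by
    -- Portmanteau: if `Y n` is in F at distance at most ε from `X n`, then `X n` is in the closed
    -- ε-thickening of F, and ε tends to zero. The event of a large distance enters only through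
    -- monotonicity and subadditivity, so it need not be measurable.
    refine tendsto_of_forall_isClosed_limsup_le' fun F hF => ?_
    have hstep (ε : ℝ) (hε : 0 < ε) : limsup (fun n => (P.map (Y n)) F) atTop ≤
        (P'.map Z) (Metric.cthickening ε F) := by
      have h1 (n : ℕ) : (P.map (Y n)) F ≤ (P.map (X n)) (Metric.cthickening ε F) +
          P {ω | ENNReal.ofReal ε < edist (X n ω) (Y n ω)} := by
        rw [Measure.map_apply_of_aemeasurable (hY n) hF.measurableSet,
          Measure.map_apply_of_aemeasurable (hX.forall_aemeasurable n)
            Metric.isClosed_cthickening.measurableSet]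
        refine (measure_mono fun ω hω => ?_).trans (measure_union_le _ _)
        by_cases hd : ENNReal.ofReal ε < edist (X n ω) (Y n ω)
        · exact Or.inr hd
        · left
          exact Metric.mem_cthickening_of_edist_le _ _ _ _ hω (not_lt.1 hd)
      have h2 := ProbabilityMeasure.limsup_measure_closed_le_of_tendsto hX.tendsto
        (Metric.isClosed_cthickening (δ := ε) (E := F))
      refine (limsup_le_limsup (Eventually.of_forall h1)).trans ?_
      exact (ENNReal.limsup_add_of_right_tendsto_zero (h ε hε) _).trans_le h2
    have hlim : Tendsto (fun ε => (P'.map Z) (Metric.cthickening ε F)) (𝓝[>] 0)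
        (𝓝 ((P'.map Z) F)) :=
      (tendsto_measure_cthickening_of_isClosed
        ⟨1, one_pos, measure_ne_top _ _⟩ hF).mono_left nhdsWithin_le_nhds
    exact ge_of_tendsto hlim (eventually_nhdsWithin_of_forall fun ε hε => hstep ε hε)

/-! ### Maxima of sequences with bounded moments -/

section Moments

variable {Ω E : Type*} [MeasurableSpace Ω] [NormedAddCommGroup E] {P : Measure Ω}

theorem measure_norm_ge_le_of_eLpNorm_le {f : Ω → E} {p : ℝ} (hp : 0 < p) {C : ℝ≥0}
    (hf : AEStronglyMeasurable f P) (hC : eLpNorm f (ENNReal.ofReal p) P ≤ C) {x : ℝ}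
    (hx : 0 < x) : P {ω | x ≤ ‖f ω‖} ≤ ENNReal.ofReal ((C / x) ^ p) := by
  have h1 := meas_ge_le_mul_pow_eLpNorm_enorm P (p := ENNReal.ofReal p) (by simpa using hp)
    ENNReal.ofReal_ne_top hf (ε := ENNReal.ofReal x) (by simpa using hx)
    (fun h => absurd h ENNReal.ofReal_ne_top)
  have h2 : {ω | x ≤ ‖f ω‖} = {ω | ENNReal.ofReal x ≤ ‖f ω‖ₑ} := by
    ext ω
    simp only [Set.mem_ofPred_eq]
    rw [← ofReal_norm, ENNReal.ofReal_le_ofReal_iff (norm_nonneg _)]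
  rw [h2]
  refine h1.trans ?_
  rw [ENNReal.toReal_ofReal hp.le, ← ENNReal.mul_rpow_of_nonneg _ _ hp.le,
    ← ENNReal.ofReal_rpow_of_nonneg (by positivity) hp.le]
  refine ENNReal.rpow_le_rpow ?_ hp.le
  rw [div_eq_inv_mul, ENNReal.ofReal_mul (by positivity), ENNReal.ofReal_inv_of_pos hx,
    ENNReal.ofReal_coe_nnreal]
  gcongr

/-- The power of n is 1 - (2 + δ)/2 = -δ/2. -/
theorem tendsto_natCast_mul_rpow_zero (c : ℝ) (hc : 0 ≤ c) {δ : ℝ} (hδ : 0 < δ) :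
    Tendsto (fun n : ℕ => (n : ℝ) * (c / √n) ^ (2 + δ)) atTop (𝓝 0) := by
  have h1 : Tendsto (fun n : ℕ => c ^ (2 + δ) * (n : ℝ) ^ (-(δ / 2))) atTop (𝓝 0) := by
    have := ((tendsto_rpow_neg_atTop (y := δ / 2) (by positivity)).comp
      tendsto_natCast_atTop_atTop).const_mul (c ^ (2 + δ))
    simpa using this
  refine h1.congr' ?_
  filter_upwards [eventually_gt_atTop 0] with n hn
  have hn' : (0 : ℝ) < n := by exact_mod_cast hn
  rw [Real.div_rpow hc (Real.sqrt_nonneg _), Real.sqrt_eq_rpow, ← Real.rpow_mul hn'.le,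
    div_eq_mul_inv (c ^ (2 + δ)), ← Real.rpow_neg hn'.le, mul_left_comm, ← Real.rpow_one_add' hn'.le]
  · congr 2; ring
  · have : 1 + -(1 / 2 * (2 + δ)) = -(δ / 2) := by ring
    rw [this]; exact (neg_neg_of_pos (by positivity)).ne

/-- An array with bounded moments of order above two has maxima of smaller order than the square
root of the sample size. -/
theorem isStarStationary_of_eLpNorm_le {w : ℕ → ℕ → Ω → E} {δ : ℝ} (hδ : 0 < δ) {C : ℝ≥0}
    (hw : ∀ n, ∀ t, 1 ≤ t → AEStronglyMeasurable (w n t) P)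
    (hC : ∀ n, ∀ t, 1 ≤ t → eLpNorm (w n t) (ENNReal.ofReal (2 + δ)) P ≤ C) :
    IsStarStationary P w := by
  rw [IsStarStationary, tendstoInMeasure_iff_norm]
  intro ε hε
  have h0 : Tendsto (fun n : ℕ => ENNReal.ofReal ((n : ℝ) * ((C / ε) / √n) ^ (2 + δ))) atTop
      (𝓝 0) := by
    have := ENNReal.tendsto_ofReal (tendsto_natCast_mul_rpow_zero (C / ε) (by positivity) hδ)
    simpa using this
  refine tendsto_of_tendsto_of_tendsto_of_le_of_le' tendsto_const_nhds h0
    (Eventually.of_forall fun n => zero_le) ?_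
  filter_upwards [eventually_gt_atTop 0] with n hn
  have hn' : (0 : ℝ) < n := by exact_mod_cast hn
  have hs : 0 < √(n : ℝ) := Real.sqrt_pos.2 hn'
  -- A union bound over n terms, to each of which Markov's inequality of order 2 + δ applies.
  have hsub : {ω | ε ≤ ‖(√(n : ℝ))⁻¹ * NNReal.toReal ((Finset.Icc 1 n).sup fun t => ‖w n t ω‖₊) -
      0‖} ⊆ ⋃ t ∈ Finset.Icc 1 n, {ω | ε * √n ≤ ‖w n t ω‖} := by
    intro ω hω
    simp only [Set.mem_ofPred_eq, sub_zero] at hω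
    rw [Real.norm_of_nonneg (by positivity), le_inv_mul_iff₀ hs] at hω
    obtain ⟨t, ht, hmax⟩ := Finset.exists_mem_eq_sup (Finset.Icc 1 n) ⟨1, by simp; omega⟩
      fun t => ‖w n t ω‖₊
    rw [hmax] at hω
    refine Set.mem_biUnion ht ?_
    change ε * √n ≤ ‖w n t ω‖
    rw [mul_comm]; exact hω
  refine (measure_mono hsub).trans ((measure_biUnion_finset_le _ _).trans ?_)
  have hterm : ∀ t ∈ Finset.Icc 1 n, P {ω | ε * √n ≤ ‖w n t ω‖} ≤
      ENNReal.ofReal (((C / ε) / √n) ^ (2 + δ)) := by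
    intro t ht
    have h1 := (Finset.mem_Icc.1 ht).1
    have := measure_norm_ge_le_of_eLpNorm_le (by positivity) (hw n t h1) (hC n t h1)
      (mul_pos hε hs)
    rwa [← div_div] at this
  refine (Finset.sum_le_sum hterm).trans ?_
  rw [Finset.sum_const, Nat.card_Icc, Nat.add_sub_cancel, nsmul_eq_mul,
    ENNReal.ofReal_mul hn'.le, ENNReal.ofReal_natCast]

end Moments

/-! ### Sequences that vanish in probability -/

section Vanish

variable {Ω E : Type*} [MeasurableSpace Ω] [NormedAddCommGroup E] {P : Measure Ω}

theorem tendstoInMeasure_zero_of_le {f g : ℕ → Ω → ℝ} {C : ℝ} (hC : 0 < C)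
    (hf : TendstoInMeasure P f atTop fun _ => 0) (h : ∀ n, ∀ᵐ ω ∂P, |g n ω| ≤ C * |f n ω|) :
    TendstoInMeasure P g atTop fun _ => 0 := by
  rw [tendstoInMeasure_iff_norm] at hf ⊢
  intro ε hε
  refine tendsto_of_tendsto_of_tendsto_of_le_of_le tendsto_const_nhds (hf (ε / C) (by positivity))
    (fun n => zero_le) fun n => measure_mono_ae ?_
  filter_upwards [h n] with ω hω hmem
  have h1 : ε ≤ ‖g n ω - 0‖ := hmem
  rw [sub_zero, Real.norm_eq_abs] at h1
  change ε / C ≤ ‖f n ω - 0‖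
  rw [sub_zero, Real.norm_eq_abs, div_le_iff₀' hC]
  exact h1.trans hω

theorem tendstoInMeasure_zero_add {f g : ℕ → Ω → ℝ}
    (hf : TendstoInMeasure P f atTop fun _ => 0) (hg : TendstoInMeasure P g atTop fun _ => 0) :
    TendstoInMeasure P (fun n ω => f n ω + g n ω) atTop fun _ => 0 := by
  rw [tendstoInMeasure_iff_norm] at hf hg ⊢
  intro ε hε
  have h0 := (hf (ε / 2) (by positivity)).add (hg (ε / 2) (by positivity))
  rw [add_zero] at h0
  refine tendsto_of_tendsto_of_tendsto_of_le_of_le tendsto_const_nhds h0 (fun n => zero_le)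
    fun n => (measure_mono fun ω hω => ?_).trans (measure_union_le _ _)
  by_contra hcon
  simp only [sub_zero, Set.mem_union, Set.mem_ofPred_eq, not_or, not_le] at hcon hω
  have := norm_add_le (f n ω) (g n ω)
  linarith

theorem tendstoInMeasure_zero_sum {ι : Type*} (s : Finset ι) {f : ι → ℕ → Ω → ℝ}
    (hf : ∀ i ∈ s, TendstoInMeasure P (f i) atTop fun _ => 0) :
    TendstoInMeasure P (fun n ω => ∑ i ∈ s, f i n ω) atTop fun _ => 0 := by
  classical
  induction s using Finset.induction_on with
  | empty =>
    rw [tendstoInMeasure_iff_norm]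
    intro ε hε
    simp [not_le.2 hε]
  | insert i s hi ih =>
    simp only [Finset.sum_insert hi]
    exact tendstoInMeasure_zero_add (hf i (Finset.mem_insert_self i s))
      (ih fun j hj => hf j (Finset.mem_insert_of_mem hj))

theorem tendstoInMeasure_inv_sqrt : TendstoInMeasure P (fun (n : ℕ) (_ : Ω) => (√(n : ℝ))⁻¹) atTop
    fun _ => 0 := by
  rw [tendstoInMeasure_iff_norm]
  intro ε hε
  have h1 : Tendsto (fun n : ℕ => (√(n : ℝ))⁻¹) atTop (𝓝 0) :=
    tendsto_inv_atTop_zero.comp (Real.tendsto_sqrt_atTop.comp tendsto_natCast_atTop_atTop)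
  refine tendsto_const_nhds.congr' ?_
  filter_upwards [h1.eventually_lt_const hε] with n hn
  have : ¬ ε ≤ ‖(√(n : ℝ))⁻¹ - 0‖ := by
    rw [sub_zero, Real.norm_of_nonneg (by positivity)]; exact not_le.2 hn
  simp only [this]
  simp

theorem tendstoInMeasure_inv_sqrt_mul_norm {f : ℕ → Ω → E} {δ : ℝ} (hδ : 0 < δ) {C : ℝ≥0}
    (hf : ∀ n, AEStronglyMeasurable (f n) P)
    (hC : ∀ n, eLpNorm (f n) (ENNReal.ofReal (2 + δ)) P ≤ C) :
    TendstoInMeasure P (fun (n : ℕ) ω => (√(n : ℝ))⁻¹ * ‖f n ω‖) atTop fun _ => 0 := by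
  -- A single variable is an array constant in t, equal to its own maximum. For n = 0 the factor
  -- (√0)⁻¹ is 0.
  refine tendstoInMeasure_zero_of_le one_pos
    (isStarStationary_of_eLpNorm_le (w := fun n _ => f n) hδ (fun n _ _ => hf n) fun n _ _ => hC n)
    fun n => Eventually.of_forall fun ω => ?_
  rcases Nat.eq_zero_or_pos n with rfl | hn
  · simp
  · rw [Finset.sup_const ⟨1, by simp; omega⟩]
    simp

theorem toReal_sup_nnnorm_le {s : Finset ℕ} {f : ℕ → E} {x : ℝ} (hx : 0 ≤ x)
    (h : ∀ t ∈ s, ‖f t‖ ≤ x) : NNReal.toReal (s.sup fun t => ‖f t‖₊) ≤ x := by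
  lift x to ℝ≥0 using hx
  exact NNReal.coe_le_coe.2 (Finset.sup_le h)

theorem norm_le_toReal_sup_nnnorm {s : Finset ℕ} {f : ℕ → E} {t : ℕ} (ht : t ∈ s) :
    ‖f t‖ ≤ NNReal.toReal (s.sup fun t => ‖f t‖₊) :=
  NNReal.coe_le_coe.2 (Finset.le_sup (f := fun t => ‖f t‖₊) ht)

end Vanish

/-! ### Measurability of the generated process. -/

namespace CKSVAR

variable {m k : ℕ} {M : CKSVAR m k}

/-- In canonical form the left-hand side of the model is z_t itself, so z_t is a continuous function
of the k preceding values and the error. -/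
theorem aemeasurable_of_generates {Ω : Type*} [MeasurableSpace Ω] {P : Measure Ω}
    (hcanon : M.IsCanonical) {u : ℕ → Ω → ZSpace m} {z : ℤ → Ω → ZSpace m}
    (hu : ∀ t, 1 ≤ t → AEMeasurable (u t) P)
    (hz : ∀ t : ℤ, -(k : ℤ) + 1 ≤ t → t ≤ 0 → AEMeasurable (z t) P)
    (hgen : ∀ᵐ ω ∂P, M.Generates (fun t => u t ω) (fun t => z t ω)) (t : ℕ) :
    ∀ s : ℤ, -(k : ℤ) + 1 ≤ s → s ≤ t → AEMeasurable (z s) P := by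
  induction t with
  | zero => exact fun s hs hs' => hz s hs (by simpa using hs')
  | succ t ih =>
    intro s hs hs'
    rcases lt_or_eq_of_le hs' with hlt | rfl
    · exact ih s hs (by push_cast at hlt; omega)
    have hrhs : AEMeasurable (fun ω => WithLp.toLp 2 (M.c +
        ∑ i ∈ Finset.Icc 1 k, M.PhiStar i *ᵥ zStar (z (((t + 1 : ℕ) : ℤ) - (i : ℤ)) ω) +
          WithLp.ofLp (u (t + 1) ω)) : Ω → ZSpace m) P := by
      refine (PiLp.continuous_toLp 2 _).measurable.comp_aemeasurable ?_
      refine AEMeasurable.add (AEMeasurable.const_add ?_ _)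
        ((PiLp.continuous_ofLp 2 _).measurable.comp_aemeasurable (hu (t + 1) (by omega)))
      refine Finset.aemeasurable_fun_sum _ fun i hi => ?_
      have hi' := Finset.mem_Icc.1 hi
      exact (continuous_const.matrix_mulVec continuous_zStar).measurable.comp_aemeasurable
        (ih _ (by push_cast; omega) (by push_cast; omega))
    refine hrhs.congr ?_
    filter_upwards [hgen] with ω hω
    apply WithLp.ofLp_injective 2
    rw [← hcanon.mulVec_zStar (z _ ω)]
    exact (hω (t + 1) (by omega)).symm

end CKSVAR

/-! ### The limit theorem. -/

theorem theorem2 {m k r d : ℕ} (hk : 2 ≤ k)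
    {Ω Ω' : Type*} [MeasurableSpace Ω] [MeasurableSpace Ω']
    (P : Measure Ω) [IsProbabilityMeasure P] (P' : Measure Ω') [IsProbabilityMeasure P']
    -- the data are generated by a canonical CKSVAR; for each sample size `n`, `z n` is the process
    (M : CKSVAR m k) (hcanon : M.IsCanonical)
    (u : ℕ → Ω → ZSpace m) (z : ℕ → ℤ → Ω → ZSpace m)
    (hu : ∀ t, 1 ≤ t → AEMeasurable (u t) P)
    (hz : ∀ n, ∀ t : ℤ, -(k : ℤ) + 1 ≤ t → t ≤ 0 → AEMeasurable (z n t) P)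
    (hgen : ∀ n, ∀ᵐ ω ∂P, M.Generates (fun t => u t ω) (fun t => z n t ω))
    -- the errors: moments and invariance principle
    (δ : ℝ) (hδ : 0 < δ)
    (humom : ∃ C : ℝ≥0, ∀ t, 1 ≤ t → eLpNorm (u t) (ENNReal.ofReal (2 + δ)) P ≤ C)
    (V : Matrix (ZIdx m) (ZIdx m) ℝ) (hV : V.PosDef)
    (U : Ω' → CadlagPath (ZSpace m)) (hU : IsBrownianMotion (fun s ω => U ω s) V P')
    (hUn : TendstoInDistribution
      (fun (n : ℕ) ω => stepPath n fun j => (√(n : ℝ))⁻¹ • ∑ t ∈ Finset.Icc 1 j, u t ω)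
      atTop U (fun _ => P) P')
    -- unit roots and ranks
    (qpos qneg : ℕ) (hrootpos : M.UnitRoots 1 qpos) (hrootneg : M.UnitRoots (-1) qneg)
    (hqpos : (M.Pi 1).rank + qpos = m + 1) (hqneg : (M.Pi (-1)).rank + qneg = m + 1)
    (hcpos : ∃ v, M.Pi 1 *ᵥ v = M.c) (hcneg : ∃ v, M.Pi (-1) *ᵥ v = M.c)
    (hrpos : (M.Pi 1).rank = r) (hrneg : (M.Pi (-1)).rank = r) (hrx : M.PiX.rank = r)
    -- any choice of the factorisation and of the orthocomplements
    (F : M.KinkedFactorisation r d)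
    (hjsr : jointSpectralRadius {1 + F.boldβT 1 * F.boldα, 1 + F.boldβT (-1) * F.boldα} < 1)
    (hdet : SignType.sign (F.core 1).det = SignType.sign (F.core (-1)).det)
    (hdet0 : (F.core 1).det ≠ 0)
    -- initial conditions
    (hinit : ∃ C : ℝ≥0, ∀ n,
      (∀ t : ℤ, -(k : ℤ) + 1 ≤ t → t ≤ 0 →
        eLpNorm (fun ω => F.eqError (z n t ω)) (ENNReal.ofReal (2 + δ)) P ≤ C) ∧
      (∀ t : ℤ, -(k : ℤ) + 2 ≤ t → t ≤ 0 →
        eLpNorm (fun ω => z n t ω - z n (t - 1) ω) (ENNReal.ofReal (2 + δ)) P ≤ C))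
    (Z₀ : ZSpace m) (hZ₀ : Z₀ ∈ M.commonTrends)
    (hinit₀ : TendstoInMeasure P (fun (n : ℕ) ω => (√(n : ℝ))⁻¹ • z n 0 ω) atTop (fun _ => Z₀))
    -- the limiting driving process
    (U₀ : Ω' → I → ZSpace m) (hU₀ : ∀ ω s, U₀ ω s = act (M.GammaOne (yPart Z₀)) Z₀ + U ω s) :
    IsStarStationary P (fun n t ω => F.eqError (z n t ω)) ∧
    IsStarStationary P (fun n t ω => z n t ω - z n ((t : ℤ) - 1) ω) ∧
    ∃ Z : Ω' → CadlagPath (ZSpace m),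
      TendstoInDistribution (fun (n : ℕ) ω => stepPath n fun j => (√(n : ℝ))⁻¹ • z n j ω)
        atTop Z (fun _ => P) P' ∧
      ∀ ω s,
        Z ω s = act (F.proj (yPart (Z ω s))) (U₀ ω s) ∧
        Z ω s = act (F.proj (F.vartheta ⬝ᵥ WithLp.ofLp (U₀ ω s))) (U₀ ω s) ∧
        SignType.sign (yPart (Z ω s)) =
          SignType.sign (F.vartheta ⬝ᵥ WithLp.ofLp (U₀ ω s)) := by
  obtain ⟨C, hC, hpath⟩ := F.exists_pathwise_bound hk hcanon hcpos hjsr hdet hdet0 Z₀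
  obtain ⟨Cu, hCu⟩ := humom
  obtain ⟨Ci, hCi⟩ := hinit
  have hzm (n : ℕ) (t : ℕ) := M.aemeasurable_of_generates hcanon hu (hz n) (hgen n) t
  -- the largest error and the remainder, scaled by the square root of the sample size
  let L : ℕ → Ω → ℝ := fun n ω => NNReal.toReal ((Finset.Icc 1 n).sup fun t => ‖u t ω‖₊)
  have hL0 (n ω) : 0 ≤ L n ω := NNReal.coe_nonneg _
  let R : ℕ → Ω → ℝ := fun n ω =>
    (√(n : ℝ))⁻¹ * (F.initialSize (fun t => z n t ω) + 1 + L n ω)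
  have hI0 (n ω) : 0 ≤ F.initialSize (fun t => z n t ω) :=
    (norm_nonneg _).trans (F.norm_state_zero_le _)
  have hQ0 (n ω) : 0 ≤ F.initialSize (fun t => z n t ω) + 1 + L n ω := by
    linarith [hI0 n ω, hL0 n ω]
  have hR0 (n ω) : 0 ≤ R n ω := mul_nonneg (by positivity) (hQ0 n ω)
  -- Each of the finitely many initial terms, the constant 1 and the largest error is negligible
  -- after division by √n.
  have hR : TendstoInMeasure P R atTop fun _ => 0 := by
    have h1 : TendstoInMeasure P (fun (n : ℕ) ω => (√(n : ℝ))⁻¹ * ‖F.eqError (z n 0 ω)‖) atTop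
        fun _ => 0 :=
      tendstoInMeasure_inv_sqrt_mul_norm hδ
        (fun n => (F.continuous_eqError.measurable.comp_aemeasurable
          (hz n 0 (by omega) le_rfl)).aestronglyMeasurable)
        (fun n => (hCi n).1 0 (by omega) le_rfl)
    have h2 : TendstoInMeasure P (fun (n : ℕ) ω => ∑ j ∈ Finset.range (k - 1),
        (√(n : ℝ))⁻¹ * ‖z n (-(j : ℤ)) ω - z n (-(j : ℤ) - 1) ω‖) atTop fun _ => 0 := by
      refine tendstoInMeasure_zero_sum _ fun j hj => ?_
      have hj' := Finset.mem_range.1 hj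
      exact tendstoInMeasure_inv_sqrt_mul_norm hδ
        (fun n => ((hz n _ (by omega) (by omega)).sub
          (hz n _ (by omega) (by omega))).aestronglyMeasurable)
        (fun n => (hCi n).2 (-(j : ℤ)) (by omega) (by omega))
    have h3 : IsStarStationary P (fun _ t ω => u t ω) :=
      isStarStationary_of_eLpNorm_le hδ (fun _ t ht => (hu t ht).aestronglyMeasurable)
        (fun _ t ht => hCu t ht)
    have h4 := tendstoInMeasure_zero_add (tendstoInMeasure_zero_add
      (tendstoInMeasure_zero_add h1 h2) tendstoInMeasure_inv_sqrt) h3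
    refine h4.congr_left fun n => Eventually.of_forall fun ω => ?_
    simp only [R, L, CKSVAR.KinkedFactorisation.initialSize, ← Finset.mul_sum]
    ring
  have hgood (n : ℕ) : ∀ᵐ ω ∂P, ∀ t : ℕ, t ≤ n →
        ‖F.eqError (z n t ω)‖ ≤ C * (F.initialSize (fun t => z n t ω) + 1 + L n ω) ∧
        ‖z n t ω - z n (t - 1) ω‖ ≤ C * (F.initialSize (fun t => z n t ω) + 1 + L n ω) ∧
        ∀ a : ℝ, 0 ≤ a → ‖a • z n t ω - F.trendMap (act (M.GammaOne (yPart Z₀)) Z₀ +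
            a • ∑ s ∈ Finset.Icc 1 t, u s ω)‖ ≤
          C * (a * (F.initialSize (fun t => z n t ω) + 1 + L n ω) + ‖a • z n 0 ω - Z₀‖) := by
    filter_upwards [hgen n] with ω hω
    exact hpath _ _ hω n (L n ω) (hL0 n ω) fun j hj =>
      norm_le_toReal_sup_nnnorm (f := fun t => u t ω) hj
  refine ⟨?_, ?_, ?_⟩
  · refine tendstoInMeasure_zero_of_le hC hR fun n => ?_
    filter_upwards [hgood n] with ω hω
    rw [abs_of_nonneg (hR0 n ω), abs_of_nonneg (by positivity), mul_left_comm]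
    refine mul_le_mul_of_nonneg_left (toReal_sup_nnnorm_le (mul_nonneg hC.le (hQ0 n ω)) ?_)
      (by positivity)
    exact fun t ht => (hω t (Finset.mem_Icc.1 ht).2).1
  · refine tendstoInMeasure_zero_of_le hC hR fun n => ?_
    filter_upwards [hgood n] with ω hω
    rw [abs_of_nonneg (hR0 n ω), abs_of_nonneg (by positivity), mul_left_comm]
    refine mul_le_mul_of_nonneg_left (toReal_sup_nnnorm_le (mul_nonneg hC.le (hQ0 n ω)) ?_)
      (by positivity)
    exact fun t ht => (hω t (Finset.mem_Icc.1 ht).2).2.1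
  · obtain ⟨K, hK, hKl⟩ := F.exists_norm_trendMap_sub_le hdet hdet0
    -- The limit is the pathwise image of U under this map: `trendMap` applied after adding the
    -- nonrandom part Γ(1; 𝒴₀) 𝒵₀ of U₀.
    let G : ZSpace m → ZSpace m := fun v => F.trendMap (act (M.GammaOne (yPart Z₀)) Z₀ + v)
    have hG : LipschitzWith ⟨K, hK.le⟩ G := LipschitzWith.of_dist_le_mul fun v v' => by
      rw [dist_eq_norm, dist_eq_norm]
      refine (hKl _ _).trans_eq ?_
      rw [add_sub_add_left_eq_sub]
      rfl
    refine ⟨fun ω => CadlagPath.map G hG.continuous (U ω), ?_, fun ω s => ?_⟩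
    -- Continuous mapping handles the image of the partial sums; the actual path differs from it
    -- uniformly by at most C (R + ‖n^(-1/2) z_0 - Z₀‖), which vanishes in probability.
    · refine (hUn.continuous_comp (CadlagPath.lipschitzWith_map hG).continuous).of_edist ?_ ?_
      · exact fun n => aemeasurable_stepPath fun j _ =>
          (hzm n j j (by omega) le_rfl).fun_const_smul _
      · intro ε hε
        have hD : TendstoInMeasure P (fun (n : ℕ) ω => ‖(√(n : ℝ))⁻¹ • z n 0 ω - Z₀‖) atTop
            fun _ => 0 := by
          rw [tendstoInMeasure_iff_norm] at hinit₀ ⊢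
          simpa using hinit₀
        have hsum := tendstoInMeasure_zero_add hR hD
        rw [tendstoInMeasure_iff_norm] at hsum
        refine tendsto_of_tendsto_of_tendsto_of_le_of_le tendsto_const_nhds
          (hsum (ε / C) (by positivity)) (fun n => zero_le) fun n => measure_mono_ae ?_
        filter_upwards [hgood n] with ω hω hmem
        by_contra hcon
        have hlt : C * (R n ω + ‖(√(n : ℝ))⁻¹ • z n 0 ω - Z₀‖) < ε := by
          have h1 : ¬ ε / C ≤ ‖R n ω + ‖(√(n : ℝ))⁻¹ • z n 0 ω - Z₀‖ - 0‖ := hcon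
          rw [sub_zero, Real.norm_of_nonneg (add_nonneg (hR0 n ω) (norm_nonneg _)), not_le,
            lt_div_iff₀' hC] at h1
          exact h1
        refine absurd hmem (not_lt.2 ?_)
        refine edist_stepPath_le (f := fun j => G ((√(n : ℝ))⁻¹ • ∑ t ∈ Finset.Icc 1 j, u t ω))
          fun j hj => ?_
        rw [edist_comm, edist_dist, dist_eq_norm]
        exact ENNReal.ofReal_le_ofReal (((hω j hj).2.2 _ (by positivity)).trans hlt.le)
    · have h1 : CadlagPath.map G hG.continuous (U ω) s = F.trendMap (U₀ ω s) := by
        rw [CadlagPath.map_apply, hU₀]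
      rw [h1, F.proj_yPart_trendMap hdet hdet0]
      exact ⟨rfl, rfl, F.sign_yPart_trendMap hdet hdet0 _⟩
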